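/- Work over $\Bbbk=\mathbb{C}$. Let $n\ge 2$, $q=e^{2\pi\sqrt{-1}/n}$ and $p=-e^{\pi\sqrt{-1}/n}$ (so $p^2=q$). Let $H=H_{2n^2}$ be Pansera's Hopf algebra: the algebra generated by $x,y,z$ with relations $$x^n=y^n=1,\quad xy=yx,\quad zx=yz,\quad zy=xz,\quad z^2=\frac1n\sum_{r,s=0}^{n-1}q^{-rs}x^ry^s,$$ where $x,y$ are grouplike, $S(x)=x^{-1}$, $S(y)=y^{-1}$, and $$\Delta(z)=\frac1n\sum_{r,s=0}^{n-1}q^{-rs}\,x^rz\otimes y^sz,\quad \varepsilon(z)=1,\quad S(z)=z.$$ Let $i,j$ be integers and $$A^+=\Bbbk\langle u,v\rangle/(p^{i^2-j^2}uv+vu),\qquad \deg u=\deg v=1,$$ with the $H$-module algebra structure determined by the representation $\pi_{i,j}$ on $\Bbbk u\oplus\Bbbk v$: $$xu=q^iu,\quad xv=q^jv,\quad yu=q^ju,\quad yv=q^iv,\quad zu=q^{ij}v,\quad zv=u.$$ Write $(A^+)^H=\{a: ha=\varepsilon(h)a \text{ for all } h\in H\}$, with the induced grading. The action is called inner-faithful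 if no non-zero Hopf ideal of $H$ annihilates $A^+$. A connected graded algebra $A$ is AS regular of dimension $d$ if it has global dimension $d<\infty$, has finite Gelfand-Kirillov dimension, and $\operatorname{Ext}^k_A(\Bbbk,A)=0$ for $k\ne d$ while $\operatorname{Ext}^d_A(\Bbbk,A)\cong\Bbbk$ up to a shift of degree; it is AS regular if this holds for some $d$. A finite-dimensional semisimple Hopf algebra acting inner-faithfully, and preserving the grading, on an AS regular module algebra $A$ is a reflection Hopf algebra for $A$ if $A^H$ is AS regular. **Theorem.** The algebra $A^+$ is AS regular of dimension $2$, and the action of $H$ on $A^+$ is inner-faithful if and only if $\gcd(i^2-j^2,n)=1$. Suppose that the action is inner-faithful. 1. If $n$ is even, then $(A^+)^H$ is the commutative polynomial ring $\Bbbk[u^n+(-1)^{ij}v^n,\;u^nv^n]$ on the two (algebraically independent) displayed generators, and $H_{2n^2}$ is a reflection Hopf algebra for $A^+$. 2. If $n$ is odd, then $(A^+)^H$ is the subalgebra of $A^+$ generated by $u^n+v^n$ and $u^nv^n(u^n-v^n)$; it is connected graded, and it is not AS regular. -/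

import Mathlib

open scoped TensorProduct

noncomputable section

/-- `q = e^{2πi/n}`. -/
def qRoot (n : ℕ) : ℂ := Complex.exp (2 * Real.pi * Complex.I / n)

/-- `p = -e^{πi/n}`, a square root of `q`. -/
def pRoot (n : ℕ) : ℂ := -Complex.exp (Real.pi * Complex.I / n)

/-- `(1/n) ∑_{r,s=0}^{n-1} q^{-rs} a^r b^s`. -/
def twistSum (n : ℕ) {B : Type} [Ring B] [Algebra ℂ B] (a b : B) : B :=
  (n : ℂ)⁻¹ • ∑ r ∈ Finset.range n, ∑ s ∈ Finset.range n,
    ((qRoot n)⁻¹ ^ (r * s)) • (a ^ r * b ^ s)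

namespace twistSum

/-- The idempotent `(1/n) ∑_s q^{-rs} b^s`. -/
def idem (n : ℕ) {B : Type} [Ring B] [Algebra ℂ B] (b : B) (r : ℕ) : B :=
  (n : ℂ)⁻¹ • ∑ s ∈ Finset.range n, ((qRoot n)⁻¹ ^ (r * s)) • b ^ s

theorem isPrimitiveRoot (n : ℕ) [NeZero n] : IsPrimitiveRoot (qRoot n) n :=
  Complex.isPrimitiveRoot_exp n (NeZero.ne n)

theorem qRoot_ne_zero (n : ℕ) : qRoot n ≠ 0 := Complex.exp_ne_zero _

section
variable {n : ℕ} {B C : Type} [Ring B] [Algebra ℂ B] [Ring C] [Algebra ℂ C]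

theorem eq_sum_idem (a b : B) :
    twistSum n a b = ∑ r ∈ Finset.range n, a ^ r * idem n b r := by
  simp only [twistSum, idem, Finset.smul_sum, Finset.mul_sum, mul_smul_comm]

theorem map (f : B →ₐ[ℂ] C) (a b : B) : f (twistSum n a b) = twistSum n (f a) (f b) := by
  simp [twistSum]

theorem commute_idem {a b : B} (h : Commute a b) (r : ℕ) : Commute a (idem n b r) := by
  unfold idem
  refine Commute.smul_right (Commute.sum_right _ _ _ fun s _ => ?_) _
  exact Commute.smul_right (h.pow_right s) _

theorem commute {c a b : B} (h : Commute c a) (h' : Commute c b) :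
    Commute c (twistSum n a b) := by
  rw [eq_sum_idem]
  exact Commute.sum_right _ _ _ fun r _ => (h.pow_right r).mul_right (commute_idem h' r)

theorem semiconj {z a b a' b' : B} (h : z * a = a' * z) (h' : z * b = b' * z) :
    z * twistSum n a b = twistSum n a' b' * z := by
  have key : ∀ r s : ℕ, z * (a ^ r * b ^ s) = (a' ^ r * b' ^ s) * z := fun r s =>
    ((show SemiconjBy z a a' from h).pow_right r).mul_right
      ((show SemiconjBy z b b' from h').pow_right s)
  simp only [twistSum, mul_smul_comm, smul_mul_assoc, Finset.mul_sum, Finset.sum_mul, key]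

theorem symm {a b : B} (h : Commute a b) : twistSum n a b = twistSum n b a := by
  unfold twistSum
  rw [Finset.sum_comm]
  congr 1
  refine Finset.sum_congr rfl fun r _ => Finset.sum_congr rfl fun s _ => ?_
  rw [mul_comm s r, (h.pow_pow s r).eq]

variable [NeZero n]

theorem mul_idem {b : B} (hb : b ^ n = 1) (r : ℕ) : b * idem n b r = qRoot n ^ r • idem n b r := by
  have hq := qRoot_ne_zero n
  obtain ⟨m, hm⟩ : ∃ m, n = m + 1 := ⟨n - 1, by have := NeZero.ne n; omega⟩
  have hqn : (qRoot n) ^ n = 1 := (isPrimitiveRoot n).pow_eq_one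
  have h1 : ∀ s : ℕ, b * ((qRoot n)⁻¹ ^ (r * s)) • b ^ s =
      qRoot n ^ r • (((qRoot n)⁻¹ ^ (r * (s + 1))) • b ^ (s + 1)) := by
    intro s
    rw [mul_smul_comm, smul_smul, pow_succ']
    congr 1
    rw [mul_add, pow_add, mul_one, inv_pow _ r]
    field_simp
  unfold idem
  rw [mul_smul_comm, smul_comm (qRoot n ^ r)]
  congr 1
  rw [Finset.mul_sum, Finset.smul_sum]
  simp only [h1]
  subst hm
  rw [Finset.sum_range_succ, Finset.sum_range_succ' _ m]
  congr 2
  rw [hb, mul_comm r, pow_mul, inv_pow, hqn]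
  simp

theorem pow_mul_idem {b : B} (hb : b ^ n = 1) (r s : ℕ) :
    b ^ s * idem n b r = qRoot n ^ (r * s) • idem n b r := by
  induction s with
  | zero => simp
  | succ s ih =>
    rw [pow_succ, mul_assoc, mul_idem hb, mul_smul_comm, ih, smul_smul, mul_add, pow_add, mul_one,
      mul_comm]

theorem idem_mul_idem {b : B} (hb : b ^ n = 1) {r r' : ℕ} (hr : r < n) (hr' : r' < n) :
    idem n b r' * idem n b r = if r' = r then idem n b r else 0 := by
  have hq := qRoot_ne_zero n
  have hn : (n : ℂ) ≠ 0 := by exact_mod_cast NeZero.ne n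
  have hqn : (qRoot n) ^ n = 1 := (isPrimitiveRoot n).pow_eq_one
  conv_lhs => rw [idem]
  rw [smul_mul_assoc, Finset.sum_mul]
  simp only [smul_mul_assoc, pow_mul_idem hb, smul_smul]
  rw [← Finset.sum_smul, smul_smul]
  have h2 : ∀ s : ℕ, (qRoot n)⁻¹ ^ (r' * s) * qRoot n ^ (r * s) =
      ((qRoot n)⁻¹ ^ r' * qRoot n ^ r) ^ s := fun s => by
    rw [mul_pow, pow_mul, pow_mul]
  simp only [h2]
  split_ifs with h
  · subst h
    rw [inv_pow, inv_mul_cancel₀ (pow_ne_zero _ hq)]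
    simp [hn]
  · have hne : (qRoot n)⁻¹ ^ r' * qRoot n ^ r ≠ 1 := by
      intro h3
      rw [inv_pow, inv_mul_eq_one₀ (pow_ne_zero _ hq)] at h3
      exact h ((isPrimitiveRoot n).pow_inj hr' hr h3)
    rw [geom_sum_eq hne, mul_pow, ← pow_mul, ← pow_mul, mul_comm r', mul_comm r, pow_mul, pow_mul,
      inv_pow, hqn]
    simp

theorem sum_idem (b : B) : ∑ r ∈ Finset.range n, idem n b r = 1 := by
  have hq := qRoot_ne_zero n
  have hn : (n : ℂ) ≠ 0 := by exact_mod_cast NeZero.ne n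
  unfold idem
  rw [← Finset.smul_sum, Finset.sum_comm]
  have h : ∀ s ∈ Finset.range n, ∑ r ∈ Finset.range n, (qRoot n)⁻¹ ^ (r * s) • b ^ s =
      if s = 0 then (n : ℂ) • (1 : B) else 0 := by
    intro s hs
    rw [← Finset.sum_smul]
    split_ifs with h0
    · subst h0; simp
    · have hne : (qRoot n)⁻¹ ^ s ≠ 1 :=
        (isPrimitiveRoot n).inv.pow_ne_one_of_pos_of_lt h0 (Finset.mem_range.mp hs)
      simp only [mul_comm _ s, pow_mul]
      rw [geom_sum_eq hne, ← pow_mul, mul_comm s, pow_mul, (isPrimitiveRoot n).inv.pow_eq_one]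
      simp
  rw [Finset.sum_congr rfl h, Finset.sum_ite_eq' (Finset.range n) 0]
  simp [NeZero.pos n, hn]

theorem one_left (b : B) : twistSum n 1 b = 1 := by
  simp [eq_sum_idem, sum_idem]

theorem root_left {b : B} (hb : b ^ n = 1) (k : ℕ) :
    twistSum n (algebraMap ℂ B (qRoot n ^ k)) b = b ^ k := by
  calc twistSum n (algebraMap ℂ B (qRoot n ^ k)) b
      = ∑ r ∈ Finset.range n, b ^ k * idem n b r := by
        rw [eq_sum_idem]
        refine Finset.sum_congr rfl fun r _ => ?_
        rw [pow_mul_idem hb, ← map_pow, ← Algebra.smul_def, ← pow_mul, mul_comm r k]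
    _ = b ^ k := by rw [← Finset.mul_sum, sum_idem, mul_one]

theorem mul_left {a a' b : B} (hb : b ^ n = 1) (h : Commute a a') (h' : Commute a' b) :
    twistSum n (a * a') b = twistSum n a b * twistSum n a' b := by
  simp only [eq_sum_idem]
  rw [Finset.sum_mul]
  refine Finset.sum_congr rfl fun r hr => ?_
  rw [Finset.mul_sum, Finset.sum_eq_single r]
  · rw [mul_assoc, ← mul_assoc (idem n b r), ← (commute_idem (h'.pow_left r) r).eq, mul_assoc,
      idem_mul_idem hb (Finset.mem_range.mp hr) (Finset.mem_range.mp hr), if_pos rfl, ← mul_assoc,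
      h.mul_pow]
  · intro r' hr' hne
    rw [mul_assoc, ← mul_assoc (idem n b r), ← (commute_idem (h'.pow_left r') r).eq, mul_assoc,
      idem_mul_idem hb (Finset.mem_range.mp hr') (Finset.mem_range.mp hr), if_neg (Ne.symm hne)]
    simp
  · exact fun h => absurd hr h

theorem mul_right {a b b' : B} (ha : a ^ n = 1) (h : Commute b b') (h1 : Commute a b)
    (h2 : Commute a b') :
    twistSum n a (b * b') = twistSum n a b * twistSum n a b' := by
  rw [symm (h1.mul_right h2), symm h1, symm h2, mul_left ha h h2.symm]

end

end twistSum

/-- The three generators of `H_{2n²}`. -/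
inductive PanseraGen : Type
  | x | y | z

/-- The defining relations: `⟨x⟩ × ⟨y⟩ ≅ ℤ/n × ℤ/n`, `z g = σ(g) z`, `z² = μ(J)`. -/
inductive PanseraRel (n : ℕ) : FreeAlgebra ℂ PanseraGen → FreeAlgebra ℂ PanseraGen → Prop
  | x_pow : PanseraRel n (FreeAlgebra.ι ℂ .x ^ n) 1
  | y_pow : PanseraRel n (FreeAlgebra.ι ℂ .y ^ n) 1
  | xy : PanseraRel n (FreeAlgebra.ι ℂ .x * FreeAlgebra.ι ℂ .y)
      (FreeAlgebra.ι ℂ .y * FreeAlgebra.ι ℂ .x)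
  | zx : PanseraRel n (FreeAlgebra.ι ℂ .z * FreeAlgebra.ι ℂ .x)
      (FreeAlgebra.ι ℂ .y * FreeAlgebra.ι ℂ .z)
  | zy : PanseraRel n (FreeAlgebra.ι ℂ .z * FreeAlgebra.ι ℂ .y)
      (FreeAlgebra.ι ℂ .x * FreeAlgebra.ι ℂ .z)
  | z_sq : PanseraRel n (FreeAlgebra.ι ℂ .z ^ 2)
      (twistSum n (FreeAlgebra.ι ℂ .x) (FreeAlgebra.ι ℂ .y))

/-- Pansera's algebra `H_{2n²} = ℂ[ℤ/n × ℤ/n][z; σ] / (z² - μ(J))`. -/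
def Pansera (n : ℕ) : Type := RingQuot (PanseraRel n)

namespace Pansera

instance instRing (n : ℕ) : Ring (Pansera n) := inferInstanceAs (Ring (RingQuot (PanseraRel n)))

instance instAlgebra (n : ℕ) : Algebra ℂ (Pansera n) :=
  inferInstanceAs (Algebra ℂ (RingQuot (PanseraRel n)))

/-- The quotient map from the free algebra. -/
def mk (n : ℕ) : FreeAlgebra ℂ PanseraGen →ₐ[ℂ] Pansera n := RingQuot.mkAlgHom ℂ (PanseraRel n)

/-- The generators of `H_{2n²}`. -/
def gen (n : ℕ) (g : PanseraGen) : Pansera n := mk n (FreeAlgebra.ι ℂ g)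

theorem mk_rel {n : ℕ} {a b : FreeAlgebra ℂ PanseraGen} (h : PanseraRel n a b) : mk n a = mk n b :=
  RingQuot.mkAlgHom_rel ℂ h

theorem mk_surjective (n : ℕ) : Function.Surjective (mk n) := RingQuot.mkAlgHom_surjective ℂ _

section
variable (n : ℕ)

theorem x_pow : gen n .x ^ n = 1 := by simpa [gen] using mk_rel (PanseraRel.x_pow (n := n))
theorem y_pow : gen n .y ^ n = 1 := by simpa [gen] using mk_rel (PanseraRel.y_pow (n := n))
theorem xy : Commute (gen n .x) (gen n .y) := by
  simpa [gen, Commute, SemiconjBy] using mk_rel (PanseraRel.xy (n := n))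
theorem zx : gen n .z * gen n .x = gen n .y * gen n .z := by
  simpa [gen] using mk_rel (PanseraRel.zx (n := n))
theorem zy : gen n .z * gen n .y = gen n .x * gen n .z := by
  simpa [gen] using mk_rel (PanseraRel.zy (n := n))
theorem z_sq : gen n .z * gen n .z = twistSum n (gen n .x) (gen n .y) := by
  simpa [gen, twistSum.map, pow_two] using mk_rel (PanseraRel.z_sq (n := n))

end

section
variable {n : ℕ} {B : Type} [Ring B] [Algebra ℂ B]

/-- The elements `x, y, z` satisfy the defining relations of `H_{2n²}`. -/
structure Rels (n : ℕ) {B : Type} [Ring B] [Algebra ℂ B] (x y z : B) : Prop where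
  hx : x ^ n = 1
  hy : y ^ n = 1
  hxy : x * y = y * x
  hzx : z * x = y * z
  hzy : z * y = x * z
  hz : z * z = twistSum n x y

/-- The universal property of `H_{2n²}`. -/
def lift (x y z : B) (H : Rels n x y z) : Pansera n →ₐ[ℂ] B :=
  RingQuot.liftAlgHom ℂ ⟨FreeAlgebra.lift ℂ (fun g => PanseraGen.casesOn g x y z), by
    intro a b h
    cases h <;> simp [twistSum.map, pow_two, H.hx, H.hy, H.hxy, H.hzx, H.hzy, H.hz]⟩

variable {x y z : B} (H : Rels n x y z)

theorem lift_mk (a : FreeAlgebra ℂ PanseraGen) : lift x y z H (mk n a) =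
    FreeAlgebra.lift ℂ (fun g => PanseraGen.casesOn g x y z) a :=
  RingQuot.liftAlgHom_mkAlgHom_apply ℂ _ _ _

@[simp] theorem lift_x : lift x y z H (gen n .x) = x := by simp [gen, lift_mk]
@[simp] theorem lift_y : lift x y z H (gen n .y) = y := by simp [gen, lift_mk]
@[simp] theorem lift_z : lift x y z H (gen n .z) = z := by simp [gen, lift_mk]

theorem hom_ext {f g : Pansera n →ₐ[ℂ] B} (hx : f (gen n .x) = g (gen n .x))
    (hy : f (gen n .y) = g (gen n .y)) (hz : f (gen n .z) = g (gen n .z)) : f = g := by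
  refine RingQuot.ringQuot_ext' (S := ℂ) f g (FreeAlgebra.hom_ext (funext fun a => ?_))
  cases a
  exacts [hx, hy, hz]

theorem induction {P : Pansera n → Prop} (h : Pansera n) (hC : ∀ c : ℂ, P (algebraMap ℂ _ c))
    (hx : P (gen n .x)) (hy : P (gen n .y)) (hz : P (gen n .z))
    (hmul : ∀ a b, P a → P b → P (a * b)) (hadd : ∀ a b, P a → P b → P (a + b)) : P h := by
  obtain ⟨a, rfl⟩ := mk_surjective n h
  induction a using FreeAlgebra.induction with
  | grade0 r => rw [AlgHom.commutes]; exact hC r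
  | grade1 g => cases g; exacts [hx, hy, hz]
  | mul a b ha hb => rw [map_mul]; exact hmul _ _ ha hb
  | add a b ha hb => rw [map_add]; exact hadd _ _ ha hb

end

section
variable (n : ℕ)

theorem pow_pred_pow {B : Type} [Monoid B] {a : B} (ha : a ^ n = 1) : (a ^ (n - 1)) ^ n = 1 := by
  rw [← pow_mul, mul_comm, pow_mul, ha, one_pow]

theorem twistSum_op (a b : Pansera n) :
    twistSum n (MulOpposite.op a) (MulOpposite.op b) = MulOpposite.op (twistSum n b a) := by
  unfold twistSum
  rw [Finset.sum_comm]
  simp [mul_comm]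

end

section
variable (n : ℕ) [NeZero n]

theorem comul_rels : Rels (B := Pansera n ⊗[ℂ] Pansera n) n
    (gen n .x ⊗ₜ gen n .x) (gen n .y ⊗ₜ gen n .y)
    (twistSum n (gen n .x ⊗ₜ 1) (1 ⊗ₜ gen n .y) * (gen n .z ⊗ₜ gen n .z)) := ⟨
    by simp [x_pow, Algebra.TensorProduct.one_def],
    by simp [y_pow, Algebra.TensorProduct.one_def],
    by simp [(xy n).eq],
    by
      rw [mul_assoc, Algebra.TensorProduct.tmul_mul_tmul, zx, ← Algebra.TensorProduct.tmul_mul_tmul,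
        ← mul_assoc, ← mul_assoc]
      congr 1
      refine (twistSum.commute ?_ ?_).eq.symm <;>
        simp [Commute, SemiconjBy, (xy n).eq],
    by
      rw [mul_assoc, Algebra.TensorProduct.tmul_mul_tmul, zy, ← Algebra.TensorProduct.tmul_mul_tmul,
        ← mul_assoc, ← mul_assoc]
      congr 1
      refine (twistSum.commute ?_ ?_).eq.symm <;>
        simp [Commute, SemiconjBy, (xy n).eq],
    by
      set x := gen n .x
      set y := gen n .y
      set z := gen n .z
      have hxy : x * y = y * x := (xy n).eq
      have hx : x ^ n = 1 := x_pow n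
      have hy : y ^ n = 1 := y_pow n
      have h1 : (z ⊗ₜ[ℂ] z) * twistSum n (x ⊗ₜ[ℂ] (1 : Pansera n)) ((1 : Pansera n) ⊗ₜ[ℂ] y) =
          twistSum n (y ⊗ₜ 1) (1 ⊗ₜ x) * (z ⊗ₜ z) :=
        twistSum.semiconj (by simp [x, y, z, zx]) (by simp [x, y, z, zy])
      have h2 : (z ⊗ₜ[ℂ] z) * (z ⊗ₜ[ℂ] z) =
          twistSum n (x ⊗ₜ 1) (y ⊗ₜ 1) * twistSum n (1 ⊗ₜ x) (1 ⊗ₜ y) := by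
        have e1 := twistSum.map (n := n)
          (Algebra.TensorProduct.includeLeft : Pansera n →ₐ[ℂ] Pansera n ⊗[ℂ] Pansera n) x y
        have e2 := twistSum.map (n := n)
          (Algebra.TensorProduct.includeRight : Pansera n →ₐ[ℂ] Pansera n ⊗[ℂ] Pansera n) x y
        simp only [Algebra.TensorProduct.includeLeft_apply,
          Algebra.TensorProduct.includeRight_apply] at e1 e2
        rw [← e1, ← e2, Algebra.TensorProduct.tmul_mul_tmul, Algebra.TensorProduct.tmul_mul_tmul,
          z_sq, mul_one, one_mul]
      have h3 : x ⊗ₜ[ℂ] x = (x ⊗ₜ 1) * (1 ⊗ₜ x) := by simp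
      have h4 : y ⊗ₜ[ℂ] y = (y ⊗ₜ 1) * (1 ⊗ₜ y) := by simp
      have c1 : (x ⊗ₜ[ℂ] (1 : Pansera n)) ^ n = 1 := by
        simp [hx, Algebra.TensorProduct.one_def]
      have c2 : ((1 : Pansera n) ⊗ₜ[ℂ] x) ^ n = 1 := by
        simp [hx, Algebra.TensorProduct.one_def]
      have c3 : (y ⊗ₜ[ℂ] y) ^ n = 1 := by
        simp [hy, Algebra.TensorProduct.one_def]
      rw [mul_assoc, ← mul_assoc (z ⊗ₜ z), h1, mul_assoc, h2, h3,
        twistSum.mul_left c3 (by simp [Commute, SemiconjBy]) (by simp [Commute, SemiconjBy, hxy]),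
        h4, twistSum.mul_right c1 (by simp [Commute, SemiconjBy])
          (by simp [Commute, SemiconjBy, hxy]) (by simp [Commute, SemiconjBy]),
        twistSum.mul_right c2 (by simp [Commute, SemiconjBy])
          (by simp [Commute, SemiconjBy]) (by simp [Commute, SemiconjBy, hxy]),
        twistSum.symm (a := (y ⊗ₜ[ℂ] (1 : Pansera n))) (b := (1 : Pansera n) ⊗ₜ[ℂ] x)
          (by simp [Commute, SemiconjBy])]
      set a := twistSum n (x ⊗ₜ[ℂ] (1 : Pansera n)) ((1 : Pansera n) ⊗ₜ[ℂ] y)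
      set b := twistSum n ((1 : Pansera n) ⊗ₜ[ℂ] x) (y ⊗ₜ[ℂ] (1 : Pansera n))
      set c := twistSum n (x ⊗ₜ[ℂ] (1 : Pansera n)) (y ⊗ₜ[ℂ] (1 : Pansera n)) with hc
      set d := twistSum n ((1 : Pansera n) ⊗ₜ[ℂ] x) ((1 : Pansera n) ⊗ₜ[ℂ] y)
      have hbc : Commute c b := by
        refine twistSum.commute ?_ ?_ <;> refine Commute.symm (twistSum.commute ?_ ?_) <;>
          simp [Commute, SemiconjBy, hxy]
      have hac : Commute c a := by
        refine twistSum.commute ?_ ?_ <;> refine Commute.symm (twistSum.commute ?_ ?_) <;>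
          simp [Commute, SemiconjBy, hxy]
      rw [← mul_assoc b, ← hbc.eq, mul_assoc c, ← mul_assoc a, ← hac.eq, mul_assoc]⟩

/-- The comultiplication: `x ↦ x ⊗ x`, `y ↦ y ⊗ y`, `z ↦ J (z ⊗ z)`. -/
def comulHom : Pansera n →ₐ[ℂ] Pansera n ⊗[ℂ] Pansera n := lift _ _ _ (comul_rels n)

/-- The counit: `x, y, z ↦ 1`. -/
def counitHom : Pansera n →ₐ[ℂ] ℂ :=
  lift 1 1 1 ⟨by simp, by simp, by simp, by simp, by simp, by simp [twistSum.one_left]⟩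

@[simp] theorem comulHom_x : comulHom n (gen n .x) = gen n .x ⊗ₜ gen n .x :=
  lift_x (comul_rels n)
@[simp] theorem comulHom_y : comulHom n (gen n .y) = gen n .y ⊗ₜ gen n .y :=
  lift_y (comul_rels n)
@[simp] theorem comulHom_z : comulHom n (gen n .z) =
    twistSum n (gen n .x ⊗ₜ 1) (1 ⊗ₜ gen n .y) * (gen n .z ⊗ₜ gen n .z) :=
  lift_z (comul_rels n)
@[simp] theorem counitHom_x : counitHom n (gen n .x) = 1 :=
  lift_x _
@[simp] theorem counitHom_y : counitHom n (gen n .y) = 1 :=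
  lift_y _
@[simp] theorem counitHom_z : counitHom n (gen n .z) = 1 :=
  lift_z _

theorem coassoc_z :
    (Algebra.TensorProduct.assoc ℂ ℂ ℂ (Pansera n) (Pansera n) (Pansera n)).toAlgHom.comp
      ((Algebra.TensorProduct.map (comulHom n) (.id ℂ (Pansera n))).comp (comulHom n)) (gen n .z) =
    (Algebra.TensorProduct.map (.id ℂ (Pansera n)) (comulHom n)).comp (comulHom n) (gen n .z) := by
  have hxy : gen n .x * gen n .y = gen n .y * gen n .x := (xy n).eq
  have hx : gen n .x ^ n = 1 := x_pow n
  have hy : gen n .y ^ n = 1 := y_pow n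
  have eL := twistSum.map (n := n) ((Algebra.TensorProduct.assoc ℂ ℂ ℂ (Pansera n) (Pansera n)
    (Pansera n)).toAlgHom.comp Algebra.TensorProduct.includeLeft)
    (gen n .x ⊗ₜ[ℂ] (1 : Pansera n)) ((1 : Pansera n) ⊗ₜ[ℂ] gen n .y)
  have eR := twistSum.map (n := n) (Algebra.TensorProduct.includeRight :
    Pansera n ⊗[ℂ] Pansera n →ₐ[ℂ] Pansera n ⊗[ℂ] (Pansera n ⊗[ℂ] Pansera n))
    (gen n .x ⊗ₜ[ℂ] (1 : Pansera n)) ((1 : Pansera n) ⊗ₜ[ℂ] gen n .y)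
  simp only [AlgHom.comp_apply, comulHom_z, map_mul, twistSum.map,
    Algebra.TensorProduct.map_tmul, AlgHom.id_apply, map_one, comulHom_x, comulHom_y]
  have zL : (twistSum n (gen n .x ⊗ₜ[ℂ] (1 : Pansera n)) ((1 : Pansera n) ⊗ₜ[ℂ] gen n .y) *
        gen n .z ⊗ₜ[ℂ] gen n .z) ⊗ₜ[ℂ] gen n .z =
      (twistSum n (gen n .x ⊗ₜ[ℂ] (1 : Pansera n)) ((1 : Pansera n) ⊗ₜ[ℂ] gen n .y) ⊗ₜ[ℂ] 1) *
        ((gen n .z ⊗ₜ[ℂ] gen n .z) ⊗ₜ[ℂ] gen n .z) := by simp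
  have zR : gen n .z ⊗ₜ[ℂ] (twistSum n (gen n .x ⊗ₜ[ℂ] (1 : Pansera n))
        ((1 : Pansera n) ⊗ₜ[ℂ] gen n .y) * gen n .z ⊗ₜ[ℂ] gen n .z) =
      (1 ⊗ₜ[ℂ] twistSum n (gen n .x ⊗ₜ[ℂ] (1 : Pansera n)) ((1 : Pansera n) ⊗ₜ[ℂ] gen n .y)) *
        (gen n .z ⊗ₜ[ℂ] (gen n .z ⊗ₜ[ℂ] gen n .z)) := by simp
  rw [zL, zR, map_mul]
  have hA : ∀ a b c : Pansera n, (Algebra.TensorProduct.assoc ℂ ℂ ℂ (Pansera n) (Pansera n)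
      (Pansera n)).toAlgHom ((a ⊗ₜ[ℂ] b) ⊗ₜ[ℂ] c) = a ⊗ₜ[ℂ] (b ⊗ₜ[ℂ] c) := fun _ _ _ => rfl
  simp only [AlgHom.comp_apply, Algebra.TensorProduct.includeLeft_apply,
    Algebra.TensorProduct.includeRight_apply, Algebra.TensorProduct.one_def, hA] at eL eR ⊢
  rw [eL, eR, ← mul_assoc, ← mul_assoc]
  congr 1
  have e1 : gen n .x ⊗ₜ[ℂ] (gen n .x ⊗ₜ[ℂ] (1 : Pansera n)) =
      (gen n .x ⊗ₜ[ℂ] ((1 : Pansera n) ⊗ₜ[ℂ] (1 : Pansera n))) *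
        ((1 : Pansera n) ⊗ₜ[ℂ] (gen n .x ⊗ₜ[ℂ] (1 : Pansera n))) := by simp
  have e2 : (1 : Pansera n) ⊗ₜ[ℂ] (gen n .y ⊗ₜ[ℂ] gen n .y) =
      ((1 : Pansera n) ⊗ₜ[ℂ] (gen n .y ⊗ₜ[ℂ] (1 : Pansera n))) *
        ((1 : Pansera n) ⊗ₜ[ℂ] ((1 : Pansera n) ⊗ₜ[ℂ] gen n .y)) := by simp
  have c1 : ((1 : Pansera n) ⊗ₜ[ℂ] ((1 : Pansera n) ⊗ₜ[ℂ] gen n .y)) ^ n = 1 := by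
    simp [hy, Algebra.TensorProduct.one_def]
  have c2 : (gen n .x ⊗ₜ[ℂ] ((1 : Pansera n) ⊗ₜ[ℂ] (1 : Pansera n))) ^ n = 1 := by
    simp [hx, Algebra.TensorProduct.one_def]
  simp only [Algebra.TensorProduct.one_def] at *
  rw [e1, twistSum.mul_left c1 (by simp [Commute, SemiconjBy])
      (by simp [Commute, SemiconjBy]), e2,
    twistSum.mul_right c2 (by simp [Commute, SemiconjBy])
      (by simp [Commute, SemiconjBy]) (by simp [Commute, SemiconjBy])]
  set a := twistSum n (gen n .x ⊗ₜ[ℂ] ((1 : Pansera n) ⊗ₜ[ℂ] (1 : Pansera n)))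
    ((1 : Pansera n) ⊗ₜ[ℂ] ((1 : Pansera n) ⊗ₜ[ℂ] gen n .y))
  set b := twistSum n (gen n .x ⊗ₜ[ℂ] ((1 : Pansera n) ⊗ₜ[ℂ] (1 : Pansera n)))
    ((1 : Pansera n) ⊗ₜ[ℂ] (gen n .y ⊗ₜ[ℂ] (1 : Pansera n)))
  set c := twistSum n ((1 : Pansera n) ⊗ₜ[ℂ] (gen n .x ⊗ₜ[ℂ] (1 : Pansera n)))
    ((1 : Pansera n) ⊗ₜ[ℂ] ((1 : Pansera n) ⊗ₜ[ℂ] gen n .y))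
  have hab : Commute a b := by
    refine twistSum.commute ?_ ?_ <;> refine Commute.symm (twistSum.commute ?_ ?_) <;>
      simp [Commute, SemiconjBy]
  have hac : Commute c a := by
    refine twistSum.commute ?_ ?_ <;> refine Commute.symm (twistSum.commute ?_ ?_) <;>
      simp [Commute, SemiconjBy]
  have hbc : Commute b c := by
    refine twistSum.commute ?_ ?_ <;> refine Commute.symm (twistSum.commute ?_ ?_) <;>
      simp [Commute, SemiconjBy, hxy]
  rw [mul_assoc, ← hbc.eq, ← mul_assoc, hab.eq]

/-- The bialgebra structure of `H_{2n²}`. -/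
instance instBialgebra : Bialgebra ℂ (Pansera n) :=
  Bialgebra.ofAlgHom (comulHom n) (counitHom n)
    (hom_ext (by simp) (by simp) (coassoc_z n))
    (hom_ext (by simp) (by simp) (by
      have h : twistSum n ((1 : ℂ) ⊗ₜ[ℂ] (1 : Pansera n)) ((1 : ℂ) ⊗ₜ[ℂ] gen n .y) = 1 := by
        rw [← Algebra.TensorProduct.one_def, twistSum.one_left]
      simp [twistSum.map, h]))
    (hom_ext (by simp) (by simp) (by
      have h : twistSum n (gen n .x ⊗ₜ[ℂ] (1 : ℂ)) ((1 : Pansera n) ⊗ₜ[ℂ] (1 : ℂ)) = 1 := by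
        rw [twistSum.symm (by simp [Commute, SemiconjBy]), ← Algebra.TensorProduct.one_def,
          twistSum.one_left]
      simp [twistSum.map, h]))

theorem comul_apply (h : Pansera n) : Coalgebra.comul (R := ℂ) h = comulHom n h := rfl

theorem counit_apply (h : Pansera n) : Coalgebra.counit (R := ℂ) h = counitHom n h := rfl

theorem pow_pred_mul {B : Type} [Monoid B] {a : B} (ha : a ^ n = 1) : a ^ (n - 1) * a = 1 := by
  rw [← pow_succ, Nat.sub_add_cancel (NeZero.pos n), ha]

theorem mul_pow_pred {B : Type} [Monoid B] {a : B} (ha : a ^ n = 1) : a * a ^ (n - 1) = 1 := by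
  rw [← pow_succ', Nat.sub_add_cancel (NeZero.pos n), ha]

theorem twistSum_inv_inv {B : Type} [Ring B] [Algebra ℂ B] {a b : B} (ha : a ^ n = 1)
    (hb : b ^ n = 1) (h : Commute a b) :
    twistSum n (a ^ (n - 1)) (b ^ (n - 1)) = twistSum n a b := by
  have hb' := pow_pred_pow n hb
  have h1 : twistSum n (a ^ (n - 1)) (b ^ (n - 1)) * twistSum n a (b ^ (n - 1)) = 1 := by
    rw [← twistSum.mul_left hb' ((Commute.refl a).pow_left _) (h.pow_right _),
      pow_pred_mul n ha, twistSum.one_left]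
  have h2 : twistSum n a (b ^ (n - 1)) * twistSum n a b = 1 := by
    rw [← twistSum.mul_right ha ((Commute.refl b).pow_left _) (h.pow_right _) h,
      pow_pred_mul n hb, twistSum.symm (Commute.one_right a), twistSum.one_left]
  exact left_inv_eq_right_inv h1 h2

/-- The antipode as an anti-homomorphism: `x ↦ x⁻¹`, `y ↦ y⁻¹`, `z ↦ z`. -/
def antipodeHom : Pansera n →ₐ[ℂ] (Pansera n)ᵐᵒᵖ :=
  lift (MulOpposite.op (gen n .x ^ (n - 1))) (MulOpposite.op (gen n .y ^ (n - 1)))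
    (MulOpposite.op (gen n .z))
    { hx := by rw [← MulOpposite.op_pow, pow_pred_pow n (x_pow n), MulOpposite.op_one]
      hy := by rw [← MulOpposite.op_pow, pow_pred_pow n (y_pow n), MulOpposite.op_one]
      hxy := by rw [← MulOpposite.op_mul, ← MulOpposite.op_mul, ((xy n).pow_pow _ _).eq]
      hzx := by
        rw [← MulOpposite.op_mul, ← MulOpposite.op_mul]
        exact congrArg _ ((show SemiconjBy (gen n .z) _ _ from zy n).pow_right (n - 1)).eq.symm
      hzy := by
        rw [← MulOpposite.op_mul, ← MulOpposite.op_mul]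
        exact congrArg _ ((show SemiconjBy (gen n .z) _ _ from zx n).pow_right (n - 1)).eq.symm
      hz := by
        rw [twistSum_op, twistSum_inv_inv n (y_pow n) (x_pow n) (xy n).symm,
          ← twistSum.symm (xy n), ← z_sq, MulOpposite.op_mul] }

/-- The antipode of `H_{2n²}`. -/
def antipodeMap : Pansera n →ₗ[ℂ] Pansera n :=
  (MulOpposite.opLinearEquiv ℂ).symm.toLinearMap ∘ₗ (antipodeHom n).toLinearMap

@[simp] theorem antipodeMap_x : antipodeMap n (gen n .x) = gen n .x ^ (n - 1) := by
  simp [antipodeMap, antipodeHom]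
@[simp] theorem antipodeMap_y : antipodeMap n (gen n .y) = gen n .y ^ (n - 1) := by
  simp [antipodeMap, antipodeHom]
@[simp] theorem antipodeMap_z : antipodeMap n (gen n .z) = gen n .z := by
  simp [antipodeMap, antipodeHom]
theorem antipodeMap_mul (a b : Pansera n) :
    antipodeMap n (a * b) = antipodeMap n b * antipodeMap n a := by simp [antipodeMap]
theorem antipodeMap_algebraMap (c : ℂ) :
    antipodeMap n (algebraMap ℂ _ c) = algebraMap ℂ _ c := by simp [antipodeMap]

theorem antipode_left_mul (t : Pansera n ⊗[ℂ] Pansera n) (a b : Pansera n) :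
    LinearMap.mul' ℂ (Pansera n) ((antipodeMap n).rTensor _ (t * (a ⊗ₜ b))) =
      antipodeMap n a * LinearMap.mul' ℂ (Pansera n) ((antipodeMap n).rTensor _ t) * b := by
  induction t with
  | zero => simp
  | tmul c d => simp [antipodeMap_mul, mul_assoc]
  | add c d hc hd => simp only [add_mul, map_add, hc, hd, mul_add]

theorem antipode_right_mul (t : Pansera n ⊗[ℂ] Pansera n) (a b : Pansera n) :
    LinearMap.mul' ℂ (Pansera n) ((antipodeMap n).lTensor _ ((a ⊗ₜ b) * t)) =
      a * LinearMap.mul' ℂ (Pansera n) ((antipodeMap n).lTensor _ t) * antipodeMap n b := by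
  induction t with
  | zero => simp
  | tmul c d => simp [antipodeMap_mul, mul_assoc]
  | add c d hc hd => simp only [mul_add, map_add, hc, hd, add_mul]

theorem antipodeMap_pow {a b : Pansera n} (h : antipodeMap n a = b) (r : ℕ) :
    antipodeMap n (a ^ r) = b ^ r := by
  induction r with
  | zero => simpa using antipodeMap_algebraMap n 1
  | succ r ih => rw [pow_succ, antipodeMap_mul, ih, h, ← pow_succ']

theorem antipode_left (h : Pansera n) :
    LinearMap.mul' ℂ (Pansera n) ((antipodeMap n).rTensor _ (comulHom n h)) =
      algebraMap ℂ _ (counitHom n h) := by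
  induction h using induction with
  | hC c => simp [Algebra.TensorProduct.algebraMap_apply, antipodeMap_algebraMap]
  | hx => simp [pow_pred_mul n (x_pow n)]
  | hy => simp [pow_pred_mul n (y_pow n)]
  | hz =>
    have key : ∀ r s : ℕ, LinearMap.mul' ℂ (Pansera n) ((antipodeMap n).rTensor _
        ((gen n .x ⊗ₜ[ℂ] (1 : Pansera n)) ^ r * ((1 : Pansera n) ⊗ₜ[ℂ] gen n .y) ^ s *
          (gen n .z ⊗ₜ[ℂ] gen n .z))) =
        ((gen n .y ^ (n - 1)) ^ r * gen n .x ^ s) * (gen n .z * gen n .z) := by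
      intro r s
      have e1 := antipodeMap_pow n (antipodeMap_x n)
      have e2 : gen n .z * (gen n .x ^ (n - 1)) ^ r = (gen n .y ^ (n - 1)) ^ r * gen n .z :=
        (((show SemiconjBy (gen n .z) _ _ from zx n).pow_right (n - 1)).pow_right r).eq
      have e3 : gen n .z * gen n .y ^ s = gen n .x ^ s * gen n .z :=
        ((show SemiconjBy (gen n .z) _ _ from zy n).pow_right s).eq
      simp only [Algebra.TensorProduct.tmul_pow, one_pow, Algebra.TensorProduct.tmul_mul_tmul,
        one_mul, mul_one, LinearMap.rTensor_tmul, LinearMap.mul'_apply, antipodeMap_mul, e1,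
        antipodeMap_z]
      rw [e2, mul_assoc, ← mul_assoc (gen n .z), e3]
      simp only [mul_assoc]
    have h1 : LinearMap.mul' ℂ (Pansera n) ((antipodeMap n).rTensor _ (comulHom n (gen n .z))) =
        twistSum n (gen n .y ^ (n - 1)) (gen n .x) * (gen n .z * gen n .z) := by
      rw [comulHom_z]
      simp only [twistSum, smul_mul_assoc, Finset.sum_mul, map_smul, map_sum, key]
    rw [h1, z_sq, twistSum.symm (xy n),
      ← twistSum.mul_left (x_pow n) ((Commute.refl _).pow_left _) (xy n).symm,
      pow_pred_mul n (y_pow n), twistSum.one_left]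
    simp
  | hmul a b ha hb =>
    rw [map_mul (comulHom n), map_mul (counitHom n), map_mul (algebraMap ℂ (Pansera n)), ← hb]
    generalize comulHom n b = t
    induction t with
    | zero => simp
    | tmul c d => rw [antipode_left_mul, ha, ← Algebra.commutes]; simp [mul_assoc]
    | add c d hc hd => simp only [mul_add, map_add, hc, hd]
  | hadd a b ha hb => simp [ha, hb]

theorem antipode_right (h : Pansera n) :
    LinearMap.mul' ℂ (Pansera n) ((antipodeMap n).lTensor _ (comulHom n h)) =
      algebraMap ℂ _ (counitHom n h) := by
  induction h using induction with
  | hC c => 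
    have h1 : antipodeMap n 1 = 1 := by simpa using antipodeMap_algebraMap n 1
    simp [Algebra.TensorProduct.algebraMap_apply, h1]
  | hx => simp [mul_pow_pred n (x_pow n)]
  | hy => simp [mul_pow_pred n (y_pow n)]
  | hz =>
    have key : ∀ r s : ℕ, LinearMap.mul' ℂ (Pansera n) ((antipodeMap n).lTensor _
        ((gen n .x ⊗ₜ[ℂ] (1 : Pansera n)) ^ r * ((1 : Pansera n) ⊗ₜ[ℂ] gen n .y) ^ s *
          (gen n .z ⊗ₜ[ℂ] gen n .z))) =
        (gen n .x ^ r * (gen n .y ^ (n - 1)) ^ s) * (gen n .z * gen n .z) := by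
      intro r s
      have e1 := antipodeMap_pow n (antipodeMap_y n)
      have e2 : gen n .z * (gen n .y ^ (n - 1)) ^ s = (gen n .x ^ (n - 1)) ^ s * gen n .z :=
        (((show SemiconjBy (gen n .z) _ _ from zy n).pow_right (n - 1)).pow_right s).eq
      have e3 : gen n .z * (gen n .x ^ (n - 1)) ^ s = (gen n .y ^ (n - 1)) ^ s * gen n .z :=
        (((show SemiconjBy (gen n .z) _ _ from zx n).pow_right (n - 1)).pow_right s).eq
      simp only [Algebra.TensorProduct.tmul_pow, one_pow, Algebra.TensorProduct.tmul_mul_tmul,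
        one_mul, mul_one, LinearMap.lTensor_tmul, LinearMap.mul'_apply, antipodeMap_mul, e1,
        antipodeMap_z]
      rw [mul_assoc, e2, ← mul_assoc (gen n .z), e3]
      simp only [mul_assoc]
    have h1 : LinearMap.mul' ℂ (Pansera n) ((antipodeMap n).lTensor _ (comulHom n (gen n .z))) =
        twistSum n (gen n .x) (gen n .y ^ (n - 1)) * (gen n .z * gen n .z) := by
      rw [comulHom_z]
      simp only [twistSum, smul_mul_assoc, Finset.sum_mul, map_smul, map_sum, key]
    rw [h1, z_sq, ← twistSum.mul_right (x_pow n) ((Commute.refl _).pow_left _)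
      ((xy n).pow_right _) (xy n), pow_pred_mul n (y_pow n),
      twistSum.symm (Commute.one_right _), twistSum.one_left]
    simp
  | hmul a b ha hb =>
    rw [map_mul (comulHom n), map_mul (counitHom n), map_mul (algebraMap ℂ (Pansera n)), ← ha]
    generalize comulHom n a = t
    induction t with
    | zero => simp
    | tmul c d => rw [antipode_right_mul, hb, mul_assoc, Algebra.commutes]; simp [mul_assoc]
    | add c d hc hd => simp only [add_mul, map_add, hc, hd]
  | hadd a b ha hb => simp [ha, hb]

/-- The Hopf algebra structure of `H_{2n²}`. -/
instance instHopfAlgebra : HopfAlgebra ℂ (Pansera n) where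
  antipode := antipodeMap n
  mul_antipode_rTensor_comul := LinearMap.ext (antipode_left n)
  mul_antipode_lTensor_comul := LinearMap.ext (antipode_right n)

theorem antipode_apply (h : Pansera n) : HopfAlgebra.antipode ℂ h = antipodeMap n h := rfl

end

end Pansera

/-- `H` acts on `A` so that `A` is an `H`-module algebra:
`h · (ab) = ∑ (h₁ · a)(h₂ · b)` and `h · 1 = ε(h) 1`. -/
class IsModuleAlgebra (H A : Type) [Ring H] [Bialgebra ℂ H] [Ring A] [Algebra ℂ A]
    [Module H A] [IsScalarTower ℂ H A] : Prop where
  smul_mul : ∀ (h : H) (a b : A), h • (a * b) =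
    LinearMap.mul' ℂ A (TensorProduct.map
      ((LinearMap.toSpanSingleton H A a).restrictScalars ℂ)
      ((LinearMap.toSpanSingleton H A b).restrictScalars ℂ) (Coalgebra.comul (R := ℂ) h))
  smul_one : ∀ h : H, h • (1 : A) = algebraMap ℂ A (Coalgebra.counit (R := ℂ) h)

section
variable (H A : Type) [Ring H] [Ring A] [Algebra ℂ A] [Module H A]

/-- The fixed ring `A^H = {a | h · a = ε(h) a for all h}`. -/
def fixedRing [Bialgebra ℂ H] [IsScalarTower ℂ H A] [IsModuleAlgebra H A] : Subalgebra ℂ A where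
  carrier := {a | ∀ h : H, h • a = Coalgebra.counit (R := ℂ) h • a}
  mul_mem' := by
    intro a b ha hb h
    have ha' : ∀ h : H, h • a = Coalgebra.counit (R := ℂ) h • a := ha
    have hb' : ∀ h : H, h • b = Coalgebra.counit (R := ℂ) h • b := hb
    rw [IsModuleAlgebra.smul_mul]
    have e : ∀ t : H ⊗[ℂ] H, LinearMap.mul' ℂ A (TensorProduct.map
        ((LinearMap.toSpanSingleton H A a).restrictScalars ℂ)
        ((LinearMap.toSpanSingleton H A b).restrictScalars ℂ) t) =
        Coalgebra.counit (R := ℂ) (TensorProduct.lid ℂ H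
          ((Coalgebra.counit (R := ℂ) (A := H)).rTensor H t)) • (a * b) := by
      intro t
      induction t with
      | zero => simp
      | tmul c d =>
        simp [ha' c, hb' d, smul_smul, mul_comm]
      | add c d hc hd => simp only [map_add, hc, hd, add_smul]
    rw [e]
    simp
  add_mem' := by
    intro a b ha hb h
    rw [smul_add, smul_add, ha h, hb h]
  algebraMap_mem' := by
    intro c h
    have h1 : (algebraMap ℂ A c) = algebraMap ℂ H c • (1 : A) := by
      rw [IsScalarTower.algebraMap_smul, Algebra.algebraMap_eq_smul_one]
    have h2 : h • (algebraMap ℂ H c • (1 : A)) = algebraMap ℂ H c • h • (1 : A) := by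
      rw [smul_smul, smul_smul, Algebra.commutes]
    rw [h1, h2, IsModuleAlgebra.smul_one, IsScalarTower.algebraMap_smul,
      IsScalarTower.algebraMap_smul, Algebra.algebraMap_eq_smul_one, smul_comm]

/-- The action of `H` on `A` is inner-faithful: the only Hopf ideal of `H` annihilating `A`
is zero. -/
def IsInnerFaithful [HopfAlgebra ℂ H] : Prop :=
  ∀ I : Ideal H, I.IsTwoSided → I.IsHopfIdeal ℂ → (∀ h ∈ I, ∀ a : A, h • a = 0) → I = ⊥

end

theorem qRoot_zpow_pow (n : ℕ) [NeZero n] (i : ℤ) : (qRoot n ^ i) ^ n = 1 := by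
  rw [← zpow_natCast, zpow_comm, zpow_natCast, (twistSum.isPrimitiveRoot n).pow_eq_one, one_zpow]

theorem twistSum_zpow (n : ℕ) [NeZero n] (i j : ℤ) :
    twistSum n (qRoot n ^ i) (qRoot n ^ j) = qRoot n ^ (i * j) := by
  have hn : (n : ℤ) ≠ 0 := by exact_mod_cast NeZero.ne n
  have hq := twistSum.qRoot_ne_zero n
  have hqn : (qRoot n) ^ n = 1 := (twistSum.isPrimitiveRoot n).pow_eq_one
  obtain ⟨k, hk⟩ : ∃ k : ℕ, i % n = k := ⟨_, (Int.toNat_of_nonneg (Int.emod_nonneg i hn)).symm⟩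
  have h1 : qRoot n ^ i = qRoot n ^ k := by
    rw [← Int.mul_ediv_add_emod i n, hk, zpow_add₀ hq, zpow_mul, zpow_natCast, hqn, one_zpow,
      one_mul, zpow_natCast]
  rw [h1]
  refine (twistSum.root_left (qRoot_zpow_pow n j) k).trans ?_
  rw [← zpow_natCast, ← zpow_mul, mul_comm, zpow_mul, zpow_natCast, ← h1, ← zpow_mul]

theorem twistSum_diagonal (n : ℕ) (d e : Fin 2 → ℂ) :
    twistSum n (Matrix.diagonal d) (Matrix.diagonal e) =
      Matrix.diagonal (fun k => twistSum n (d k) (e k)) := by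
  have h1 := twistSum.map (n := n) (Matrix.diagonalAlgHom ℂ (n := Fin 2) (α := ℂ)) d e
  simp only [Matrix.diagonalAlgHom_apply] at h1
  rw [← h1]
  congr 1
  funext k
  exact twistSum.map (n := n) (Pi.evalAlgHom ℂ (fun _ : Fin 2 => ℂ) k) d e

namespace Pansera

theorem rep_rels (n : ℕ) [NeZero n] (i j : ℤ) : Rels (B := Matrix (Fin 2) (Fin 2) ℂ) n
    !![qRoot n ^ i, 0; 0, qRoot n ^ j] !![qRoot n ^ j, 0; 0, qRoot n ^ i]
    !![0, 1; qRoot n ^ (i * j), 0] := by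
  have e : ∀ a b : ℂ, !![a, 0; 0, b] = Matrix.diagonal ![a, b] := fun a b => by
    ext r s; fin_cases r <;> fin_cases s <;> rfl
  have hp : ∀ a b : ℤ, Matrix.diagonal ![qRoot n ^ a, qRoot n ^ b] ^ n = 1 := fun a b => by
    rw [Matrix.diagonal_pow, ← Matrix.diagonal_one]
    congr 1
    funext k
    fin_cases k
    exacts [qRoot_zpow_pow n a, qRoot_zpow_pow n b]
  refine ⟨by rw [e, hp], by rw [e, hp], ?_, ?_, ?_, ?_⟩
  · simp [mul_comm]
  · simp [mul_comm]
  · simp [mul_comm]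
  · rw [e, e, twistSum_diagonal]
    ext r s
    fin_cases r <;> fin_cases s <;> simp [twistSum_zpow, mul_comm]

/-- The representation `π_{i,j}`. -/
def rep (n : ℕ) [NeZero n] (i j : ℤ) : Pansera n →ₐ[ℂ] Matrix (Fin 2) (Fin 2) ℂ :=
  lift !![qRoot n ^ i, 0; 0, qRoot n ^ j] !![qRoot n ^ j, 0; 0, qRoot n ^ i]
    !![0, 1; qRoot n ^ (i * j), 0] (rep_rels n i j)

end Pansera

/-- The relation `p^{i²-j²} uv + vu = 0`, with `u`, `v` the generators `0`, `1`. -/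
inductive AplusRel (n : ℕ) (i j : ℤ) : FreeAlgebra ℂ (Fin 2) → FreeAlgebra ℂ (Fin 2) → Prop
  | rel : AplusRel n i j
      (pRoot n ^ (i ^ 2 - j ^ 2) • (FreeAlgebra.ι ℂ 0 * FreeAlgebra.ι ℂ 1) +
        FreeAlgebra.ι ℂ 1 * FreeAlgebra.ι ℂ 0) 0

/-- `A⁺ = ℂ⟨u, v⟩ / (p^{i²-j²} uv + vu)`. -/
def Aplus (n : ℕ) (i j : ℤ) : Type := RingQuot (AplusRel n i j)

namespace Aplus

instance instRing (n : ℕ) (i j : ℤ) : Ring (Aplus n i j) :=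
  inferInstanceAs (Ring (RingQuot (AplusRel n i j)))

instance instAlgebra (n : ℕ) (i j : ℤ) : Algebra ℂ (Aplus n i j) :=
  inferInstanceAs (Algebra ℂ (RingQuot (AplusRel n i j)))

section
variable (n : ℕ) (i j : ℤ)

/-- The quotient map from the free algebra. -/
def mk : FreeAlgebra ℂ (Fin 2) →ₐ[ℂ] Aplus n i j := RingQuot.mkAlgHom ℂ (AplusRel n i j)

/-- The generators `u`, `v` indexed by `0`, `1`. -/
def var (k : Fin 2) : Aplus n i j := mk n i j (FreeAlgebra.ι ℂ k)

/-- The generator `u`. -/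
def u : Aplus n i j := var n i j 0

/-- The generator `v`. -/
def v : Aplus n i j := var n i j 1

/-- The grading of `A⁺` with `u` and `v` in degree one. -/
def grading (m : ℕ) : Submodule ℂ (Aplus n i j) := Submodule.span ℂ {u n i j, v n i j} ^ m

theorem rel : pRoot n ^ (i ^ 2 - j ^ 2) • (u n i j * v n i j) + v n i j * u n i j = 0 := by
  have h := RingQuot.mkAlgHom_rel ℂ (AplusRel.rel (n := n) (i := i) (j := j))
  rw [map_add, map_smul, map_mul, map_mul, map_zero] at h
  exact h

theorem mk_surjective : Function.Surjective (mk n i j) := RingQuot.mkAlgHom_surjective ℂ _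

/-- The universal property of `A⁺`. -/
def lift {B : Type} [Ring B] [Algebra ℂ B] (f : Fin 2 → B)
    (h : pRoot n ^ (i ^ 2 - j ^ 2) • (f 0 * f 1) + f 1 * f 0 = 0) : Aplus n i j →ₐ[ℂ] B :=
  RingQuot.liftAlgHom ℂ ⟨FreeAlgebra.lift ℂ f, by
    intro a b hab
    cases hab
    simpa using h⟩

theorem lift_var {B : Type} [Ring B] [Algebra ℂ B] (f : Fin 2 → B)
    (h : pRoot n ^ (i ^ 2 - j ^ 2) • (f 0 * f 1) + f 1 * f 0 = 0) (k : Fin 2) :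
    lift n i j f h (var n i j k) = f k :=
  (RingQuot.liftAlgHom_mkAlgHom_apply ℂ _ _ _).trans (FreeAlgebra.lift_ι_apply _ _)

theorem induction {P : Aplus n i j → Prop} (a : Aplus n i j) (hC : ∀ c : ℂ, P (algebraMap ℂ _ c))
    (hv : ∀ k, P (var n i j k))
    (hmul : ∀ a b, P a → P b → P (a * b)) (hadd : ∀ a b, P a → P b → P (a + b)) : P a := by
  obtain ⟨a, rfl⟩ := mk_surjective n i j a
  induction a using FreeAlgebra.induction with
  | grade0 r => rw [AlgHom.commutes]; exact hC r
  | grade1 g => exact hv g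
  | mul a b ha hb => rw [map_mul]; exact hmul _ _ ha hb
  | add a b ha hb => rw [map_add]; exact hadd _ _ ha hb

theorem pRoot_sq : pRoot n ^ 2 = qRoot n := by
  rw [pRoot, qRoot, neg_sq, ← Complex.exp_nat_mul]
  congr 1
  push_cast
  ring

theorem pRoot_ne_zero : pRoot n ≠ 0 := neg_ne_zero.mpr (Complex.exp_ne_zero _)

/-- The linear inclusion of `π_{i,j} = ℂu ⊕ ℂv` in `A⁺`. -/
def incl : (Fin 2 → ℂ) →ₗ[ℂ] Aplus n i j :=
  Fintype.linearCombination ℂ (var n i j)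

theorem twistSum_apply {M : Type} [AddCommGroup M] [Module ℂ M] (a b : Module.End ℂ M) (w : M)
    (α β : ℂ) (ha : a w = α • w) (hb : b w = β • w) :
    twistSum n a b w = twistSum n α β • w := by
  have hp : ∀ (a : Module.End ℂ M) (α : ℂ), a w = α • w → ∀ r : ℕ, (a ^ r) w = α ^ r • w := by
    intro a α ha r
    induction r with
    | zero => simp
    | succ r ih => rw [pow_succ, Module.End.mul_apply, ha, map_smul, ih, smul_smul, pow_succ']
  simp only [twistSum, LinearMap.smul_apply, LinearMap.sum_apply, Module.End.mul_apply,
    hp b β hb, hp a α ha, map_smul, smul_smul, smul_eq_mul, Finset.sum_smul,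
    Finset.mul_sum, Finset.smul_sum]
  refine Finset.sum_congr rfl fun r _ => Finset.sum_congr rfl fun s _ => ?_
  congr 1
  ring

theorem incl_single (k : Fin 2) : incl n i j (Pi.single k 1) = var n i j k := by
  simp [incl]

variable [NeZero n]

/-- The action of `H_{2n²}` on `π_{i,j}` as an algebra homomorphism to endomorphisms. -/
def repEnd : Pansera n →ₐ[ℂ] Module.End ℂ (Fin 2 → ℂ) :=
  (Matrix.toLinAlgEquiv' (R := ℂ) (n := Fin 2)).toAlgHom.comp (Pansera.rep n i j)

/-- The action of `H_{2n²}` on `π_{i,j} ⊗ π_{i,j}`. -/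
def tensorEnd : Pansera n →ₐ[ℂ] Module.End ℂ ((Fin 2 → ℂ) ⊗[ℂ] (Fin 2 → ℂ)) :=
  (Module.endTensorEndAlgHom (R := ℂ) (S := ℂ) (A := ℂ) (M := Fin 2 → ℂ) (N := Fin 2 → ℂ)).comp
    ((Algebra.TensorProduct.map (repEnd n i j) (repEnd n i j)).comp (Pansera.comulHom n))

/-- The map `h ↦ h · k` from `H_{2n²}` to `A⁺`, for a generator `k`. -/
def genAct (k : Fin 2) : WithConv (Pansera n →ₗ[ℂ] Aplus n i j) :=
  WithConv.toConv (incl n i j ∘ₗ LinearMap.applyₗ (Pi.single k 1) ∘ₗ (repEnd n i j).toLinearMap)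

theorem genAct_mul (k l : Fin 2) (h : Pansera n) :
    (genAct n i j k * genAct n i j l) h = LinearMap.mul' ℂ _ (TensorProduct.map (incl n i j)
      (incl n i j) (tensorEnd n i j h (Pi.single k 1 ⊗ₜ Pi.single l 1))) := by
  rw [LinearMap.convMul_apply, Pansera.comul_apply, tensorEnd, AlgHom.comp_apply,
    AlgHom.comp_apply]
  generalize Pansera.comulHom n h = t
  induction t with
  | zero => simp
  | tmul c d => simp [genAct, Module.endTensorEndAlgHom_apply]
  | add c d hc hd => simp only [map_add, hc, hd, LinearMap.add_apply]

theorem repEnd_x (k : Fin 2) : repEnd n i j (Pansera.gen n .x) (Pi.single k 1) =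
    qRoot n ^ (![i, j] k) • Pi.single k 1 := by
  fin_cases k <;> ext l <;> fin_cases l <;>
    simp [repEnd, Pansera.rep, Matrix.mulVec, dotProduct]

theorem repEnd_y (k : Fin 2) : repEnd n i j (Pansera.gen n .y) (Pi.single k 1) =
    qRoot n ^ (![j, i] k) • Pi.single k 1 := by
  fin_cases k <;> ext l <;> fin_cases l <;>
    simp [repEnd, Pansera.rep, Matrix.mulVec, dotProduct]

theorem repEnd_z_zero : repEnd n i j (Pansera.gen n .z) (Pi.single 0 1) =
    qRoot n ^ (i * j) • Pi.single 1 1 := by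
  ext l; fin_cases l <;> simp [repEnd, Pansera.rep, Matrix.mulVec, dotProduct]

theorem repEnd_z_one : repEnd n i j (Pansera.gen n .z) (Pi.single 1 1) = Pi.single 0 1 := by
  ext l; fin_cases l <;> simp [repEnd, Pansera.rep, Matrix.mulVec, dotProduct]

/-- The relation as an element of `π_{i,j} ⊗ π_{i,j}`. -/
def relTensor : (Fin 2 → ℂ) ⊗[ℂ] (Fin 2 → ℂ) :=
  pRoot n ^ (i ^ 2 - j ^ 2) • (Pi.single 0 1 ⊗ₜ Pi.single 1 1) + Pi.single 1 1 ⊗ₜ Pi.single 0 1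

theorem tensorEnd_z (k l : Fin 2) : tensorEnd n i j (Pansera.gen n .z)
      (Pi.single k 1 ⊗ₜ Pi.single l 1) =
    twistSum n (TensorProduct.map (repEnd n i j (Pansera.gen n .x)) 1)
      (TensorProduct.map 1 (repEnd n i j (Pansera.gen n .y)))
      (repEnd n i j (Pansera.gen n .z) (Pi.single k 1) ⊗ₜ
        repEnd n i j (Pansera.gen n .z) (Pi.single l 1)) := by
  have e := twistSum.map (n := n) (B := Pansera n ⊗[ℂ] Pansera n)
    (C := Module.End ℂ ((Fin 2 → ℂ) ⊗[ℂ] (Fin 2 → ℂ))) ((Module.endTensorEndAlgHom (R := ℂ) (S := ℂ) (A := ℂ)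
    (M := Fin 2 → ℂ) (N := Fin 2 → ℂ)).comp
    (Algebra.TensorProduct.map (repEnd n i j) (repEnd n i j)))
    (Pansera.gen n .x ⊗ₜ 1) (1 ⊗ₜ Pansera.gen n .y)
  have e1 : tensorEnd n i j (Pansera.gen n .z) = ((Module.endTensorEndAlgHom (R := ℂ) (S := ℂ)
    (A := ℂ) (M := Fin 2 → ℂ) (N := Fin 2 → ℂ)).comp
    (Algebra.TensorProduct.map (repEnd n i j) (repEnd n i j)))
      (Pansera.comulHom n (Pansera.gen n .z)) := rfl
  rw [e1, Pansera.comulHom_z, map_mul, e, Module.End.mul_apply]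
  simp only [AlgHom.comp_apply, Algebra.TensorProduct.map_tmul, map_one,
    Module.endTensorEndAlgHom_apply]
  rfl

theorem tensorEnd_rel (h : Pansera n) :
    ∃ c : ℂ, tensorEnd n i j h (relTensor n i j) = c • relTensor n i j := by
  induction h using Pansera.induction with
  | hC c => exact ⟨c, by rw [AlgHom.commutes]; rfl⟩
  | hx =>
    refine ⟨qRoot n ^ (i + j), ?_⟩
    simp only [tensorEnd, AlgHom.comp_apply, Pansera.comulHom_x, Algebra.TensorProduct.map_tmul,
      Module.endTensorEndAlgHom_apply, relTensor, map_add, map_smul,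
      TensorProduct.AlgebraTensorModule.map_tmul, repEnd_x, TensorProduct.smul_tmul_smul,
      Matrix.cons_val_zero, Matrix.cons_val_one, smul_add]
    have hq := twistSum.qRoot_ne_zero n
    rw [← zpow_add₀ hq, ← zpow_add₀ hq, add_comm j i, smul_comm]
  | hy =>
    refine ⟨qRoot n ^ (i + j), ?_⟩
    simp only [tensorEnd, AlgHom.comp_apply, Pansera.comulHom_y, Algebra.TensorProduct.map_tmul,
      Module.endTensorEndAlgHom_apply, relTensor, map_add, map_smul,
      TensorProduct.AlgebraTensorModule.map_tmul, repEnd_y, TensorProduct.smul_tmul_smul,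
      Matrix.cons_val_zero, Matrix.cons_val_one, smul_add]
    have hq := twistSum.qRoot_ne_zero n
    rw [← zpow_add₀ hq, ← zpow_add₀ hq, add_comm j i, smul_comm]
  | hz =>
    have hq := twistSum.qRoot_ne_zero n
    have hp := pRoot_ne_zero n
    have h1 : tensorEnd n i j (Pansera.gen n .z) (Pi.single 0 1 ⊗ₜ Pi.single 1 1) =
        (qRoot n ^ (i * j) * qRoot n ^ (j * j)) • (Pi.single 1 1 ⊗ₜ Pi.single 0 1) := by
      rw [tensorEnd_z, repEnd_z_zero, repEnd_z_one, ← TensorProduct.smul_tmul', map_smul,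
        twistSum_apply n _ _ _ (qRoot n ^ j) (qRoot n ^ j), twistSum_zpow, smul_smul]
      · simp [repEnd_x, TensorProduct.smul_tmul']
      · simp [repEnd_y]
    have h2 : tensorEnd n i j (Pansera.gen n .z) (Pi.single 1 1 ⊗ₜ Pi.single 0 1) =
        (qRoot n ^ (i * j) * qRoot n ^ (i * i)) • (Pi.single 0 1 ⊗ₜ Pi.single 1 1) := by
      rw [tensorEnd_z, repEnd_z_zero, repEnd_z_one, TensorProduct.tmul_smul, map_smul,
        twistSum_apply n _ _ _ (qRoot n ^ i) (qRoot n ^ i), twistSum_zpow, smul_smul]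
      · simp [repEnd_x, TensorProduct.smul_tmul']
      · simp [repEnd_y]
    refine ⟨qRoot n ^ (i * j) * qRoot n ^ (j * j) * pRoot n ^ (i ^ 2 - j ^ 2), ?_⟩
    have h3 : pRoot n ^ (i ^ 2 - j ^ 2) * pRoot n ^ (i ^ 2 - j ^ 2) * qRoot n ^ (j * j) =
        qRoot n ^ (i * i) := by
      rw [← pRoot_sq n, ← zpow_natCast, ← zpow_mul, ← zpow_mul, ← zpow_add₀ hp, ← zpow_add₀ hp]
      congr 1
      push_cast
      ring
    rw [relTensor, map_add, map_smul, h1, h2, smul_add, smul_smul, smul_smul, add_comm, ← h3]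
    congr 2 <;> ring
  | hmul a b ha hb =>
    obtain ⟨c, hc⟩ := ha
    obtain ⟨d, hd⟩ := hb
    exact ⟨d * c, by rw [map_mul, Module.End.mul_apply, hd, map_smul, hc, smul_smul]⟩
  | hadd a b ha hb =>
    obtain ⟨c, hc⟩ := ha
    obtain ⟨d, hd⟩ := hb
    exact ⟨c + d, by rw [map_add, LinearMap.add_apply, hc, hd, add_smul]⟩

theorem genAct_rel : pRoot n ^ (i ^ 2 - j ^ 2) • (genAct n i j 0 * genAct n i j 1) +
    genAct n i j 1 * genAct n i j 0 = 0 := by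
  ext h
  have e : (pRoot n ^ (i ^ 2 - j ^ 2) • (genAct n i j 0 * genAct n i j 1) +
      genAct n i j 1 * genAct n i j 0) h = LinearMap.mul' ℂ _ (TensorProduct.map (incl n i j)
      (incl n i j) (tensorEnd n i j h (relTensor n i j))) := by
    rw [relTensor, map_add, map_smul, map_add, map_smul, map_add, map_smul, ← genAct_mul,
      ← genAct_mul]
    rfl
  obtain ⟨c, hc⟩ := tensorEnd_rel n i j h
  have e0 : LinearMap.mul' ℂ _ (TensorProduct.map (incl n i j) (incl n i j) (relTensor n i j)) =
      0 := by
    rw [← rel n i j]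
    simp [relTensor, incl_single, u, v]
  refine e.trans ?_
  rw [hc, map_smul, map_smul, e0, smul_zero]
  rfl

/-- The action map `a ↦ (h ↦ h · a)`, the algebra homomorphism from `A⁺` to the convolution
algebra `Hom(H_{2n²}, A⁺)` extending the representation `π_{i,j}` on `ℂu ⊕ ℂv`. -/
def act : Aplus n i j →ₐ[ℂ] WithConv (Pansera n →ₗ[ℂ] Aplus n i j) :=
  lift n i j (genAct n i j) (genAct_rel n i j)

theorem act_var (k : Fin 2) : act n i j (var n i j k) = genAct n i j k := lift_var n i j _ _ k

theorem act_incl (w : Fin 2 → ℂ) (h : Pansera n) :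
    act n i j (incl n i j w) h = incl n i j (repEnd n i j h w) := by
  have e : w = ∑ k, w k • Pi.single k (1 : ℂ) := by
    ext l
    simp [Finset.sum_apply, Pi.single_apply]
  rw [e]
  simp only [map_sum, map_smul, incl_single, act_var]
  simp [genAct]

theorem act_mul (a b : Aplus n i j) (h : Pansera n) :
    act n i j (a * b) h = LinearMap.mul' ℂ _ (TensorProduct.map (act n i j a).ofConv
      (act n i j b).ofConv (Coalgebra.comul (R := ℂ) h)) := by
  rw [map_mul]; rfl

theorem act_algebraMap (c : ℂ) (h : Pansera n) :
    act n i j (algebraMap ℂ _ c) h = algebraMap ℂ _ (c * Coalgebra.counit (R := ℂ) h) := by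
  rw [AlgHom.commutes, LinearMap.convAlgebraMap_apply, map_mul, Algebra.smul_def]

theorem act_one (a : Aplus n i j) : act n i j a 1 = a := by
  induction a using induction with
  | hC c => rw [act_algebraMap]; simp
  | hv k => rw [← incl_single, act_incl, map_one]; rfl
  | hmul a b ha hb =>
    rw [act_mul, Bialgebra.comul_one, Algebra.TensorProduct.one_def, TensorProduct.map_tmul,
      LinearMap.mul'_apply]
    exact congrArg₂ _ ha hb
  | hadd a b ha hb => rw [map_add]; exact congrArg₂ (· + ·) ha hb

theorem act_act (a : Aplus n i j) (g h : Pansera n) :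
    act n i j a (g * h) = act n i j (act n i j a h) g := by
  induction a using induction generalizing g h with
  | hC c => simp only [act_algebraMap, Bialgebra.counit_mul]; congr 1; ring
  | hv k => rw [← incl_single]; simp only [act_incl, map_mul]; rfl
  | hmul a b ha hb =>
    rw [act_mul, act_mul, Bialgebra.comul_mul]
    generalize Coalgebra.comul (R := ℂ) h = t
    induction t with
    | zero => simp
    | tmul c d =>
      rw [TensorProduct.map_tmul, LinearMap.mul'_apply, act_mul]
      generalize Coalgebra.comul (R := ℂ) g = s
      induction s with
      | zero => simp
      | tmul e f =>
        rw [Algebra.TensorProduct.tmul_mul_tmul, TensorProduct.map_tmul, TensorProduct.map_tmul]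
        exact congrArg₂ (· * ·) (ha e c) (hb f d)
      | add e f he hf => rw [add_mul, map_add, map_add, map_add, map_add, he, hf]
    | add c d hc hd =>
      rw [mul_add, map_add, map_add, map_add, map_add, map_add, hc, hd]
      rfl
  | hadd a b ha hb =>
    have e : act n i j (a + b) h = act n i j a h + act n i j b h := by rw [map_add]; rfl
    rw [e, map_add, map_add]
    exact congrArg₂ (· + ·) (ha g h) (hb g h)

/-- The `H_{2n²}`-module structure of `A⁺` extending `π_{i,j}` on `ℂu ⊕ ℂv`. -/
instance instModule : Module (Pansera n) (Aplus n i j) where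
  smul h a := act n i j a h
  one_smul := act_one n i j
  mul_smul g h a := act_act n i j a g h
  smul_zero h := by change act n i j 0 h = 0; rw [map_zero]; rfl
  smul_add h a b := by change act n i j (a + b) h = _; rw [map_add]; rfl
  add_smul g h a := map_add (act n i j a).ofConv g h
  zero_smul a := map_zero (act n i j a).ofConv

theorem smul_def (h : Pansera n) (a : Aplus n i j) : h • a = act n i j a h := rfl

instance instIsScalarTower : IsScalarTower ℂ (Pansera n) (Aplus n i j) where
  smul_assoc c h a := map_smul (act n i j a).ofConv c h

instance instIsModuleAlgebra : IsModuleAlgebra (Pansera n) (Aplus n i j) where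
  smul_mul h a b := act_mul n i j a b h
  smul_one h := by
    have e := act_algebraMap n i j 1 h
    rw [map_one, one_mul] at e
    exact e

theorem x_smul_u : Pansera.gen n .x • u n i j = qRoot n ^ i • u n i j := by
  rw [smul_def, u, ← incl_single, act_incl, repEnd_x, map_smul]; rfl
theorem x_smul_v : Pansera.gen n .x • v n i j = qRoot n ^ j • v n i j := by
  rw [smul_def, v, ← incl_single, act_incl, repEnd_x, map_smul]; rfl
theorem y_smul_u : Pansera.gen n .y • u n i j = qRoot n ^ j • u n i j := by
  rw [smul_def, u, ← incl_single, act_incl, repEnd_y, map_smul]; rfl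
theorem y_smul_v : Pansera.gen n .y • v n i j = qRoot n ^ i • v n i j := by
  rw [smul_def, v, ← incl_single, act_incl, repEnd_y, map_smul]; rfl
theorem z_smul_u : Pansera.gen n .z • u n i j = qRoot n ^ (i * j) • v n i j := by
  rw [smul_def, u, ← incl_single, act_incl, repEnd_z_zero, map_smul, incl_single]; rfl
theorem z_smul_v : Pansera.gen n .z • v n i j = u n i j := by
  rw [smul_def, v, ← incl_single, act_incl, repEnd_z_one, incl_single]; rfl

end

end Aplus

section
open CategoryTheory

/-- The (left) global dimension of a ring. -/
def globalDimension (A : Type) [Ring A] : WithBot ℕ∞ :=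
  ⨆ M : ModuleCat.{0} A, projectiveDimension M

/-- The Gelfand-Kirillov dimension `sup_V limsup_m log dim V^m / log m`, where `V` runs over the
finite-dimensional subspaces containing `1`. -/
def gkDimension (A : Type) [Ring A] [Algebra ℂ A] : EReal :=
  ⨆ V : {V : Submodule ℂ A // FiniteDimensional ℂ V ∧ (1 : A) ∈ V},
    Filter.limsup (fun m : ℕ =>
      ((Real.log (Module.finrank ℂ ↥(V.1 ^ m)) / Real.log m : ℝ) : EReal)) Filter.atTop

variable {A : Type} [Ring A] [Algebra ℂ A]

/-- `A = ⨁ 𝒜 m` is a connected `ℕ`-graded algebra. -/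
structure IsConnectedGraded (𝒜 : ℕ → Submodule ℂ A) : Prop where
  gradedMonoid : SetLike.GradedMonoid 𝒜
  isInternal : DirectSum.IsInternal 𝒜
  connected : Module.finrank ℂ (𝒜 0) = 1

/-- The trivial left module `A / A_{≥ 1}` of a connected graded algebra. -/
def trivialModule (𝒜 : ℕ → Submodule ℂ A) : ModuleCat.{0} A :=
  ModuleCat.of A (A ⧸ Ideal.span {a : A | ∃ m, 0 < m ∧ a ∈ 𝒜 m})

/-- Artin-Schelter regularity of dimension `d`. The last three fields say that `Ext^i_A(ℂ, A)` is
zero for `i ≠ d` and that `Ext^d_A(ℂ, A)` is, as a right `A`-module (through right multiplication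
on `A`), the one-dimensional trivial module, up to a shift of degree. -/
structure IsASRegularOfDim (𝒜 : ℕ → Submodule ℂ A) (d : ℕ) : Prop where
  connectedGraded : IsConnectedGraded 𝒜
  globalDimension_eq : globalDimension A = d
  gkDimension_lt_top : gkDimension A < ⊤
  ext_subsingleton : ∀ i : ℕ, i ≠ d →
    Subsingleton (Abelian.Ext.{0} (trivialModule 𝒜) (ModuleCat.of A A) i)
  finrank_ext : Module.finrank ℂ (Abelian.Ext.{0} (trivialModule 𝒜) (ModuleCat.of A A) d) = 1
  ext_comp : ∀ (e : Abelian.Ext.{0} (trivialModule 𝒜) (ModuleCat.of A A) d) (m : ℕ) (a : A),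
    0 < m → a ∈ 𝒜 m → e.comp (Abelian.Ext.mk₀
      (ModuleCat.ofHom (LinearMap.toSpanSingleton A A a))) (add_zero d) = 0

/-- Artin-Schelter regularity. -/
def IsASRegular (𝒜 : ℕ → Submodule ℂ A) : Prop := ∃ d : ℕ, IsASRegularOfDim 𝒜 d

variable (H : Type) [Ring H] [HopfAlgebra ℂ H] [Module H A] [IsScalarTower ℂ H A]
  [IsModuleAlgebra H A]

/-- The grading of the fixed ring induced by the grading of `A`. -/
def fixedGrading (𝒜 : ℕ → Submodule ℂ A) (m : ℕ) : Submodule ℂ (fixedRing H A) :=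
  (𝒜 m).comap (fixedRing H A).val.toLinearMap

/-- The finite-dimensional semisimple Hopf algebra `H`, acting inner-faithfully and preserving the
grading on the Artin-Schelter regular `H`-module algebra `A`, is a reflection Hopf algebra for `A`:
the fixed ring is Artin-Schelter regular. -/
structure IsReflectionHopfAlgebra (𝒜 : ℕ → Submodule ℂ A) : Prop where
  finiteDimensional : FiniteDimensional ℂ H
  semisimple : IsSemisimpleRing H
  regular : IsASRegular 𝒜
  smul_mem : ∀ (m : ℕ) (h : H) (a : A), a ∈ 𝒜 m → h • a ∈ 𝒜 m
  innerFaithful : IsInnerFaithful H A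
  fixed_regular : IsASRegular (fixedGrading H 𝒜)

end
end

/-! ### Quantum planes: coefficients, divisibility and syzygies -/

noncomputable section

/-! Regularity. The relation says vu = c uv with c = -p^(i²-j²) ≠ 0, so A⁺ is a quantum plane: the
monomials u^a v^b form a basis, and divisibility and syzygy questions are settled on coefficients.
Every quantum plane A is regular of dimension 2. Tensoring the Koszul bimodule resolution with a
module M gives 0 → A⊗M → (A⊗M)² → A⊗M → M → 0 with free middle terms, which bounds the global
dimension by 2 (`IsQuantumPlane.globalDimension_le`). The resolution 0 → A → A² → A → ℂ → 0 of the
trivial module computes Ext(ℂ, A), which is A/A_{≥1} in degree 2 and zero elsewhere.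
`IsQuantumPlane.isASRegularOfDim` allows generators of any positive degrees, so it serves both for
A⁺ and for the fixed ring when n is even.

Inner-faithfulness. H is spanned by the e_{rs} z^ε with ε = 0, 1, where the e_{rs} are the weight
idempotents of ⟨x, y⟩. The elements x and y scale u^a v^b by q^(ia+jb) and q^(ja+ib), and z sends it
to a nonzero multiple of u^b v^a. The weight system has determinant i²-j². If this is a unit modulo
n, each pair of weights occurs on a monomial with a ≠ b, and the action is even faithful
(`Aplus.eq_zero_of_smul_eq_zero`). Otherwise some grouplike x^r y^s ≠ 1 acts trivially, and the
elements g - 1 for such grouplikes g generate a nonzero Hopf ideal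
(`Aplus.isHopfIdeal_trivialIdeal`).

Fixed rings. The same determinant shows that the invariants of x and y are generated by U = u^n and
V = v^n (`Aplus.xyFixed_eq_adjoin`). There z acts by an algebra homomorphism exchanging U and V.
Since p^n = (-1)^(n+1), the scalar in VU = c^(n²) UV is 1 for even n and -1 for odd n. For even n
the fixed ring consists of the symmetric polynomials in two commuting variables, again a polynomial
ring. For odd n, z negates both U - V and UV. Every element of ℂ⟨U, V⟩ has the form b + b'(U - V) +
b''UV with coefficients in the algebra generated by U + V and UV(U - V), so this algebra is the
whole fixed ring F.

Failure of regularity for odd n. Let M be the F-module of elements fixed by x, y and negated by z;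
it is generated by U - V and UV. Because (U - V)UV = -UV(U - V), the syzygies of these generators
are the pairs f·(UV, U - V) with f again in M. This gives 0 → M → F² → M → 0. If M were projective,
a splitting would write 1 as UV·r + (U - V)·r', which is impossible in degree 0. Hence M has
infinite projective dimension and F infinite global dimension. -/

/-- The elements `u`, `v` satisfy `vu = c uv` and the monomials `u ^ i v ^ j` form a basis: the
algebra is the quantum plane with parameter `c`. -/
structure IsQuantumPlane {A : Type} [Ring A] [Algebra ℂ A] (c : ℂ) (u v : A) : Prop where
  comm : v * u = c • (u * v)
  ne_zero : c ≠ 0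
  linearIndependent : LinearIndependent ℂ (fun k : ℕ × ℕ => u ^ k.1 * v ^ k.2)
  span_eq_top : ⊤ ≤ Submodule.span ℂ (Set.range fun k : ℕ × ℕ => u ^ k.1 * v ^ k.2)

theorem mul_pow_of_mul_eq_smul {A : Type} [Ring A] [Algebra ℂ A] {c : ℂ} {u v : A}
    (h : v * u = c • (u * v)) (j : ℕ) : v ^ j * u = c ^ j • (u * v ^ j) := by
  induction j with
  | zero => simp
  | succ j ih =>
    rw [pow_succ', mul_assoc, ih, mul_smul_comm, ← mul_assoc, h, smul_mul_assoc, smul_smul,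
      mul_assoc, ← pow_succ', ← pow_succ]

theorem pow_mul_pow_of_mul_eq_smul {A : Type} [Ring A] [Algebra ℂ A] {c : ℂ} {u v : A}
    (h : v * u = c • (u * v)) (i j : ℕ) : v ^ j * u ^ i = c ^ (i * j) • (u ^ i * v ^ j) := by
  induction i with
  | zero => simp
  | succ i ih =>
    rw [pow_succ, ← mul_assoc, ih, smul_mul_assoc, mul_assoc, mul_pow_of_mul_eq_smul h,
      mul_smul_comm, smul_smul, ← mul_assoc, ← pow_add, add_mul, one_mul]

namespace IsQuantumPlane

variable {A : Type} [Ring A] [Algebra ℂ A] {c : ℂ} {u v : A} (h : IsQuantumPlane c u v)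
include h

theorem mul_pow (i : ℕ) : v * u ^ i = c ^ i • (u ^ i * v) := by
  simpa using pow_mul_pow_of_mul_eq_smul h.comm i 1

/-- The basis of monomials of a quantum plane. -/
def basis : Module.Basis (ℕ × ℕ) ℂ A := Module.Basis.mk h.linearIndependent h.span_eq_top

@[simp] theorem basis_apply (k : ℕ × ℕ) : h.basis k = u ^ k.1 * v ^ k.2 := by
  simp [basis]

/-- The coefficients of an element with respect to the monomial basis. -/
def coeff (k : ℕ × ℕ) : A →ₗ[ℂ] ℂ := h.basis.coord k

theorem coeff_monomial (k l : ℕ × ℕ) :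
    h.coeff k (u ^ l.1 * v ^ l.2) = if l = k then 1 else 0 := by
  rw [← h.basis_apply, coeff, Module.Basis.coord_apply, Module.Basis.repr_self,
    Finsupp.single_apply]

theorem ext_coeff {a b : A} (hab : ∀ i j, h.coeff (i, j) a = h.coeff (i, j) b) : a = b :=
  h.basis.ext_elem fun k => hab k.1 k.2

theorem induction {P : A → Prop} (a : A) (hm : ∀ i j, P (u ^ i * v ^ j))
    (hadd : ∀ a b, P a → P b → P (a + b)) (hsmul : ∀ (t : ℂ) a, P a → P (t • a)) : P a := by
  have ha : a ∈ Submodule.span ℂ (Set.range fun k : ℕ × ℕ => u ^ k.1 * v ^ k.2) :=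
    h.span_eq_top trivial
  induction ha using Submodule.span_induction with
  | mem x hx => obtain ⟨k, rfl⟩ := hx; exact hm _ _
  | zero => simpa using hsmul 0 _ (hm 0 0)
  | add x y _ _ hx hy => exact hadd _ _ hx hy
  | smul t x _ hx => exact hsmul _ _ hx

theorem coeff_one : h.coeff (0, 0) 1 = 1 := by
  simpa using h.coeff_monomial (0, 0) (0, 0)

/-- Multiplying by a generator shifts the array of coefficients by one step. A scalar appears only
when the generator has to cross the other variable: c^j for u on the right, c^i for v on the left.
These shift rules carry all later cancellation and divisibility arguments. -/
theorem coeff_mul_right_succ (i j : ℕ) (a : A) :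
    h.coeff (i, j + 1) (a * v) = h.coeff (i, j) a := by
  induction a using h.induction with
  | hm k l =>
    rw [mul_assoc, ← pow_succ]
    simpa using (h.coeff_monomial (i, j + 1) (k, l + 1)).trans (by simp [h.coeff_monomial _ (k, l)])
  | hadd a b ha hb => rw [add_mul, map_add, map_add, ha, hb]
  | hsmul t a ha => rw [smul_mul_assoc, map_smul, map_smul, ha]

theorem coeff_mul_right_zero (i : ℕ) (a : A) : h.coeff (i, 0) (a * v) = 0 := by
  induction a using h.induction with
  | hm k l =>
    rw [mul_assoc, ← pow_succ]
    simpa using h.coeff_monomial (i, 0) (k, l + 1)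
  | hadd a b ha hb => rw [add_mul, map_add, ha, hb, add_zero]
  | hsmul t a ha => rw [smul_mul_assoc, map_smul, ha, smul_zero]

theorem monomial_mul_left (k l : ℕ) :
    u ^ k * v ^ l * u = c ^ l • (u ^ (k + 1) * v ^ l) := by
  rw [mul_assoc, mul_pow_of_mul_eq_smul h.comm, mul_smul_comm, ← mul_assoc, ← pow_succ]

theorem coeff_mul_left_succ (i j : ℕ) (a : A) :
    h.coeff (i + 1, j) (a * u) = c ^ j * h.coeff (i, j) a := by
  induction a using h.induction with
  | hm k l =>
    rw [h.monomial_mul_left, map_smul, smul_eq_mul]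
    have e1 := h.coeff_monomial (i + 1, j) (k + 1, l)
    have e2 := h.coeff_monomial (i, j) (k, l)
    simp only [Prod.mk.injEq, add_left_inj] at e1 e2
    rw [e1, e2]
    split_ifs with hkl
    · rw [hkl.2]
    · simp
  | hadd a b ha hb => rw [add_mul, map_add, map_add, ha, hb, mul_add]
  | hsmul t a ha =>
    rw [smul_mul_assoc, map_smul, map_smul, ha, smul_eq_mul, smul_eq_mul, mul_left_comm]

theorem coeff_mul_left_zero (j : ℕ) (a : A) : h.coeff (0, j) (a * u) = 0 := by
  induction a using h.induction with
  | hm k l =>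
    rw [h.monomial_mul_left, map_smul]
    have e1 := h.coeff_monomial (0, j) (k + 1, l)
    simp only [Prod.mk.injEq, Nat.add_eq_zero_iff, one_ne_zero, and_false, false_and,
      if_false] at e1
    rw [e1, smul_zero]
  | hadd a b ha hb => rw [add_mul, map_add, ha, hb, add_zero]
  | hsmul t a ha => rw [smul_mul_assoc, map_smul, ha, smul_zero]

theorem coeff_left_mul_succ (i j : ℕ) (a : A) :
    h.coeff (i + 1, j) (u * a) = h.coeff (i, j) a := by
  induction a using h.induction with
  | hm k l =>
    rw [← mul_assoc, ← pow_succ']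
    simpa using (h.coeff_monomial (i + 1, j) (k + 1, l)).trans (by simp [h.coeff_monomial _ (k, l)])
  | hadd a b ha hb => rw [mul_add, map_add, map_add, ha, hb]
  | hsmul t a ha => rw [mul_smul_comm, map_smul, map_smul, ha]

theorem coeff_left_mul_zero (j : ℕ) (a : A) : h.coeff (0, j) (u * a) = 0 := by
  induction a using h.induction with
  | hm k l =>
    rw [← mul_assoc, ← pow_succ']
    simpa using h.coeff_monomial (0, j) (k + 1, l)
  | hadd a b ha hb => rw [mul_add, map_add, ha, hb, add_zero]
  | hsmul t a ha => rw [mul_smul_comm, map_smul, ha, smul_zero]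

theorem right_mul_monomial (k l : ℕ) :
    v * (u ^ k * v ^ l) = c ^ k • (u ^ k * v ^ (l + 1)) := by
  rw [← mul_assoc, h.mul_pow, smul_mul_assoc, mul_assoc, ← pow_succ']

theorem coeff_right_mul_succ (i j : ℕ) (a : A) :
    h.coeff (i, j + 1) (v * a) = c ^ i * h.coeff (i, j) a := by
  induction a using h.induction with
  | hm k l =>
    rw [h.right_mul_monomial, map_smul, smul_eq_mul]
    have e1 := h.coeff_monomial (i, j + 1) (k, l + 1)
    have e2 := h.coeff_monomial (i, j) (k, l)
    simp only [Prod.mk.injEq, add_left_inj] at e1 e2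
    rw [e1, e2]
    split_ifs with hkl
    · rw [hkl.1]
    · simp
  | hadd a b ha hb => rw [mul_add, map_add, map_add, ha, hb, mul_add]
  | hsmul t a ha =>
    rw [mul_smul_comm, map_smul, map_smul, ha, smul_eq_mul, smul_eq_mul, mul_left_comm]

theorem coeff_right_mul_zero (i : ℕ) (a : A) : h.coeff (i, 0) (v * a) = 0 := by
  induction a using h.induction with
  | hm k l =>
    rw [h.right_mul_monomial, map_smul]
    have e1 := h.coeff_monomial (i, 0) (k, l + 1)
    simp only [Prod.mk.injEq, Nat.add_eq_zero_iff, one_ne_zero, and_false,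
      if_false] at e1
    rw [e1, smul_zero]
  | hadd a b ha hb => rw [mul_add, map_add, ha, hb, add_zero]
  | hsmul t a ha => rw [mul_smul_comm, map_smul, ha, smul_zero]

theorem eq_zero_of_mul_right {a : A} (ha : a * v = 0) : a = 0 :=
  h.ext_coeff fun i j => by rw [← h.coeff_mul_right_succ, ha, map_zero, map_zero]

theorem eq_zero_of_left_mul {a : A} (ha : u * a = 0) : a = 0 :=
  h.ext_coeff fun i j => by rw [← h.coeff_left_mul_succ, ha, map_zero, map_zero]

theorem eq_zero_of_right_mul {a : A} (ha : v * a = 0) : a = 0 :=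
  h.ext_coeff fun i j => by
    have e := h.coeff_right_mul_succ i j a
    rw [ha, map_zero] at e
    rw [map_zero, (mul_eq_zero.mp e.symm).resolve_left (pow_ne_zero _ h.ne_zero)]

/-- The terms with v-exponent at least n form the multiple of v^n and the others form the remainder.
The last clause holds because e v^n has no terms of v-exponent below n. -/
theorem exists_eq_mul_right (n : ℕ) (a : A) :
    ∃ e r, a = e * v ^ n + r ∧ (∀ i j, n ≤ j → h.coeff (i, j) r = 0) ∧
      ∀ i, ∀ j < n, h.coeff (i, j) r = h.coeff (i, j) a := by
  have key : ∀ n (e : A), ∀ i, ∀ j < n, h.coeff (i, j) (e * v ^ n) = 0 := by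
    intro n
    induction n with
    | zero => intro e i j hj; simp at hj
    | succ n ih =>
      intro e i j hj
      rw [pow_succ, ← mul_assoc]
      cases j with
      | zero => exact h.coeff_mul_right_zero _ _
      | succ j => rw [h.coeff_mul_right_succ]; exact ih _ _ _ (by omega)
  have main : ∃ e r, a = e * v ^ n + r ∧ (∀ i j, n ≤ j → h.coeff (i, j) r = 0) := by
    induction a using h.induction with
    | hm k l =>
      by_cases hl : n ≤ l
      · exact ⟨u ^ k * v ^ (l - n), 0, by rw [mul_assoc, ← pow_add, Nat.sub_add_cancel hl,
          add_zero], by simp⟩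
      · refine ⟨0, u ^ k * v ^ l, by simp, fun i j hj => ?_⟩
        have e1 := h.coeff_monomial (i, j) (k, l)
        rw [if_neg (by rintro ⟨⟩; exact hl hj)] at e1
        exact e1
    | hadd a b ha hb =>
      obtain ⟨e, r, rfl, hr⟩ := ha
      obtain ⟨e', r', rfl, hr'⟩ := hb
      exact ⟨e + e', r + r', by rw [add_mul]; abel, fun i j hj => by
        rw [map_add, hr i j hj, hr' i j hj, add_zero]⟩
    | hsmul t a ha =>
      obtain ⟨e, r, rfl, hr⟩ := ha
      exact ⟨t • e, t • r, by rw [smul_add, smul_mul_assoc], fun i j hj => by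
        rw [map_smul, hr i j hj, smul_zero]⟩
  obtain ⟨e, r, rfl, hr⟩ := main
  exact ⟨e, r, rfl, hr, fun i j hj => by rw [map_add, key n e i j hj, zero_add]⟩

/-- An element whose coefficients at `u ^ i v ^ j` vanish for `j < n` is right divisible by
`v ^ n`. -/
theorem exists_eq_mul_right_pow (n : ℕ) {a : A} (ha : ∀ i, ∀ j < n, h.coeff (i, j) a = 0) :
    ∃ e, a = e * v ^ n := by
  obtain ⟨e, r, rfl, hr, hr'⟩ := h.exists_eq_mul_right n a
  refine ⟨e, ?_⟩
  have : r = 0 := h.ext_coeff fun i j => by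
    rw [map_zero]
    rcases lt_or_ge j n with hj | hj
    · rw [hr' i j hj, ha i j hj]
    · exact hr i j hj
  rw [this, add_zero]

/-- Reversing a monomial only multiplies it by a power of c, so the reversed monomials are again a
basis. This transfers statements on right divisibility by v^n to u^n. -/
theorem symm : IsQuantumPlane c⁻¹ v u := by
  have hc := h.ne_zero
  have e : (fun k : ℕ × ℕ => v ^ k.1 * u ^ k.2) = fun k : ℕ × ℕ =>
      (Units.mk0 c hc ^ (k.2 * k.1)) • (u ^ k.2 * v ^ k.1) := by
    funext k
    rw [pow_mul_pow_of_mul_eq_smul h.comm]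
    rfl
  refine ⟨by rw [h.comm, smul_smul, inv_mul_cancel₀ hc, one_smul], inv_ne_zero hc, ?_, ?_⟩
  · rw [e]
    exact (h.linearIndependent.comp (Prod.swap : ℕ × ℕ → ℕ × ℕ) Prod.swap_injective).units_smul _
  · intro a _
    induction a using h.induction with
    | hm i j =>
      have e1 := pow_mul_pow_of_mul_eq_smul h.comm i j
      have e2 : u ^ i * v ^ j = (c ^ (i * j))⁻¹ • (v ^ j * u ^ i) := by
        rw [e1, smul_smul, inv_mul_cancel₀ (pow_ne_zero _ hc), one_smul]
      rw [e2]
      exact Submodule.smul_mem _ _ (Submodule.subset_span ⟨(j, i), rfl⟩)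
    | hadd a b ha hb => exact Submodule.add_mem _ (ha trivial) (hb trivial)
    | hsmul t a ha => exact Submodule.smul_mem _ _ (ha trivial)

/-- The two coordinate systems differ by the nonzero scalars in v^j u^i = c^(ij) u^i v^j, so they
have the same vanishing coefficients. -/
theorem coeff_symm_eq_zero (i j : ℕ) (a : A) : h.symm.coeff (j, i) a = 0 ↔ h.coeff (i, j) a = 0 := by
  have key : ∃ t : ℂ, t ≠ 0 ∧ ∀ a, h.coeff (i, j) a = t * h.symm.coeff (j, i) a := by
    refine ⟨c ^ (i * j), pow_ne_zero _ h.ne_zero, fun a => ?_⟩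
    induction a using h.symm.induction with
    | hm k l =>
      have e1 := h.symm.coeff_monomial (j, i) (k, l)
      have e2 := h.coeff_monomial (i, j) (l, k)
      simp only [Prod.mk.injEq] at e1 e2
      rw [pow_mul_pow_of_mul_eq_smul h.comm, map_smul, e2,
        ← pow_mul_pow_of_mul_eq_smul h.comm, e1]
      by_cases hkl : k = j ∧ l = i
      · simp [hkl.1, hkl.2]
      · rw [if_neg hkl, if_neg fun hlk => hkl hlk.symm, smul_zero, mul_zero]
    | hadd a b ha hb => rw [map_add, map_add, ha, hb, mul_add]
    | hsmul t a ha =>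
      rw [map_smul, map_smul, ha, smul_eq_mul, smul_eq_mul, mul_left_comm]
  obtain ⟨t, ht, hk⟩ := key
  rw [hk]
  simp [ht]

/-- An element whose coefficients at `u ^ i v ^ j` vanish for `i < n` is right divisible by
`u ^ n`. -/
theorem exists_eq_mul_left_pow (n : ℕ) {a : A} (ha : ∀ j, ∀ i < n, h.coeff (i, j) a = 0) :
    ∃ e, a = e * u ^ n :=
  h.symm.exists_eq_mul_right_pow n fun j i hi => (h.coeff_symm_eq_zero i j a).mpr (ha j i hi)

/-- The coefficients give a right multiple e u, and u is normal: moving it across a monomial to the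
left costs only a power of c. -/
theorem exists_eq_left_mul {a : A} (ha : ∀ j, h.coeff (0, j) a = 0) : ∃ e, a = u * e := by
  obtain ⟨e, rfl⟩ := h.exists_eq_mul_left_pow 1 (a := a) (by simpa [Nat.lt_one_iff] using ha)
  clear ha
  rw [pow_one]
  induction e using h.induction with
  | hm k l =>
    exact ⟨c ^ l • (u ^ k * v ^ l), by
      rw [h.monomial_mul_left, mul_smul_comm, ← mul_assoc, ← pow_succ']⟩
  | hadd a b ha hb =>
    obtain ⟨x, hx⟩ := ha
    obtain ⟨y, hy⟩ := hb
    exact ⟨x + y, by rw [add_mul, hx, hy, mul_add]⟩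
  | hsmul t a ha =>
    obtain ⟨x, hx⟩ := ha
    exact ⟨t • x, by rw [smul_mul_assoc, hx, mul_smul_comm]⟩

/-- The kernel of `A² → A`, `(a, b) ↦ a u + b v`. -/
theorem exists_of_mul_add_mul_eq_zero {a b : A} (hab : a * u + b * v = 0) :
    ∃ e, a = e * v ∧ b = -(c • (e * u)) := by
  -- At (i + 1, 0) the term b v has no coefficient, so a has none at (i, 0) and is right divisible
  -- by v.
  obtain ⟨e, he⟩ := h.exists_eq_mul_right_pow 1 (a := a) (by
    intro i j hj
    obtain rfl : j = 0 := by omega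
    have e1 := h.coeff_mul_left_succ i 0 a
    rw [eq_neg_of_add_eq_zero_left hab, map_neg, h.coeff_mul_right_zero] at e1
    simpa using e1.symm)
  rw [pow_one] at he
  refine ⟨e, he, ?_⟩
  have e2 : (b + c • (e * u)) * v = 0 := by
    rw [add_mul, smul_mul_assoc, ← hab, he, mul_assoc e v u, h.comm, mul_smul_comm, mul_assoc]
    abel
  exact eq_neg_of_add_eq_zero_left (h.eq_zero_of_mul_right e2)

/-- The kernel of `A² → A`, `(a, b) ↦ v a - c u b`. -/
theorem exists_of_mul_eq_smul {a b : A} (hab : v * a = c • (u * b)) :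
    ∃ e, a = u * e ∧ b = v * e := by
  obtain ⟨e, he⟩ := h.exists_eq_left_mul (a := a) (by
    intro j
    have e1 := h.coeff_right_mul_succ 0 j a
    rw [hab, map_smul, h.coeff_left_mul_zero] at e1
    simpa using e1.symm)
  refine ⟨e, he, ?_⟩
  have e2 : u * (b - v * e) = 0 := by
    have e3 : c • (u * (b - v * e)) = 0 := by
      rw [mul_sub, smul_sub, ← hab, he, ← mul_assoc, ← mul_assoc, h.comm, smul_mul_assoc, sub_self]
    exact (smul_eq_zero.mp e3).resolve_left h.ne_zero
  exact sub_eq_zero.mp (h.eq_zero_of_left_mul e2)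

/-- The augmentation ideal as a right ideal. This side is the one needed to kill classes in Ext²,
where elements of A act by right multiplication. -/
theorem exists_of_coeff_zero {a : A} (ha : h.coeff (0, 0) a = 0) :
    ∃ x y, a = u * x + v * y := by
  have key : ∀ a : A, ∃ x y, a = algebraMap ℂ A (h.coeff (0, 0) a) + u * x + v * y := by
    intro a
    induction a using h.induction with
    | hm k l =>
      have e := h.coeff_monomial (0, 0) (k, l)
      simp only [Prod.mk.injEq] at e
      rw [e]
      rcases k with _ | k
      · rcases l with _ | l
        · exact ⟨0, 0, by simp⟩
        · exact ⟨0, v ^ l, by simp [pow_succ']⟩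
      · exact ⟨u ^ k * v ^ l, 0, by simp [pow_succ', mul_assoc]⟩
    | hadd a b ha hb =>
      obtain ⟨x, y, hx⟩ := ha
      obtain ⟨x', y', hx'⟩ := hb
      refine ⟨x + x', y + y', ?_⟩
      conv_lhs => rw [hx, hx']
      rw [map_add, map_add, mul_add, mul_add]
      abel
    | hsmul t a ha =>
      obtain ⟨x, y, hx⟩ := ha
      refine ⟨t • x, t • y, ?_⟩
      conv_lhs => rw [hx]
      rw [map_smul, smul_add, smul_add, mul_smul_comm, mul_smul_comm, smul_eq_mul, map_mul,
        ← Algebra.smul_def]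
  obtain ⟨x, y, hx⟩ := key a
  exact ⟨x, y, by rw [hx, ha]; simp⟩

/-- The constant coefficient is the augmentation character, since a product picks up a constant term
only from constant terms. -/
theorem coeff_zero_mul (a b : A) :
    h.coeff (0, 0) (a * b) = h.coeff (0, 0) a * h.coeff (0, 0) b := by
  induction b using h.induction with
  | hm k l =>
    have e := h.coeff_monomial (0, 0) (k, l)
    simp only [Prod.mk.injEq] at e
    rw [e]
    rcases l with _ | l
    · rcases k with _ | k
      · simp
      · rw [pow_zero, mul_one, pow_succ, ← mul_assoc, h.coeff_mul_left_zero]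
        simp
    · rw [pow_succ, ← mul_assoc, ← mul_assoc, h.coeff_mul_right_zero]
      simp
  | hadd x y hx hy => rw [mul_add, map_add, map_add, hx, hy, mul_add]
  | hsmul t x hx =>
    rw [mul_smul_comm, map_smul, map_smul, hx, smul_eq_mul, smul_eq_mul, mul_left_comm]

end IsQuantumPlane
end

/-! ### The Koszul complex of a quantum plane tensored with a module -/

noncomputable section

section
variable {A M : Type} [Ring A] [Algebra ℂ A] [AddCommGroup M] [Module ℂ M]

/-- The endomorphism `a ⊗ m ↦ a x ⊗ m` of `A ⊗ M`. -/
def tensorRightMul (M : Type) [AddCommGroup M] [Module ℂ M] (x : A) :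
    A ⊗[ℂ] M →ₗ[A] A ⊗[ℂ] M :=
  TensorProduct.AlgebraTensorModule.map (LinearMap.toSpanSingleton A A x)
    (LinearMap.id : M →ₗ[ℂ] M)

@[simp] theorem tensorRightMul_tmul (x a : A) (m : M) :
    tensorRightMul M x (a ⊗ₜ m) = (a * x) ⊗ₜ m := rfl

variable [Module A M] [IsScalarTower ℂ A M]

/-- The endomorphism `a ⊗ m ↦ a ⊗ x m` of `A ⊗ M`. -/
def tensorActMul (M : Type) [AddCommGroup M] [Module ℂ M] [Module A M] [IsScalarTower ℂ A M]
    (x : A) : A ⊗[ℂ] M →ₗ[A] A ⊗[ℂ] M :=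
  TensorProduct.AlgebraTensorModule.map (LinearMap.id : A →ₗ[A] A) (Algebra.lsmul ℂ ℂ M x)

/-- The multiplication `A ⊗ M → M`. -/
def tensorAct (A M : Type) [Ring A] [Algebra ℂ A] [AddCommGroup M] [Module ℂ M] [Module A M]
    [IsScalarTower ℂ A M] : A ⊗[ℂ] M →ₗ[A] M :=
  TensorProduct.AlgebraTensorModule.lift
    { toFun := fun a => (LinearMap.toSpanSingleton A (M →ₗ[ℂ] M) LinearMap.id a)
      map_add' := fun a b => add_smul a b _
      map_smul' := fun a b => mul_smul a b _ }

@[simp] theorem tensorActMul_tmul (x a : A) (m : M) :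
    tensorActMul M x (a ⊗ₜ m) = a ⊗ₜ (x • m) := rfl

@[simp] theorem tensorAct_tmul (a : A) (m : M) : tensorAct A M (a ⊗ₜ m) = a • m := by
  simp [tensorAct]

theorem tensorAct_surjective : Function.Surjective (tensorAct A M) :=
  fun m => ⟨1 ⊗ₜ m, by simp⟩

end

namespace IsQuantumPlane

variable {A : Type} [Ring A] [Algebra ℂ A] {c : ℂ} {u v : A} (h : IsQuantumPlane c u v)
  {M : Type} [AddCommGroup M] [Module ℂ M]

/-- The coefficients in `M` of an element of `A ⊗ M` with respect to the monomial basis. -/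
def tensorCoeff (M : Type) [AddCommGroup M] [Module ℂ M] : A ⊗[ℂ] M ≃ₗ[ℂ] (ℕ × ℕ →₀ M) :=
  TensorProduct.equivFinsuppOfBasisLeft h.basis

theorem tensorCoeff_tmul (a : A) (m : M) (k : ℕ × ℕ) :
    h.tensorCoeff M (a ⊗ₜ m) k = h.coeff k a • m :=
  TensorProduct.equivFinsuppOfBasisLeft_apply_tmul_apply h.basis a m k

theorem tensorCoeff_right_succ (f : A ⊗[ℂ] M) (i j : ℕ) :
    h.tensorCoeff M (tensorRightMul M v f) (i, j + 1) = h.tensorCoeff M f (i, j) := by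
  induction f with
  | zero => simp
  | tmul a m => simp [tensorCoeff_tmul, h.coeff_mul_right_succ]
  | add f g hf hg => simp only [map_add, Finsupp.add_apply, hf, hg]

theorem tensorCoeff_left_succ (f : A ⊗[ℂ] M) (i j : ℕ) :
    h.tensorCoeff M (tensorRightMul M u f) (i + 1, j) = c ^ j • h.tensorCoeff M f (i, j) := by
  induction f with
  | zero => simp
  | tmul a m => simp [tensorCoeff_tmul, h.coeff_mul_left_succ, mul_smul]
  | add f g hf hg => simp only [map_add, Finsupp.add_apply, hf, hg, smul_add]

variable [Module A M] [IsScalarTower ℂ A M]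

/-- The map `(f, g) ↦ f (u ⊗ 1 - 1 ⊗ u) + g (v ⊗ 1 - 1 ⊗ v)` on `(A ⊗ M)²`. -/
def koszulOne (u v : A) (M : Type) [AddCommGroup M] [Module ℂ M] [Module A M]
    [IsScalarTower ℂ A M] : (A ⊗[ℂ] M) × (A ⊗[ℂ] M) →ₗ[A] A ⊗[ℂ] M :=
  (tensorRightMul M u - tensorActMul M u).coprod (tensorRightMul M v - tensorActMul M v)

/-- The map `f ↦ (f (v ⊗ 1 - c ⊗ v), f (1 ⊗ u - c u ⊗ 1))` on `A ⊗ M`. -/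
def koszulTwo (c : ℂ) (u v : A) (M : Type) [AddCommGroup M] [Module ℂ M] [Module A M]
    [IsScalarTower ℂ A M] : A ⊗[ℂ] M →ₗ[A] (A ⊗[ℂ] M) × (A ⊗[ℂ] M) :=
  (tensorRightMul M v - tensorActMul M (c • v)).prod
    (tensorActMul M u - tensorRightMul M (c • u))

include h in
theorem koszulOne_koszulTwo (f : A ⊗[ℂ] M) : koszulOne u v M (koszulTwo c u v M f) = 0 := by
  induction f with
  | zero => simp
  | tmul a m =>
    have e : v • u • m = c • u • v • m := by
      rw [← mul_smul, h.comm, smul_assoc, mul_smul]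
    simp [koszulOne, koszulTwo, mul_assoc, h.comm, TensorProduct.tmul_smul,
      TensorProduct.smul_tmul', e]
    abel
  | add f g hf hg => rw [map_add, map_add, hf, hg, add_zero]

theorem tensorAct_koszulOne (f : (A ⊗[ℂ] M) × (A ⊗[ℂ] M)) :
    tensorAct A M (koszulOne u v M f) = 0 := by
  obtain ⟨f, g⟩ := f
  have key : ∀ (x : A) (f : A ⊗[ℂ] M),
      tensorAct A M ((tensorRightMul M x - tensorActMul M x) f) = 0 := by
    intro x f
    induction f with
    | zero => simp
    | tmul a m => simp [mul_smul]
    | add f g hf hg => rw [map_add, map_add, hf, hg, add_zero]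
  simp only [koszulOne, LinearMap.coprod_apply, map_add, key, add_zero]

include h in
-- Telescoping: moving the last letter of a monomial across the tensor sign changes a ⊗ m by a
-- boundary. Moving all letters shows that f is congruent to 1 ⊗ (its product), which vanishes by
-- assumption.
theorem exists_koszulOne {f : A ⊗[ℂ] M} (hf : tensorAct A M f = 0) :
    ∃ g, koszulOne u v M g = f := by
  have key : ∀ (a : A) (m : M), ∃ g, koszulOne u v M g = a ⊗ₜ m - 1 ⊗ₜ (a • m) := by
    intro a
    induction a using h.induction with
    | hm k l =>
      induction l with
      | zero =>
        rw [pow_zero, mul_one]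
        induction k with
        | zero => intro m; exact ⟨0, by simp⟩
        | succ k ih =>
          intro m
          obtain ⟨g, hg⟩ := ih (u • m)
          refine ⟨g + ((u ^ k) ⊗ₜ m, 0), ?_⟩
          rw [map_add, hg, pow_succ, mul_smul]
          simp [koszulOne]
      | succ l ih =>
        intro m
        obtain ⟨g, hg⟩ := ih (v • m)
        refine ⟨g + (0, (u ^ k * v ^ l) ⊗ₜ m), ?_⟩
        rw [map_add, hg, pow_succ, ← mul_assoc, mul_smul _ v]
        simp [koszulOne]
    | hadd a b ha hb =>
      intro m
      obtain ⟨g, hg⟩ := ha m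
      obtain ⟨g', hg'⟩ := hb m
      exact ⟨g + g', by rw [map_add, hg, hg', add_smul, TensorProduct.add_tmul,
        TensorProduct.tmul_add]; abel⟩
    | hsmul t a ha =>
      intro m
      obtain ⟨g, hg⟩ := ha m
      exact ⟨algebraMap ℂ A t • g, by rw [map_smul, hg, smul_sub, algebraMap_smul,
        algebraMap_smul, smul_assoc, TensorProduct.smul_tmul',
        TensorProduct.tmul_smul t (1 : A) (a • m)]⟩
  have key2 : ∀ f : A ⊗[ℂ] M, ∃ g, koszulOne u v M g = f - 1 ⊗ₜ tensorAct A M f := by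
    intro f
    induction f with
    | zero => exact ⟨0, by simp⟩
    | tmul a m => simpa using key a m
    | add f g hf hg =>
      obtain ⟨x, hx⟩ := hf
      obtain ⟨y, hy⟩ := hg
      exact ⟨x + y, by rw [map_add, hx, hy, map_add, TensorProduct.tmul_add]; abel⟩
  obtain ⟨g, hg⟩ := key2 f
  exact ⟨g, by rw [hg, hf, TensorProduct.tmul_zero, sub_zero]⟩

theorem tensorCoeff_act (x : A) (f : A ⊗[ℂ] M) (k : ℕ × ℕ) :
    h.tensorCoeff M (tensorActMul M x f) k = x • h.tensorCoeff M f k := by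
  induction f with
  | zero => simp
  | tmul a m => rw [tensorActMul_tmul, tensorCoeff_tmul, tensorCoeff_tmul, smul_comm]
  | add f g hf hg => simp only [map_add, Finsupp.add_apply, hf, hg, smul_add]

/-- The coefficients satisfy f_{i,j} = v f_{i,j+1}, and the support is finite, so descending
induction on j from beyond the support kills f. Only positive v-exponents are assumed to vanish,
because this is all that `exists_koszulTwo` can supply. -/
theorem eq_zero_of_right {f : A ⊗[ℂ] M} (hf : ∀ i j,
    h.tensorCoeff M ((tensorRightMul M v - tensorActMul M v) f) (i, j + 1) = 0) : f = 0 := by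
  have e : ∀ i j, h.tensorCoeff M f (i, j) = v • h.tensorCoeff M f (i, j + 1) := by
    intro i j
    have := hf i j
    rw [LinearMap.sub_apply, map_sub, Finsupp.sub_apply, h.tensorCoeff_right_succ,
      h.tensorCoeff_act, sub_eq_zero] at this
    exact this
  by_contra hne
  obtain ⟨N, hN⟩ : ∃ N, ∀ k ∈ (h.tensorCoeff M f).support, k.2 < N := by
    obtain ⟨N, hN⟩ := ((h.tensorCoeff M f).support.image Prod.snd).bddAbove
    exact ⟨N + 1, fun k hk => Nat.lt_succ_of_le (hN (Finset.mem_coe.mpr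
      (Finset.mem_image_of_mem _ hk)))⟩
  have big : ∀ i j, N ≤ j → h.tensorCoeff M f (i, j) = 0 := fun i j hj => by
    by_contra hc
    exact absurd (hN (i, j) (Finsupp.mem_support_iff.mpr hc)) (by simpa using hj)
  have all : ∀ k i j, N ≤ j + k → h.tensorCoeff M f (i, j) = 0 := by
    intro k
    induction k with
    | zero => exact fun i j hj => big i j (by simpa using hj)
    | succ k ih => intro i j hj; rw [e, ih i (j + 1) (by omega), smul_zero]
  apply hne
  apply (h.tensorCoeff M).injective
  rw [map_zero]
  ext ⟨i, j⟩
  exact all N i j (by omega)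

include h in
-- The same descent in the direction of u. The free scalar t covers both t = c, for injectivity of
-- the second differential, and t = 1, for exactness in the middle.
theorem eq_zero_of_left {t : ℂ} (ht : t ≠ 0) {f : A ⊗[ℂ] M}
    (hf : (tensorRightMul M (t • u) - tensorActMul M u) f = 0) : f = 0 := by
  have hR : ∀ f : A ⊗[ℂ] M, tensorRightMul M (t • u) f = t • tensorRightMul M u f := by
    intro f
    induction f with
    | zero => simp
    | tmul a m => simp [TensorProduct.smul_tmul']
    | add f g hf hg => rw [map_add, hf, hg, map_add, smul_add]
  have e : ∀ i j, h.tensorCoeff M f (i, j) =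
      (t * c ^ j)⁻¹ • u • h.tensorCoeff M f (i + 1, j) := by
    intro i j
    have h1 : h.tensorCoeff M ((tensorRightMul M (t • u) - tensorActMul M u) f) (i + 1, j) = 0 := by
      rw [hf]; simp
    rw [LinearMap.sub_apply, map_sub, Finsupp.sub_apply, hR, map_smul, Finsupp.smul_apply,
      h.tensorCoeff_left_succ, h.tensorCoeff_act, sub_eq_zero, smul_smul] at h1
    rw [← h1, inv_smul_smul₀ (mul_ne_zero ht (pow_ne_zero _ h.ne_zero))]
  by_contra hne
  obtain ⟨N, hN⟩ : ∃ N, ∀ k ∈ (h.tensorCoeff M f).support, k.1 < N := by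
    obtain ⟨N, hN⟩ := ((h.tensorCoeff M f).support.image Prod.fst).bddAbove
    exact ⟨N + 1, fun k hk => Nat.lt_succ_of_le (hN (Finset.mem_coe.mpr
      (Finset.mem_image_of_mem _ hk)))⟩
  have big : ∀ i j, N ≤ i → h.tensorCoeff M f (i, j) = 0 := fun i j hj => by
    by_contra hc
    exact absurd (hN (i, j) (Finsupp.mem_support_iff.mpr hc)) (by simpa using hj)
  have all : ∀ k i j, N ≤ i + k → h.tensorCoeff M f (i, j) = 0 := by
    intro k
    induction k with
    | zero => exact fun i j hj => big i j (by simpa using hj)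
    | succ k ih => intro i j hj; rw [e, ih (i + 1) j (by omega), smul_zero, smul_zero]
  apply hne
  apply (h.tensorCoeff M).injective
  rw [map_zero]
  ext ⟨i, j⟩
  exact all N i j (by omega)

include h in
theorem koszulTwo_injective : Function.Injective (koszulTwo c u v M) := by
  rw [← LinearMap.ker_eq_bot, LinearMap.ker_eq_bot']
  intro f hf
  have h1 : tensorActMul M u f - tensorRightMul M (c • u) f = 0 := congrArg Prod.snd hf
  exact h.eq_zero_of_left h.ne_zero (by
    rw [LinearMap.sub_apply, (sub_eq_zero.mp h1), sub_self])

/-- Division with remainder by `v ⊗ 1 - c ⊗ v` in `A ⊗ M`. -/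
theorem exists_tensor_div (f : A ⊗[ℂ] M) : ∃ g r : A ⊗[ℂ] M,
    f = (tensorRightMul M v - tensorActMul M (c • v)) g + r ∧
      ∀ i j, h.tensorCoeff M r (i, j + 1) = 0 := by
  have hadd : ∀ f f' : A ⊗[ℂ] M,
    (∃ g r : A ⊗[ℂ] M, f = (tensorRightMul M v - tensorActMul M (c • v)) g + r ∧
      ∀ i j, h.tensorCoeff M r (i, j + 1) = 0) →
    (∃ g r : A ⊗[ℂ] M, f' = (tensorRightMul M v - tensorActMul M (c • v)) g + r ∧
      ∀ i j, h.tensorCoeff M r (i, j + 1) = 0) →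
    ∃ g r : A ⊗[ℂ] M, f + f' = (tensorRightMul M v - tensorActMul M (c • v)) g + r ∧
      ∀ i j, h.tensorCoeff M r (i, j + 1) = 0 := by
    rintro f f' ⟨g, r, rfl, hr⟩ ⟨g', r', rfl, hr'⟩
    exact ⟨g + g', r + r', by rw [map_add]; abel, fun i j => by
      rw [map_add, Finsupp.add_apply, hr, hr', add_zero]⟩
  induction f with
  | zero => exact ⟨0, 0, by simp, by simp⟩
  | add f g hf hg => exact hadd _ _ hf hg
  | tmul a m =>
    induction a using h.induction generalizing m with
    | hm k l =>
      induction l generalizing m with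
      | zero =>
        refine ⟨0, (u ^ k * v ^ 0) ⊗ₜ m, by simp, fun i j => ?_⟩
        rw [h.tensorCoeff_tmul, h.coeff_monomial (i, j + 1) (k, 0), if_neg (by simp), zero_smul]
      | succ l ih =>
        -- Modulo the image of v ⊗ 1 - c ⊗ v, one factor v moves across the tensor sign with a
        -- factor c, which lowers the v-exponent by one.
        obtain ⟨g, r, hg, hr⟩ := ih ((c • v) • m)
        refine ⟨(u ^ k * v ^ l) ⊗ₜ m + g, r, ?_, hr⟩
        rw [map_add, add_assoc, ← hg]
        simp [pow_succ, mul_assoc]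
    | hadd a b ha hb => rw [TensorProduct.add_tmul]; exact hadd _ _ (ha m) (hb m)
    | hsmul t a ha => rw [TensorProduct.smul_tmul]; exact ha _

include h in
-- Subtracting a boundary reduces the first component to a remainder r free of v. The cycle
-- condition then forces first the other component and then r itself to vanish.
theorem exists_koszulTwo {f : (A ⊗[ℂ] M) × (A ⊗[ℂ] M)} (hf : koszulOne u v M f = 0) :
    ∃ g, koszulTwo c u v M g = f := by
  obtain ⟨f, f'⟩ := f
  obtain ⟨g, r, hg, hr⟩ := h.exists_tensor_div f
  have e := h.koszulOne_koszulTwo (M := M) g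
  set s := f' - (tensorActMul M u - tensorRightMul M (c • u)) g with hs
  have e2 : (f, f') = koszulTwo c u v M g + (r, s) := by
    rw [hs, hg]
    simp [koszulTwo]
  rw [e2, map_add, e, zero_add] at hf
  have e3 : (tensorRightMul M u - tensorActMul M u) r +
    (tensorRightMul M v - tensorActMul M v) s = 0 := hf
  -- Since r has no v in its left factor, neither has its image under u ⊗ 1 - 1 ⊗ u. Hence the image
  -- of s has no coefficient at positive v-exponents.
  have hs0 : s = 0 := by
    refine h.eq_zero_of_right fun i j => ?_
    rw [eq_neg_of_add_eq_zero_right e3, map_neg, Finsupp.neg_apply, neg_eq_zero,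
      LinearMap.sub_apply, map_sub, Finsupp.sub_apply, h.tensorCoeff_act, hr, smul_zero, sub_zero]
    cases i with
    | succ i => rw [h.tensorCoeff_left_succ, hr, smul_zero]
    | zero =>
      clear * -
      induction r with
      | zero => simp
      | tmul a m => simp [tensorCoeff_tmul, h.coeff_mul_left_zero]
      | add f g hf hg => simp only [map_add, Finsupp.add_apply, hf, hg, add_zero]
  have hr0 : r = 0 := by
    refine h.eq_zero_of_left one_ne_zero ?_
    rw [hs0, map_zero, add_zero] at e3
    rwa [one_smul]
  exact ⟨g, by rw [e2, hr0, hs0]; simp⟩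

end IsQuantumPlane
end

/-! ### Global dimension at most two -/

noncomputable section

open CategoryTheory

/-- The short exact sequence in the category of modules given by linear maps. -/
theorem ModuleCat.shortExact_of_linearMap {A X Y Z : Type} [Ring A] [AddCommGroup X]
    [AddCommGroup Y] [AddCommGroup Z] [Module A X] [Module A Y] [Module A Z] (f : X →ₗ[A] Y)
    (g : Y →ₗ[A] Z) (hf : Function.Injective f) (hg : Function.Surjective g)
    (hfg : Function.Exact f g) : ∃ w : ModuleCat.ofHom f ≫ ModuleCat.ofHom g = 0,
      (ShortComplex.mk (ModuleCat.ofHom f) (ModuleCat.ofHom g) w).ShortExact := by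
  have w : ModuleCat.ofHom f ≫ ModuleCat.ofHom g = 0 := by
    ext x
    exact hfg.apply_apply_eq_zero x
  refine ⟨w, ?_⟩
  have h1 : Mono (ModuleCat.ofHom f) := (ModuleCat.mono_iff_injective _).mpr hf
  have h2 : Epi (ModuleCat.ofHom g) := (ModuleCat.epi_iff_surjective _).mpr hg
  refine { exact := ?_ }
  rw [ShortComplex.ShortExact.moduleCat_exact_iff_function_exact]
  exact hfg

theorem ModuleCat.shortExact_ker {A Y Z : Type} [Ring A] [AddCommGroup Y] [AddCommGroup Z]
    [Module A Y] [Module A Z] (g : Y →ₗ[A] Z) (hg : Function.Surjective g) :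
    ∃ w : ModuleCat.ofHom (LinearMap.ker g).subtype ≫ ModuleCat.ofHom g = 0,
      (ShortComplex.mk (ModuleCat.ofHom (LinearMap.ker g).subtype) (ModuleCat.ofHom g)
        w).ShortExact :=
  ModuleCat.shortExact_of_linearMap _ g (Submodule.subtype_injective _) hg
    (LinearMap.exact_subtype_ker_map g)

namespace IsQuantumPlane

variable {A : Type} [Ring A] [Algebra ℂ A] {c : ℂ} {u v : A} (h : IsQuantumPlane c u v)

/-- The map `koszulOne`, with values in the kernel of the multiplication. -/
def koszulOneKer (u v : A) (M : Type) [AddCommGroup M] [Module ℂ M] [Module A M]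
    [IsScalarTower ℂ A M] :
    (A ⊗[ℂ] M) × (A ⊗[ℂ] M) →ₗ[A] LinearMap.ker (tensorAct A M) :=
  (koszulOne u v M).codRestrict (LinearMap.ker (tensorAct A M)) tensorAct_koszulOne

include h in
-- The Koszul complex is spliced from two short exact sequences at the kernel of A ⊗ M → M. Its
-- terms are free over A because M is free over the field ℂ.
theorem hasProjectiveDimensionLT_three (M : Type) [AddCommGroup M] [Module ℂ M] [Module A M]
    [IsScalarTower ℂ A M] : HasProjectiveDimensionLT (ModuleCat.of A M) 3 := by
  have p1 : Projective (ModuleCat.of A (A ⊗[ℂ] M)) :=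
    ModuleCat.projective_of_free (Module.Free.chooseBasis A (A ⊗[ℂ] M))
  have p2 : Projective (ModuleCat.of A ((A ⊗[ℂ] M) × (A ⊗[ℂ] M))) :=
    ModuleCat.projective_of_free (Module.Free.chooseBasis A ((A ⊗[ℂ] M) × (A ⊗[ℂ] M)))
  obtain ⟨w, hw⟩ := ModuleCat.shortExact_ker (tensorAct A M) tensorAct_surjective
  obtain ⟨w', hw'⟩ := ModuleCat.shortExact_of_linearMap (X := A ⊗[ℂ] M)
    (Y := (A ⊗[ℂ] M) × (A ⊗[ℂ] M)) (Z := LinearMap.ker (tensorAct A M)) (koszulTwo c u v M)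
    (koszulOneKer u v M)
    h.koszulTwo_injective (by
      rintro ⟨f, hf⟩
      obtain ⟨g, rfl⟩ := h.exists_koszulOne hf
      exact ⟨g, rfl⟩) (by
      intro f
      refine ⟨fun hf => ?_, ?_⟩
      · exact h.exists_koszulTwo (congrArg Subtype.val hf)
      · rintro ⟨g, rfl⟩
        exact Subtype.ext (h.koszulOne_koszulTwo g))
  have q1 := hw'.hasProjectiveDimensionLT_X₃ 1 (by exact inferInstance) (by
    exact hasProjectiveDimensionLT_of_ge _ 1 2 (by norm_num))
  exact hw.hasProjectiveDimensionLT_X₃ 2 q1 (by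
    exact hasProjectiveDimensionLT_of_ge _ 1 3 (by norm_num))

include h in
theorem globalDimension_le : globalDimension A ≤ 2 := by
  refine iSup_le fun M => ?_
  -- The tensor product A ⊗ M is over ℂ, so M is given the vector space structure restricted from A.
  let _ : Module ℂ M := Module.compHom M (algebraMap ℂ A)
  have _ : IsScalarTower ℂ A M := IsScalarTower.of_compHom ℂ A M
  exact (projectiveDimension_le_iff M 2).mpr (h.hasProjectiveDimensionLT_three M)

end IsQuantumPlane
end

/-! ### Ext from the trivial module to a quantum plane -/

noncomputable section

open CategoryTheory Abelian

section
variable {A : Type} [Ring A]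

theorem shortExact_ideal (I : Ideal A) :
    ∃ w : ModuleCat.ofHom I.subtype ≫ ModuleCat.ofHom I.mkQ = 0,
      (ShortComplex.mk (ModuleCat.ofHom I.subtype) (ModuleCat.ofHom I.mkQ) w).ShortExact :=
  ModuleCat.shortExact_of_linearMap _ _ (Submodule.subtype_injective _)
    (Submodule.mkQ_surjective _) (LinearMap.exact_subtype_mkQ I)

/-- The Yoneda class of `0 → I → A → A / I → 0`. -/
def idealExt (I : Ideal A) : Ext.{0} (ModuleCat.of A (A ⧸ I)) (ModuleCat.of A I) 1 :=
  (shortExact_ideal I).choose_spec.extClass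

/-- Right multiplication by `a`. -/
def rightMulHom (a : A) : ModuleCat.of A A ⟶ ModuleCat.of A A :=
  ModuleCat.ofHom (LinearMap.toSpanSingleton A A a)

theorem exists_rightMulHom (f : ModuleCat.of A A ⟶ ModuleCat.of A A) :
    ∃ a : A, f = rightMulHom a := by
  refine ⟨f.hom (1 : A), ?_⟩
  ext
  simp [rightMulHom]

theorem projective_self : Projective (ModuleCat.of A A) :=
  ModuleCat.projective_of_free (Module.Free.chooseBasis A A)

theorem projective_prod : Projective (ModuleCat.of A (A × A)) :=
  ModuleCat.projective_of_free (Module.Free.chooseBasis A (A × A))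

/-- Dimension shifting: the obstruction lies in Ext^(m+1)(A, A), which is zero because A is
projective. -/
theorem exists_idealExt_comp {m : ℕ} (x : Ext.{0} (ModuleCat.of A (A ⧸ I)) (ModuleCat.of A A) (m + 1)) :
    ∃ y : Ext.{0} (ModuleCat.of A I) (ModuleCat.of A A) m,
      (idealExt I).comp y (add_comm 1 m) = x := by
  have := projective_self (A := A)
  exact Ext.contravariant_sequence_exact₃ (shortExact_ideal I).choose_spec _ x
    (Ext.eq_zero_of_projective _) (add_comm 1 m)

end

namespace IsQuantumPlane

variable {A : Type} [Ring A] [Algebra ℂ A] {c : ℂ} {u v : A} (h : IsQuantumPlane c u v)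

/-- The augmentation ideal as a left ideal; this is the surjectivity of A² → A_{≥1} in the
resolution of the trivial module. -/
theorem exists_of_coeff_zero' {a : A} (ha : h.coeff (0, 0) a = 0) :
    ∃ x y, a = x * u + y * v := by
  have key : ∀ a : A, ∃ x y, a = algebraMap ℂ A (h.coeff (0, 0) a) + x * u + y * v := by
    intro a
    induction a using h.induction with
    | hm k l =>
      have e := h.coeff_monomial (0, 0) (k, l)
      simp only [Prod.mk.injEq] at e
      rw [e]
      rcases l with _ | l
      · rcases k with _ | k
        · exact ⟨0, 0, by simp⟩
        · exact ⟨u ^ k, 0, by simp [pow_succ]⟩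
      · exact ⟨0, u ^ k * v ^ l, by simp [pow_succ, mul_assoc]⟩
    | hadd a b ha hb =>
      obtain ⟨x, y, hx⟩ := ha
      obtain ⟨x', y', hx'⟩ := hb
      refine ⟨x + x', y + y', ?_⟩
      conv_lhs => rw [hx, hx']
      rw [map_add, map_add, add_mul, add_mul]
      abel
    | hsmul t a ha =>
      obtain ⟨x, y, hx⟩ := ha
      refine ⟨t • x, t • y, ?_⟩
      conv_lhs => rw [hx]
      rw [map_smul, smul_add, smul_add, smul_mul_assoc, smul_mul_assoc, smul_eq_mul, map_mul,
        ← Algebra.smul_def]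
  obtain ⟨x, y, hx⟩ := key a
  exact ⟨x, y, by rw [hx, ha]; simp⟩

/-- The map `A → A²`, `a ↦ (a v, - c a u)`. -/
def relationMap (c : ℂ) (u v : A) : A →ₗ[A] A × A :=
  (LinearMap.toSpanSingleton A A v).prod (LinearMap.toSpanSingleton A A (-(c • u)))

theorem relationMap_apply (a : A) : relationMap c u v a = (a * v, -(c • (a * u))) := by
  simp [relationMap]

section

variable {I : Ideal A} (hI : ∀ a, a ∈ I ↔ h.coeff (0, 0) a = 0)
include h hI

theorem left_mem : u ∈ I := (hI u).mpr (by simpa using h.coeff_mul_left_zero 0 1)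

theorem right_mem : v ∈ I := (hI v).mpr (by simpa using h.coeff_mul_right_zero 0 1)

/-- The map `A² → A_{≥ 1}`, `(a, b) ↦ a u + b v`. -/
def augmentationMap : A × A →ₗ[A] I :=
  ((LinearMap.toSpanSingleton A A u).coprod (LinearMap.toSpanSingleton A A v)).codRestrict I
    fun k => I.add_mem (I.mul_mem_left k.1 (h.left_mem hI)) (I.mul_mem_left k.2 (h.right_mem hI))

theorem augmentationMap_apply (a b : A) :
    (h.augmentationMap hI (a, b) : A) = a * u + b * v := rfl

/-- Exactness in the middle is the computation of the left syzygies of (u, v). Spliced with I → A →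
A/I, this is the free resolution of length two of the trivial module. -/
theorem shortExact_relation :
    ∃ w : ModuleCat.ofHom (relationMap c u v) ≫ ModuleCat.ofHom (h.augmentationMap hI) = 0,
      (ShortComplex.mk (ModuleCat.ofHom (relationMap c u v))
        (ModuleCat.ofHom (h.augmentationMap hI)) w).ShortExact := by
  refine ModuleCat.shortExact_of_linearMap _ _ ?_ ?_ ?_
  · rw [← LinearMap.ker_eq_bot, LinearMap.ker_eq_bot']
    intro a ha
    rw [relationMap_apply] at ha
    exact h.eq_zero_of_mul_right (congrArg Prod.fst ha)
  · rintro ⟨a, ha⟩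
    obtain ⟨x, y, rfl⟩ := h.exists_of_coeff_zero' ((hI a).mp ha)
    exact ⟨(x, y), rfl⟩
  · rintro ⟨a, b⟩
    refine ⟨fun hab => ?_, ?_⟩
    · obtain ⟨e, rfl, rfl⟩ := h.exists_of_mul_add_mul_eq_zero (congrArg Subtype.val hab)
      exact ⟨e, relationMap_apply e⟩
    · rintro ⟨e, he⟩
      rw [← he, relationMap_apply]
      refine Subtype.ext ?_
      rw [h.augmentationMap_apply, mul_assoc, h.comm, neg_mul, smul_mul_assoc, mul_smul_comm,
        mul_assoc, add_neg_cancel]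
      rfl

/-- The Yoneda class of `0 → A → A² → A_{≥ 1} → 0`. -/
def relationExt : Ext.{0} (ModuleCat.of A I) (ModuleCat.of A A) 1 :=
  (h.shortExact_relation hI).choose_spec.extClass

/-- The class in `Ext²(A / A_{≥ 1}, A)` of the homomorphism `A → A` given by `a`. -/
def extTwo (a : A) : Ext.{0} (ModuleCat.of A (A ⧸ I)) (ModuleCat.of A A) 2 :=
  (idealExt I).comp ((h.relationExt hI).comp (Ext.mk₀ (rightMulHom a)) (add_zero 1))
    (show 1 + 1 = 2 from rfl)

theorem exists_relationExt_comp {m : ℕ}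
    (x : Ext.{0} (ModuleCat.of A I) (ModuleCat.of A A) (m + 1)) :
    ∃ y : Ext.{0} (ModuleCat.of A A) (ModuleCat.of A A) m,
      (h.relationExt hI).comp y (add_comm 1 m) = x := by
  have := projective_prod (A := A)
  exact Ext.contravariant_sequence_exact₃ (h.shortExact_relation hI).choose_spec _ x
    (Ext.eq_zero_of_projective _) (add_comm 1 m)

/-- The image of the class of 1 under a homomorphism A/I → A is annihilated by u, which is not a
zero divisor. -/
theorem ext_zero (x : Ext.{0} (ModuleCat.of A (A ⧸ I)) (ModuleCat.of A A) 0) : x = 0 := by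
  obtain ⟨f, rfl⟩ := Ext.mk₀_bijective _ _ |>.2 x
  have e : f = 0 := by
    have h1 : f.hom (I.mkQ 1) = 0 := by
      refine h.eq_zero_of_left_mul ?_
      rw [← smul_eq_mul, ← map_smul, ← map_smul, smul_eq_mul, mul_one,
        show I.mkQ u = 0 from (Submodule.Quotient.mk_eq_zero I).mpr (h.left_mem hI), map_zero]
    refine ModuleCat.hom_ext (LinearMap.ext fun x => ?_)
    obtain ⟨a, rfl⟩ := I.mkQ_surjective x
    have e1 : I.mkQ a = a • I.mkQ 1 := by rw [← map_smul, smul_eq_mul, mul_one]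
    rw [e1, map_smul, h1]
    simp
  rw [e, Ext.mk₀_zero]

/-- A class comes from a homomorphism f : I → A, whose values satisfy v f(u) = c u f(v). This forces
f(u) = u e and f(v) = v e. So f is the restriction of right multiplication by e on A, and restricted
maps give the zero class. -/
theorem ext_one (x : Ext.{0} (ModuleCat.of A (A ⧸ I)) (ModuleCat.of A A) 1) : x = 0 := by
  obtain ⟨y, rfl⟩ := exists_idealExt_comp x
  obtain ⟨f, rfl⟩ := Ext.mk₀_bijective _ _ |>.2 y
  set fu : A := f.hom (⟨u, h.left_mem hI⟩ : I)
  set fv : A := f.hom (⟨v, h.right_mem hI⟩ : I)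
  have e1 : v * fu = c • (u * fv) := by
    have e : v • (⟨u, h.left_mem hI⟩ : I) = (c • u) • (⟨v, h.right_mem hI⟩ : I) :=
      Subtype.ext (by simp [h.comm])
    have e2 := congrArg (fun t : I => (f.hom t : A)) e
    simp only [map_smul, smul_eq_mul] at e2
    rw [← smul_mul_assoc]
    exact e2
  obtain ⟨e, he, he'⟩ := h.exists_of_mul_eq_smul e1
  have hf : f = ModuleCat.ofHom I.subtype ≫ rightMulHom e := by
    ext ⟨a, ha⟩
    obtain ⟨x, y, rfl⟩ := h.exists_of_coeff_zero' ((hI a).mp ha)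
    have e3 : (⟨x * u + y * v, ha⟩ : I) =
      x • (⟨u, h.left_mem hI⟩ : I) + y • (⟨v, h.right_mem hI⟩ : I) := rfl
    rw [e3, map_add, map_smul, map_smul]
    change x * fu + y * fv = (x * u + y * v) * e
    rw [he, he', add_mul, mul_assoc, mul_assoc]
  rw [hf, ← Ext.mk₀_comp_mk₀]
  exact (shortExact_ideal I).choose_spec.extClass_comp_assoc _

theorem ext_three_add (m : ℕ)
    (x : Ext.{0} (ModuleCat.of A (A ⧸ I)) (ModuleCat.of A A) (m + 3)) : x = 0 := by
  obtain ⟨y, rfl⟩ := exists_idealExt_comp x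
  obtain ⟨z, rfl⟩ := h.exists_relationExt_comp hI y
  have := projective_self (A := A)
  rw [Ext.eq_zero_of_projective z, Ext.comp_zero, Ext.comp_zero]

theorem exists_extTwo (x : Ext.{0} (ModuleCat.of A (A ⧸ I)) (ModuleCat.of A A) 2) :
    ∃ a, x = h.extTwo hI a := by
  obtain ⟨y, rfl⟩ := exists_idealExt_comp x
  obtain ⟨z, rfl⟩ := h.exists_relationExt_comp hI y
  obtain ⟨f, rfl⟩ := Ext.mk₀_bijective _ _ |>.2 z
  obtain ⟨a, rfl⟩ := exists_rightMulHom f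
  exact ⟨a, rfl⟩

theorem extTwo_add (a b : A) : h.extTwo hI (a + b) = h.extTwo hI a + h.extTwo hI b := by
  have e : rightMulHom (a + b) = rightMulHom a + rightMulHom b := by
    ext; simp [rightMulHom]
  rw [extTwo, e, Ext.mk₀_add, Ext.comp_add, Ext.comp_add]; rfl

theorem extTwo_smul (t : ℂ) (a : A) : h.extTwo hI (t • a) = t • h.extTwo hI a := by
  have e : Ext.mk₀ (rightMulHom (t • a)) = t • Ext.mk₀ (rightMulHom a) := by
    rw [← Ext.mk₀_smul]
    congr 1
    ext
    change (1 : A) * (t • a) = algebraMap ℂ A t * ((1 : A) * a)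
    rw [one_mul, one_mul, Algebra.smul_def]
  rw [extTwo, e, Ext.comp_smul, Ext.comp_smul]; rfl

/-- Right multiplication by ux + vy extends along the inclusion A → A² of the relation, and the
extension class composed with that inclusion is zero. -/
theorem extTwo_eq_zero {a : A} (ha : a ∈ I) : h.extTwo hI a = 0 := by
  obtain ⟨x, y, rfl⟩ := h.exists_of_coeff_zero ((hI a).mp ha)
  -- The extension sends (a v, -c a u) to a v y + (-c a u)(-c⁻¹ x) = a(ux + vy), which explains the
  -- coefficient -c⁻¹ x.
  have e : rightMulHom (u * x + v * y) = ModuleCat.ofHom (relationMap c u v) ≫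
      ModuleCat.ofHom ((LinearMap.toSpanSingleton A A y).coprod
        (LinearMap.toSpanSingleton A A (-(c⁻¹ • x)))) := by
    ext
    simp [rightMulHom, relationMap_apply, smul_smul, h.ne_zero, add_comm]
  rw [extTwo, e, ← Ext.mk₀_comp_mk₀]
  have e2 := (h.shortExact_relation hI).choose_spec.extClass_comp_assoc
    (Ext.mk₀ (ModuleCat.ofHom ((LinearMap.toSpanSingleton A A y).coprod
        (LinearMap.toSpanSingleton A A (-(c⁻¹ • x)))))) (h := add_zero 1)
  exact (congrArg (fun t => (idealExt I).comp t rfl) e2).trans (Ext.comp_zero _ _ _ _ _)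

/-- Going back through the two connecting maps, vanishing would make the identity of A extend to A²
along the relation. Then 1 = v f(1, 0) - c u f(0, 1), which has no constant term. -/
theorem extTwo_one_ne_zero : h.extTwo hI 1 ≠ 0 := by
  intro h0
  have := projective_self (A := A)
  obtain ⟨y, hy⟩ := Ext.contravariant_sequence_exact₁ (shortExact_ideal I).choose_spec _ _ rfl h0
  rw [Ext.eq_zero_of_projective y, Ext.comp_zero] at hy
  obtain ⟨z, hz⟩ := Ext.contravariant_sequence_exact₁ (h.shortExact_relation hI).choose_spec
    _ _ rfl hy.symm
  obtain ⟨f, rfl⟩ := Ext.mk₀_bijective _ _ |>.2 z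
  rw [Ext.mk₀_comp_mk₀] at hz
  have e := (Ext.mk₀_bijective _ _).1 hz
  have e1 : f.hom (relationMap c u v 1) = (1 : A) := by
    have := congrArg (fun g => g.hom (1 : A)) e
    simpa [rightMulHom] using this
  rw [relationMap_apply] at e1
  have e2 : ((1 : A) * v, -(c • ((1 : A) * u))) = v • ((1 : A), (0 : A)) + (-(c • u)) • ((0 : A), (1 : A)) := by
    simp
  rw [e2, map_add, map_smul, map_smul] at e1
  have e3 := congrArg (h.coeff (0, 0)) e1
  rw [map_add, smul_eq_mul, smul_eq_mul, neg_mul, smul_mul_assoc, map_neg, map_smul,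
    h.coeff_left_mul_zero, h.coeff_right_mul_zero, h.coeff_one] at e3
  simp at e3

end

end IsQuantumPlane
end

/-! ### Artin-Schelter regularity of quantum planes -/

noncomputable section

open CategoryTheory Abelian

namespace IsQuantumPlane

variable {A : Type} [Ring A] [Algebra ℂ A] {c : ℂ} {u v : A} (h : IsQuantumPlane c u v)

theorem extTwo_comp {I : Ideal A} (hI : ∀ a, a ∈ I ↔ h.coeff (0, 0) a = 0) (a b : A) :
    (h.extTwo hI a).comp (Ext.mk₀ (rightMulHom b)) (add_zero 2) = h.extTwo hI (a * b) := by
  have e : rightMulHom (a * b) = rightMulHom a ≫ rightMulHom b := by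
    ext
    simp [rightMulHom]
  rw [extTwo, extTwo, e, ← Ext.mk₀_comp_mk₀, Ext.comp_assoc_of_third_deg_zero,
    Ext.comp_assoc_of_third_deg_zero]

/-- Every class is given by an element of A, elements of the augmentation ideal give zero, and the
class of 1 survives. So Ext² is A/A_{≥1}. -/
theorem finrank_extTwo {I : Ideal A} (hI : ∀ a, a ∈ I ↔ h.coeff (0, 0) a = 0) :
    Module.finrank ℂ (Ext.{0} (ModuleCat.of A (A ⧸ I)) (ModuleCat.of A A) 2) = 1 := by
  refine (finrank_eq_one_iff_of_nonzero' (h.extTwo hI 1) (h.extTwo_one_ne_zero hI)).mpr ?_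
  intro x
  obtain ⟨a, rfl⟩ := h.exists_extTwo hI x
  refine ⟨h.coeff (0, 0) a, ?_⟩
  have e1 : a = h.coeff (0, 0) a • 1 + (a - h.coeff (0, 0) a • 1) := by abel
  conv_rhs => rw [e1]
  have e2 : h.extTwo hI (a - h.coeff (0, 0) a • 1) = 0 := h.extTwo_eq_zero hI ((hI _).mpr (by
    rw [map_sub, map_smul, h.coeff_one, smul_eq_mul, mul_one, sub_self]))
  rw [h.extTwo_add, h.extTwo_smul, e2, add_zero]

section gkDimension

/-- The span of the monomials `u ^ i v ^ j` with `i, j ≤ N`. -/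
def boxSpan (u v : A) (N : ℕ) : Submodule ℂ A :=
  Submodule.span ℂ ((fun k : ℕ × ℕ => u ^ k.1 * v ^ k.2) ''
    (Finset.range (N + 1) ×ˢ Finset.range (N + 1) : Finset (ℕ × ℕ)))

theorem mem_boxSpan {N i j : ℕ} (hi : i ≤ N) (hj : j ≤ N) : u ^ i * v ^ j ∈ boxSpan u v N :=
  Submodule.subset_span ⟨(i, j), by simp; omega, rfl⟩

theorem boxSpan_mono {N N' : ℕ} (hN : N ≤ N') : boxSpan u v N ≤ boxSpan u v N' := by
  refine Submodule.span_le.mpr ?_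
  rintro _ ⟨⟨i, j⟩, hij, rfl⟩
  simp only [Finset.coe_product, Finset.coe_range, Set.mem_prod, Set.mem_Iio] at hij
  exact mem_boxSpan (by omega) (by omega)

theorem finiteDimensional_boxSpan (N : ℕ) : FiniteDimensional ℂ (boxSpan u v N) :=
  FiniteDimensional.span_of_finite ℂ ((Finset.finite_toSet _).image _)

theorem finrank_boxSpan_le (N : ℕ) : Module.finrank ℂ (boxSpan u v N) ≤ (N + 1) ^ 2 := by
  classical
  rw [boxSpan, ← Finset.coe_image]
  refine (finrank_span_finset_le_card _).trans (Finset.card_image_le.trans ?_)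
  rw [Finset.card_product, Finset.card_range, sq]

include h

theorem boxSpan_mul_le (N N' : ℕ) : boxSpan u v N * boxSpan u v N' ≤ boxSpan u v (N + N') := by
  rw [boxSpan, boxSpan, Submodule.span_mul_span, Submodule.span_le]
  rintro _ ⟨_, ⟨⟨i, j⟩, hij, rfl⟩, _, ⟨⟨k, l⟩, hkl, rfl⟩, rfl⟩
  simp only [Finset.coe_product, Finset.coe_range, Set.mem_prod, Set.mem_Iio] at hij hkl
  have e : u ^ i * v ^ j * (u ^ k * v ^ l) = c ^ (k * j) • (u ^ (i + k) * v ^ (j + l)) := by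
    rw [mul_assoc, ← mul_assoc (v ^ j), pow_mul_pow_of_mul_eq_smul h.comm, smul_mul_assoc,
      mul_smul_comm, pow_add, pow_add]
    simp only [mul_assoc]
  change u ^ i * v ^ j * (u ^ k * v ^ l) ∈ _
  rw [e]
  exact Submodule.smul_mem _ _ (mem_boxSpan (by omega) (by omega))

theorem exists_mem_boxSpan (a : A) : ∃ N, a ∈ boxSpan u v N := by
  induction a using h.induction with
  | hm i j => exact ⟨max i j, mem_boxSpan (le_max_left _ _) (le_max_right _ _)⟩
  | hadd a b ha hb =>
    obtain ⟨N, hN⟩ := ha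
    obtain ⟨N', hN'⟩ := hb
    exact ⟨max N N', Submodule.add_mem _ (boxSpan_mono (le_max_left _ _) hN)
      (boxSpan_mono (le_max_right _ _) hN')⟩
  | hsmul t a ha =>
    obtain ⟨N, hN⟩ := ha
    exact ⟨N, Submodule.smul_mem _ _ hN⟩

theorem exists_le_boxSpan (V : Submodule ℂ A) [FiniteDimensional ℂ V] :
    ∃ N, V ≤ boxSpan u v N := by
  obtain ⟨S, rfl⟩ : V.FG := (Submodule.fg_top V).mp Module.Finite.fg_top
  choose N hN using h.exists_mem_boxSpan
  refine ⟨S.sup N, Submodule.span_le.mpr fun a ha => ?_⟩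
  exact boxSpan_mono (Finset.le_sup (f := N) ha) (hN a)

theorem pow_le_boxSpan {V : Submodule ℂ A} {N : ℕ} (hV : V ≤ boxSpan u v N) (m : ℕ) :
    V ^ m ≤ boxSpan u v (N * m) := by
  induction m with
  | zero =>
    rw [pow_zero, Submodule.one_le]
    simpa using mem_boxSpan (u := u) (v := v) (N := N * 0) (Nat.zero_le _) (Nat.zero_le _)
  | succ m ih =>
    rw [pow_succ]
    exact (mul_le_mul' ih hV).trans (h.boxSpan_mul_le _ _)

/-- Only finiteness is needed, so a crude bound is enough. If V lies in the box of side N, then V^m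
lies in the box of side Nm, of dimension at most (Nm + 1)² ≤ m³ for large m. -/
theorem gkDimension_le : gkDimension A ≤ 3 := by
  refine iSup_le ?_
  rintro ⟨V, hV, -⟩
  obtain ⟨N, hN⟩ := h.exists_le_boxSpan V
  refine Filter.limsup_le_of_le ?_ ?_
  · exact Filter.isCobounded_le_of_bot
  -- The threshold lets one factor m absorb the constant (N + 1)² and also gives m > 1, so that log
  -- m is positive.
  filter_upwards [Filter.eventually_ge_atTop ((N + 1) ^ 2 + 1)] with m hm
  have hm1 : 1 < m := by nlinarith [Nat.zero_le N]
  have := finiteDimensional_boxSpan (u := u) (v := v) (N * m)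
  have h1 : Module.finrank ℂ ↥(V ^ m) ≤ m ^ 3 := by
    refine (Submodule.finrank_mono (h.pow_le_boxSpan hN m)).trans
      ((finrank_boxSpan_le _).trans ?_)
    calc (N * m + 1) ^ 2 ≤ ((N + 1) * m) ^ 2 := Nat.pow_le_pow_left (by nlinarith) 2
      _ = (N + 1) ^ 2 * m ^ 2 := by ring
      _ ≤ m * m ^ 2 := Nat.mul_le_mul_right _ (by omega)
      _ = m ^ 3 := by ring
  have hlog : 0 < Real.log m := Real.log_pos (by exact_mod_cast hm1)
  have h2 : Real.log (Module.finrank ℂ ↥(V ^ m)) / Real.log m ≤ 3 := by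
    rw [div_le_iff₀ hlog]
    rcases Nat.eq_zero_or_pos (Module.finrank ℂ ↥(V ^ m)) with h0 | h0
    · rw [h0]; simp; positivity
    · have := Real.log_le_log (by exact_mod_cast h0) (show
        ((Module.finrank ℂ ↥(V ^ m) : ℕ) : ℝ) ≤ (m : ℝ) ^ 3 by exact_mod_cast h1)
      rwa [Real.log_pow] at this
  exact EReal.coe_le_coe_iff.mpr h2

end gkDimension

section grading

variable {𝒜 : ℕ → Submodule ℂ A} (hg : IsConnectedGraded 𝒜) {d e : ℕ} (hd : 0 < d) (he : 0 < e)
  (hu : u ∈ 𝒜 d) (hv : v ∈ 𝒜 e)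
include hg hd he hu hv

/-- This matches the trivial module defined by the grading with the kernel of the constant
coefficient used in the Ext computation. The grading is arbitrary apart from positive degrees of u
and v, since the generators of the fixed ring have degrees n and 2n. -/
theorem mem_augmentation_iff (a : A) :
    a ∈ Ideal.span {a : A | ∃ m, 0 < m ∧ a ∈ 𝒜 m} ↔ h.coeff (0, 0) a = 0 := by
  have := hg.gradedMonoid
  have key : ∀ a : A, a - h.coeff (0, 0) a • (1 : A) ∈ ⨆ m, ⨆ (_ : m ≠ 0), 𝒜 m := by
    intro a
    induction a using h.induction with
    | hm i j =>
      have e1 := h.coeff_monomial (0, 0) (i, j)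
      simp only [Prod.mk.injEq] at e1
      rw [e1]
      split_ifs with hij
      · obtain ⟨rfl, rfl⟩ := hij
        simp
      · rw [zero_smul, sub_zero]
        have e2 := SetLike.mul_mem_graded (SetLike.pow_mem_graded i hu)
          (SetLike.pow_mem_graded j hv)
        refine Submodule.mem_iSup_of_mem _ (Submodule.mem_iSup_of_mem ?_ e2)
        intro h0
        simp only [smul_eq_mul, Nat.add_eq_zero_iff, mul_eq_zero] at h0
        omega
    | hadd a b ha hb =>
      rw [map_add, add_smul, add_sub_add_comm]
      exact Submodule.add_mem _ ha hb
    | hsmul t a ha =>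
      rw [map_smul, smul_assoc, ← smul_sub]
      exact Submodule.smul_mem _ _ ha
  constructor
  · intro ha
    induction ha using Submodule.span_induction with
    | mem a ha =>
      obtain ⟨m, hm, ha⟩ := ha
      -- The constant term of a positive-degree element lies both in degree 0 and in the sum of the
      -- other components, so it is zero.
      have h1 : h.coeff (0, 0) a • (1 : A) ∈ ⨆ m, ⨆ (_ : m ≠ 0), 𝒜 m := by
        have := Submodule.sub_mem _ (show a ∈ ⨆ m, ⨆ (_ : m ≠ 0), 𝒜 m from
          Submodule.mem_iSup_of_mem m (Submodule.mem_iSup_of_mem hm.ne' ha)) (key a)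
        rwa [sub_sub_cancel] at this
      have h2 : h.coeff (0, 0) a • (1 : A) ∈ 𝒜 0 :=
        Submodule.smul_mem _ _ (SetLike.one_mem_graded 𝒜)
      have h3 := Submodule.disjoint_def.mp (hg.isInternal.submodule_iSupIndep 0) _ h2 h1
      have h4 := congrArg (h.coeff (0, 0)) h3
      rwa [map_smul, h.coeff_one, smul_eq_mul, mul_one, map_zero] at h4
    | zero => simp
    | add a b _ _ ha hb => rw [map_add, ha, hb, add_zero]
    | smul a b _ hb => rw [smul_eq_mul, h.coeff_zero_mul, hb, mul_zero]
  · intro ha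
    obtain ⟨x, y, rfl⟩ := h.exists_of_coeff_zero' ha
    exact Ideal.add_mem _ (Ideal.mul_mem_left _ _ (Ideal.subset_span ⟨d, hd, hu⟩))
      (Ideal.mul_mem_left _ _ (Ideal.subset_span ⟨e, he, hv⟩))

include h in
/-- A quantum plane with generators of positive degree is Artin-Schelter regular. -/
theorem isASRegularOfDim : IsASRegularOfDim 𝒜 2 := by
  have hI := h.mem_augmentation_iff hg hd he hu hv
  refine ⟨hg, ?_, ?_, ?_, ?_, ?_⟩
  · refine le_antisymm h.globalDimension_le ?_
    refine le_trans ?_ (le_iSup _ (trivialModule 𝒜))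
    -- The nonzero class in Ext² shows that the trivial module already has projective dimension at
    -- least 2.
    refine (projectiveDimension_ge_iff _ 2).mpr fun hp => ?_
    have : HasProjectiveDimensionLT
      (ModuleCat.of A (A ⧸ Ideal.span {a : A | ∃ m, 0 < m ∧ a ∈ 𝒜 m})) 2 := hp
    exact h.extTwo_one_ne_zero hI (Ext.eq_zero_of_hasProjectiveDimensionLT _ 2 le_rfl)
  · exact lt_of_le_of_lt h.gkDimension_le (EReal.coe_lt_top 3)
  · intro i hi
    refine subsingleton_of_forall_eq 0 fun x => ?_
    obtain rfl | rfl | ⟨m, rfl⟩ : i = 0 ∨ i = 1 ∨ ∃ m, i = m + 3 := by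
      rcases i with _ | _ | _ | m
      · exact Or.inl rfl
      · exact Or.inr (Or.inl rfl)
      · exact absurd rfl hi
      · exact Or.inr (Or.inr ⟨m, rfl⟩)
    · exact h.ext_zero hI x
    · exact h.ext_one hI x
    · exact h.ext_three_add hI m x
  · exact h.finrank_extTwo hI
  · intro x m a hm ha
    obtain ⟨b, rfl⟩ := h.exists_extTwo hI x
    refine (h.extTwo_comp hI b a).trans (h.extTwo_eq_zero hI ?_)
    exact Ideal.mul_mem_left _ _ (Ideal.subset_span ⟨m, hm, ha⟩)

end grading

end IsQuantumPlane
end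

/-! ### A⁺ as a quantum plane, and the grading of a fixed ring -/

noncomputable section

namespace IsQuantumPlane

variable {A : Type} [Ring A] [Algebra ℂ A] {c : ℂ} {u v : A} (h : IsQuantumPlane c u v)

theorem mem_of_coeff {S : Submodule ℂ A} {a : A}
    (ha : ∀ i j, h.coeff (i, j) a ≠ 0 → u ^ i * v ^ j ∈ S) : a ∈ S := by
  rw [← h.basis.linearCombination_repr a, Finsupp.linearCombination_apply]
  refine Submodule.sum_mem _ fun k hk => Submodule.smul_mem _ _ ?_
  rw [h.basis_apply]
  exact ha k.1 k.2 (Finsupp.mem_support_iff.mp hk)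

/-- By the shift rules, each factor from span{u, v} raises the total degree by exactly one. This
separates the graded pieces, which are defined only as powers of a subspace. -/
theorem coeff_eq_zero_of_mem_span_pow {m : ℕ} {a : A} (ha : a ∈ Submodule.span ℂ {u, v} ^ m)
    (i j : ℕ) (hij : i + j ≠ m) : h.coeff (i, j) a = 0 := by
  let W : ℕ → Submodule ℂ A := fun m => ⨅ k : ℕ × ℕ, ⨅ _ : k.1 + k.2 ≠ m, LinearMap.ker (h.coeff k)
  have hW : ∀ m a, a ∈ W m ↔ ∀ i j, i + j ≠ m → h.coeff (i, j) a = 0 := by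
    intro m a
    simp only [W, Submodule.mem_iInf, LinearMap.mem_ker, Prod.forall]
  have key : Submodule.span ℂ {u, v} ^ m ≤ W m := by
    clear ha hij
    induction m with
    | zero =>
      rw [pow_zero, Submodule.one_le, hW]
      intro i j hij
      have e := h.coeff_monomial (i, j) (0, 0)
      rw [if_neg (by rintro ⟨⟩; exact hij rfl)] at e
      simpa using e
    | succ m ih =>
      rw [pow_succ, Submodule.mul_le]
      intro a ha b hb
      obtain ⟨x, y, rfl⟩ := Submodule.mem_span_pair.mp hb
      have ha' := (hW _ _).mp (ih ha)
      rw [mul_add, mul_smul_comm, mul_smul_comm]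
      refine Submodule.add_mem _ (Submodule.smul_mem _ _ ?_) (Submodule.smul_mem _ _ ?_)
      · refine (hW _ _).mpr fun i j hij => ?_
        cases i with
        | zero => exact h.coeff_mul_left_zero j a
        | succ i => rw [h.coeff_mul_left_succ, ha' i j (by omega), mul_zero]
      · refine (hW _ _).mpr fun i j hij => ?_
        cases j with
        | zero => exact h.coeff_mul_right_zero i a
        | succ j => rw [h.coeff_mul_right_succ, ha' i j (by omega)]
  exact (hW _ _).mp (key ha) i j hij

omit h in
theorem monomial_mem_span_pow (i j : ℕ) :
    u ^ i * v ^ j ∈ Submodule.span ℂ {u, v} ^ (i + j) := by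
  rw [pow_add]
  exact Submodule.mul_mem_mul
    (Submodule.pow_mem_pow _ (Submodule.subset_span (by simp)) i)
    (Submodule.pow_mem_pow _ (Submodule.subset_span (by simp)) j)

include h in
theorem isConnectedGraded :
    IsConnectedGraded (fun m => (Submodule.span ℂ {u, v} : Submodule ℂ A) ^ m) where
  gradedMonoid :=
    { one_mem := by rw [pow_zero]; exact Submodule.one_le.mp le_rfl
      mul_mem := fun i j a b ha hb => by rw [pow_add]; exact Submodule.mul_mem_mul ha hb }
  isInternal := by
    refine DirectSum.isInternal_submodule_of_iSupIndep_of_iSup_eq_top ?_ ?_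
    · intro m
      rw [Submodule.disjoint_def]
      intro a ha ha'
      have h2 : (⨆ j, ⨆ (_ : j ≠ m), (Submodule.span ℂ {u, v} : Submodule ℂ A) ^ j) ≤
          ⨅ k : ℕ × ℕ, ⨅ _ : k.1 + k.2 = m, LinearMap.ker (h.coeff k) := by
        refine iSup₂_le fun j hj => le_iInf₂ fun k hk b hb => ?_
        exact h.coeff_eq_zero_of_mem_span_pow hb _ _ (by omega)
      refine h.ext_coeff fun i j => ?_
      rw [map_zero]
      by_cases hij : i + j = m
      · have h3 := h2 ha'
        simp only [Submodule.mem_iInf] at h3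
        exact h3 (i, j) hij
      · exact h.coeff_eq_zero_of_mem_span_pow ha i j hij
    · rw [eq_top_iff]
      intro a _
      exact h.mem_of_coeff fun i j _ => Submodule.mem_iSup_of_mem (i + j)
        (monomial_mem_span_pow i j)
  connected := by
    rw [pow_zero, Submodule.one_eq_span]
    refine finrank_span_singleton fun h0 => ?_
    have := h.coeff_one
    rw [h0, map_zero] at this
    exact zero_ne_one this

end IsQuantumPlane

namespace Aplus

variable (n : ℕ) (i j : ℤ)

/-- The parameter of the quantum plane `A⁺`. -/
def param : ℂ := -pRoot n ^ (i ^ 2 - j ^ 2)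

theorem param_ne_zero : param n i j ≠ 0 := neg_ne_zero.mpr (zpow_ne_zero _ (pRoot_ne_zero n))

theorem v_mul_u : v n i j * u n i j = param n i j • (u n i j * v n i j) := by
  rw [param, neg_smul]
  exact eq_neg_of_add_eq_zero_right (rel n i j)

/-- Multiplication by the generators on the space with basis the monomials. -/
def monomialRep (k : Fin 2) : Module.End ℂ (ℕ × ℕ →₀ ℂ) :=
  ![Finsupp.linearCombination ℂ fun k => Finsupp.single (k.1 + 1, k.2) 1,
    Finsupp.linearCombination ℂ fun k => Finsupp.single (k.1, k.2 + 1) (param n i j ^ k.1)] k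

theorem monomialRep_zero (a b : ℕ) (t : ℂ) :
    monomialRep n i j 0 (Finsupp.single (a, b) t) = Finsupp.single (a + 1, b) t := by
  simp [monomialRep]

theorem monomialRep_one (a b : ℕ) (t : ℂ) : monomialRep n i j 1 (Finsupp.single (a, b) t) =
    Finsupp.single (a, b + 1) (param n i j ^ a * t) := by
  simp [monomialRep, mul_comm]

theorem monomialRep_rel : pRoot n ^ (i ^ 2 - j ^ 2) • (monomialRep n i j 0 * monomialRep n i j 1) +
    monomialRep n i j 1 * monomialRep n i j 0 = 0 := by
  have e : pRoot n ^ (i ^ 2 - j ^ 2) = - param n i j := (neg_neg _).symm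
  refine Finsupp.lhom_ext fun k t => ?_
  obtain ⟨a, b⟩ := k
  simp only [LinearMap.add_apply, LinearMap.smul_apply, Module.End.mul_apply, monomialRep_zero,
    monomialRep_one, e, Finsupp.smul_single, ← Finsupp.single_add, LinearMap.zero_apply]
  rw [smul_eq_mul, pow_succ, show -param n i j * (param n i j ^ a * t) +
    param n i j ^ a * param n i j * t = 0 by ring, Finsupp.single_zero]

/-- Independence: in the representation on the formal monomials, u^a v^b sends the vector at (0, 0)
to the one at (a, b). Spanning: the span of the monomials contains 1 and is stable under left
multiplication by u and v. -/
theorem isQuantumPlane : IsQuantumPlane (param n i j) (u n i j) (v n i j) where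
  comm := v_mul_u n i j
  ne_zero := param_ne_zero n i j
  linearIndependent := by
    let f : Aplus n i j →ₗ[ℂ] (ℕ × ℕ →₀ ℂ) := LinearMap.applyₗ (Finsupp.single (0, 0) 1) ∘ₗ
      (lift n i j (monomialRep n i j) (monomialRep_rel n i j)).toLinearMap
    refine LinearIndependent.of_comp f ?_
    have e : f ∘ (fun k : ℕ × ℕ => u n i j ^ k.1 * v n i j ^ k.2) =
        fun k => Finsupp.single k (1 : ℂ) := by
      funext ⟨a, b⟩
      have h1 : ∀ b, (monomialRep n i j 1 ^ b) (Finsupp.single (0, 0) 1) =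
          Finsupp.single (0, b) (1 : ℂ) := by
        intro b
        induction b with
        | zero => simp
        | succ b ih => rw [pow_succ', Module.End.mul_apply, ih, monomialRep_one]; simp
      have h2 : ∀ a, (monomialRep n i j 0 ^ a) (Finsupp.single (0, b) 1) =
          Finsupp.single (a, b) (1 : ℂ) := by
        intro a
        induction a with
        | zero => simp
        | succ a ih => rw [pow_succ', Module.End.mul_apply, ih, monomialRep_zero]
      simp only [f, Function.comp_apply, LinearMap.comp_apply, AlgHom.toLinearMap_apply, map_mul,
        map_pow, u, v, lift_var, LinearMap.applyₗ_apply_apply, Module.End.mul_apply, h1, h2]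
    rw [e]
    have := (Finsupp.basisSingleOne (R := ℂ) (ι := ℕ × ℕ)).linearIndependent
    rwa [Finsupp.coe_basisSingleOne] at this
  span_eq_top := by
    set S := Submodule.span ℂ (Set.range fun k : ℕ × ℕ => u n i j ^ k.1 * v n i j ^ k.2) with hS
    have key : ∀ a : Aplus n i j, ∀ b ∈ S, a * b ∈ S := by
      intro a
      induction a using induction with
      | hC c => intro b hb; rw [← Algebra.smul_def]; exact Submodule.smul_mem _ _ hb
      | hv k =>
        intro b hb
        induction hb using Submodule.span_induction with
        | mem b hb =>
          obtain ⟨⟨a, b⟩, rfl⟩ := hb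
          fin_cases k
          · exact Submodule.subset_span ⟨(a + 1, b), by simp [pow_succ', mul_assoc, u]⟩
          · change v n i j * (u n i j ^ a * v n i j ^ b) ∈ S
            have e := pow_mul_pow_of_mul_eq_smul (v_mul_u n i j) a 1
            rw [pow_one] at e
            rw [← mul_assoc, e, smul_mul_assoc, mul_assoc, ← pow_succ']
            exact Submodule.smul_mem _ _ (Submodule.subset_span ⟨(a, b + 1), rfl⟩)
        | zero => simp
        | add b c _ _ hb hc => rw [mul_add]; exact Submodule.add_mem _ hb hc
        | smul t b _ hb => rw [mul_smul_comm]; exact Submodule.smul_mem _ _ hb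
      | hmul a b ha hb => intro c hc; rw [mul_assoc]; exact ha _ (hb _ hc)
      | hadd a b ha hb =>
        intro c hc
        rw [add_mul]
        exact Submodule.add_mem _ (ha c hc) (hb c hc)
    intro a _
    rw [← mul_one a]
    exact key a 1 (Submodule.subset_span ⟨(0, 0), by simp⟩)

theorem isConnectedGraded : IsConnectedGraded (grading n i j) :=
  (isQuantumPlane n i j).isConnectedGraded

theorem isASRegularOfDim_grading : IsASRegularOfDim (grading n i j) 2 :=
  (isQuantumPlane n i j).isASRegularOfDim (isConnectedGraded n i j) one_pos one_pos
    (by rw [grading, pow_one]; exact Submodule.subset_span (by simp))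
    (by rw [grading, pow_one]; exact Submodule.subset_span (by simp))

end Aplus

section fixedRing

variable {H A : Type} [Ring H] [HopfAlgebra ℂ H] [Ring A] [Algebra ℂ A] [Module H A]
  [IsScalarTower ℂ H A] [IsModuleAlgebra H A]

theorem mem_fixedRing {a : A} :
    a ∈ fixedRing H A ↔ ∀ h : H, h • a = Coalgebra.counit (R := ℂ) h • a := Iff.rfl

/-- The fixed ring of a grading-preserving action on a connected graded algebra is connected
graded. -/
theorem IsConnectedGraded.fixedGrading {𝒜 : ℕ → Submodule ℂ A} (hg : IsConnectedGraded 𝒜)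
    (hs : ∀ (m : ℕ) (h : H) (a : A), a ∈ 𝒜 m → h • a ∈ 𝒜 m) :
    IsConnectedGraded (fixedGrading H 𝒜) where
  gradedMonoid :=
    { one_mem := hg.gradedMonoid.one_mem
      mul_mem := fun i j a b ha hb => hg.gradedMonoid.mul_mem ha hb }
  isInternal := by
    have := hg.isInternal.chooseDecomposition
    -- Projection to a graded component commutes with H because H preserves degrees. Hence the
    -- components of a fixed element are fixed.
    have hd : ∀ (m : ℕ) (h : H) (a : A),
        ((DirectSum.decompose 𝒜 (h • a)) m : A) = h • (DirectSum.decompose 𝒜 a m : A) := by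
      intro m h a
      induction a using DirectSum.Decomposition.inductionOn 𝒜 with
      | zero => simp
      | @homogeneous i a =>
        have h1 := DirectSum.decompose_of_mem 𝒜 (hs i h a a.2)
        rw [h1, DirectSum.decompose_coe]
        rcases eq_or_ne i m with rfl | him
        · rw [DirectSum.of_eq_same, DirectSum.of_eq_same]
        · rw [DirectSum.of_eq_of_ne _ _ _ him.symm, DirectSum.of_eq_of_ne _ _ _ him.symm]
          simp
      | add a b ha hb =>
        rw [smul_add, DirectSum.decompose_add, DirectSum.decompose_add, DirectSum.add_apply,
          DirectSum.add_apply, Submodule.coe_add, Submodule.coe_add, ha, hb, smul_add]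
    have hf : ∀ (m : ℕ) (a : fixedRing H A), (DirectSum.decompose 𝒜 (a : A) m : A) ∈
        fixedRing H A := by
      intro m a h
      rw [← hd, mem_fixedRing.mp a.2 h, DirectSum.decompose_smul]
      rfl
    refine DirectSum.isInternal_submodule_of_iSupIndep_of_iSup_eq_top ?_ ?_
    · intro m
      rw [Submodule.disjoint_def]
      intro a ha ha'
      have h1 : (⨆ j, ⨆ (_ : j ≠ m), _root_.fixedGrading H 𝒜 j) ≤
          (⨆ j, ⨆ (_ : j ≠ m), 𝒜 j).comap (fixedRing H A).val.toLinearMap :=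
        iSup₂_le fun j hj => Submodule.comap_mono
          (le_iSup₂ (f := fun j (_ : j ≠ m) => 𝒜 j) j hj)
      exact Subtype.ext (Submodule.disjoint_def.mp (hg.isInternal.submodule_iSupIndep m) _ ha
        (h1 ha'))
    · rw [eq_top_iff]
      intro a _
      classical
      have h1 : a = ∑ m ∈ (DirectSum.decompose 𝒜 (a : A)).support,
          (⟨_, hf m a⟩ : fixedRing H A) := by
        refine Subtype.ext ?_
        rw [AddSubmonoidClass.coe_finsetSum]
        exact (DirectSum.sum_support_decompose 𝒜 (a : A)).symm
      rw [h1]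
      exact Submodule.sum_mem _ fun m _ => Submodule.mem_iSup_of_mem m
        (show (DirectSum.decompose 𝒜 (a : A) m : A) ∈ 𝒜 m from Subtype.prop _)
  connected := by
    have h1 : (1 : A) ∈ 𝒜 0 := hg.gradedMonoid.one_mem
    have hne : (1 : A) ≠ 0 := by
      intro h0
      have : Subsingleton A := subsingleton_of_zero_eq_one h0.symm
      have := hg.connected
      rw [Module.finrank_zero_of_subsingleton] at this
      exact zero_ne_one this
    refine (finrank_eq_one_iff_of_nonzero' (⟨1, h1⟩ : _root_.fixedGrading H 𝒜 0) ?_).mpr ?_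
    · intro h0
      exact hne (congrArg (fun t : _root_.fixedGrading H 𝒜 0 => ((t : fixedRing H A) : A)) h0)
    · rintro ⟨a, ha⟩
      obtain ⟨t, ht⟩ := (finrank_eq_one_iff_of_nonzero' (⟨1, h1⟩ : 𝒜 0)
        (fun h0 => hne (congrArg Subtype.val h0))).mp hg.connected ⟨a, ha⟩
      exact ⟨t, Subtype.ext (Subtype.ext (congrArg (fun x : 𝒜 0 => (x : A)) ht))⟩

end fixedRing
end

/-! ### Structure of H: twisted action of z, spanning set, semisimplicity -/

noncomputable section

namespace Pansera

theorem pow_smul_of_smul {n : ℕ} {M : Type} [AddCommGroup M] [Module ℂ M] [Module (Pansera n) M]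
    [IsScalarTower ℂ (Pansera n) M] {g : Pansera n} {a : M} {t : ℂ} (h : g • a = t • a) (r : ℕ) :
    g ^ r • a = t ^ r • a := by
  induction r with
  | zero => simp
  | succ r ih => rw [pow_succ, mul_smul, h, smul_comm, ih, smul_smul, pow_succ']

section moduleAlgebra

variable {n : ℕ} [NeZero n] {A : Type} [Ring A] [Algebra ℂ A] [Module (Pansera n) A]
  [IsScalarTower ℂ (Pansera n) A] [IsModuleAlgebra (Pansera n) A]

theorem x_smul_mul (a b : A) : gen n .x • (a * b) = (gen n .x • a) * (gen n .x • b) := by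
  rw [IsModuleAlgebra.smul_mul, comul_apply, comulHom_x]; rfl

theorem y_smul_mul (a b : A) : gen n .y • (a * b) = (gen n .y • a) * (gen n .y • b) := by
  rw [IsModuleAlgebra.smul_mul, comul_apply, comulHom_y]; rfl

theorem x_smul_one : gen n .x • (1 : A) = 1 := by
  rw [IsModuleAlgebra.smul_one, counit_apply, counitHom_x, map_one]

theorem y_smul_one : gen n .y • (1 : A) = 1 := by
  rw [IsModuleAlgebra.smul_one, counit_apply, counitHom_y, map_one]

theorem z_smul_one : gen n .z • (1 : A) = 1 := by
  rw [IsModuleAlgebra.smul_one, counit_apply, counitHom_z, map_one]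

/-- The twisted multiplicativity of the action of `z` on weight vectors. -/
theorem z_smul_mul {a b : A} {s t : ℤ} (ha : gen n .y • a = qRoot n ^ s • a)
    (hb : gen n .x • b = qRoot n ^ t • b) :
    gen n .z • (a * b) = qRoot n ^ (s * t) • ((gen n .z • a) * (gen n .z • b)) := by
  -- By zy = xz and zx = yz, z interchanges x- and y-weights. The twist x^r ⊗ y^s, evaluated on za ⊗
  -- zb, therefore sees the y-weight of a and the x-weight of b.
  have ha' : gen n .x • gen n .z • a = qRoot n ^ s • gen n .z • a := by
    rw [← mul_smul, ← zy, mul_smul, ha, smul_comm]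
  have hb' : gen n .y • gen n .z • b = qRoot n ^ t • gen n .z • b := by
    rw [← mul_smul, ← zx, mul_smul, hb, smul_comm]
  have key : ∀ r r' : ℕ, LinearMap.mul' ℂ A (TensorProduct.map
      ((LinearMap.toSpanSingleton (Pansera n) A a).restrictScalars ℂ)
      ((LinearMap.toSpanSingleton (Pansera n) A b).restrictScalars ℂ)
      ((gen n .x ⊗ₜ[ℂ] (1 : Pansera n)) ^ r * ((1 : Pansera n) ⊗ₜ[ℂ] gen n .y) ^ r' *
        (gen n .z ⊗ₜ[ℂ] gen n .z))) =
      ((qRoot n ^ s) ^ r * (qRoot n ^ t) ^ r') • ((gen n .z • a) * (gen n .z • b)) := by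
    intro r r'
    simp only [Algebra.TensorProduct.tmul_pow, one_pow, Algebra.TensorProduct.tmul_mul_tmul,
      one_mul, mul_one, TensorProduct.map_tmul, LinearMap.mul'_apply, LinearMap.coe_restrictScalars,
      LinearMap.toSpanSingleton_apply, mul_smul, pow_smul_of_smul ha', pow_smul_of_smul hb',
      smul_mul_assoc, mul_smul_comm]
    exact smul_comm _ _ _
  rw [IsModuleAlgebra.smul_mul, comul_apply, comulHom_z, ← twistSum_zpow]
  simp only [twistSum, smul_mul_assoc, Finset.sum_mul, map_smul, map_sum, key]
  rw [smul_assoc, Finset.sum_smul]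
  congr 1
  refine Finset.sum_congr rfl fun r _ => ?_
  rw [Finset.sum_smul]
  exact Finset.sum_congr rfl fun r' _ => by rw [smul_smul, smul_eq_mul]

end moduleAlgebra

/-- The subspaces stable under the generators are stable under `H_{2n²}`. -/
theorem smul_mem_of_gen {n : ℕ} {M : Type} [AddCommGroup M] [Module ℂ M] [Module (Pansera n) M]
    [IsScalarTower ℂ (Pansera n) M] (S : Submodule ℂ M)
    (hS : ∀ g, ∀ m ∈ S, gen n g • m ∈ S) (h : Pansera n) : ∀ m ∈ S, h • m ∈ S := by
  induction h using induction with
  | hC c => intro m hm; rw [algebraMap_smul]; exact S.smul_mem _ hm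
  | hx => exact hS .x
  | hy => exact hS .y
  | hz => exact hS .z
  | hmul a b ha hb => intro m hm; rw [mul_smul]; exact ha _ (hb _ hm)
  | hadd a b ha hb => intro m hm; rw [add_smul]; exact S.add_mem (ha _ hm) (hb _ hm)

theorem mem_fixedRing_iff {n : ℕ} [NeZero n] {A : Type} [Ring A] [Algebra ℂ A]
    [Module (Pansera n) A] [IsScalarTower ℂ (Pansera n) A] [IsModuleAlgebra (Pansera n) A] {a : A} :
    a ∈ fixedRing (Pansera n) A ↔ gen n .x • a = a ∧ gen n .y • a = a ∧ gen n .z • a = a := by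
  constructor
  · intro ha
    rw [mem_fixedRing] at ha
    refine ⟨?_, ?_, ?_⟩
    · simpa [counit_apply] using ha (gen n .x)
    · simpa [counit_apply] using ha (gen n .y)
    · simpa [counit_apply] using ha (gen n .z)
  · rintro ⟨hx, hy, hz⟩ h
    rw [counit_apply]
    induction h using induction with
    | hC c => rw [algebraMap_smul, AlgHom.commutes]; rfl
    | hx => rw [hx, counitHom_x, one_smul]
    | hy => rw [hy, counitHom_y, one_smul]
    | hz => rw [hz, counitHom_z, one_smul]
    | hmul g h hg hh => rw [mul_smul, hh, smul_comm, hg, smul_smul, map_mul, mul_comm]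
    | hadd g h hg hh => rw [add_smul, hg, hh, map_add, add_smul]

section algebra

variable (n : ℕ) [NeZero n]

/-- The primitive idempotents of the group algebra of `⟨x, y⟩`. -/
def wtIdem (r s : ℕ) : Pansera n := twistSum.idem n (gen n .x) r * twistSum.idem n (gen n .y) s

omit [NeZero n] in
theorem z_mul_wtIdem (r s : ℕ) : gen n .z * wtIdem n r s = wtIdem n s r * gen n .z := by
  have key : ∀ (a b : Pansera n), gen n .z * a = b * gen n .z → ∀ r,
      gen n .z * twistSum.idem n a r = twistSum.idem n b r * gen n .z := by
    intro a b hab r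
    simp only [twistSum.idem, mul_smul_comm, smul_mul_assoc, Finset.mul_sum, Finset.sum_mul,
      ((show SemiconjBy (gen n .z) a b from hab).pow_right _).eq]
  rw [wtIdem, ← mul_assoc, key _ _ (zx n), mul_assoc, key _ _ (zy n), ← mul_assoc, wtIdem,
    (twistSum.commute_idem (twistSum.commute_idem (xy n) r).symm s).eq]

theorem x_mul_wtIdem (r s : ℕ) : gen n .x * wtIdem n r s = qRoot n ^ r • wtIdem n r s := by
  rw [wtIdem, ← mul_assoc, twistSum.mul_idem (x_pow n), smul_mul_assoc]

theorem y_mul_wtIdem (r s : ℕ) : gen n .y * wtIdem n r s = qRoot n ^ s • wtIdem n r s := by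
  rw [wtIdem, (twistSum.commute_idem (twistSum.commute_idem (xy n) s).symm r).eq.symm,
    ← mul_assoc, twistSum.mul_idem (y_pow n), smul_mul_assoc]

theorem z_sq_mul_wtIdem (r s : ℕ) :
    gen n .z * gen n .z * wtIdem n r s = qRoot n ^ (r * s) • wtIdem n r s := by
  have hx : ∀ k : ℕ, gen n .x ^ k * wtIdem n r s = (qRoot n ^ r) ^ k • wtIdem n r s := by
    intro k
    induction k with
    | zero => simp
    | succ k ih => rw [pow_succ', mul_assoc, ih, mul_smul_comm, x_mul_wtIdem, smul_smul, pow_succ]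
  have hy : ∀ k : ℕ, gen n .y ^ k * wtIdem n r s = (qRoot n ^ s) ^ k • wtIdem n r s := by
    intro k
    induction k with
    | zero => simp
    | succ k ih => rw [pow_succ', mul_assoc, ih, mul_smul_comm, y_mul_wtIdem, smul_smul, pow_succ]
  have e := twistSum_zpow n r s
  rw [zpow_natCast, zpow_natCast, ← Nat.cast_mul, zpow_natCast] at e
  rw [z_sq, ← e]
  simp only [twistSum, smul_mul_assoc, Finset.sum_mul, mul_assoc, hy, hx, mul_smul_comm, smul_smul,
    Finset.sum_smul, Finset.smul_sum, smul_eq_mul, Finset.mul_sum]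
  refine Finset.sum_congr rfl fun k _ => Finset.sum_congr rfl fun l _ => ?_
  congr 1
  ring

theorem sum_wtIdem :
    ∑ r ∈ Finset.range n, ∑ s ∈ Finset.range n, wtIdem n r s = 1 := by
  simp only [wtIdem, ← Finset.mul_sum, twistSum.sum_idem, mul_one]

/-- The algebra `H_{2n²}` is spanned by the `e_{rs}` and the `e_{rs} z`. -/
theorem span_wtIdem : Submodule.span ℂ (Set.range fun k : Fin n × Fin n × Fin 2 =>
    wtIdem n k.1 k.2.1 * gen n .z ^ (k.2.2 : ℕ)) = ⊤ := by
  rw [eq_top_iff]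
  set S := Submodule.span ℂ (Set.range fun k : Fin n × Fin n × Fin 2 =>
    wtIdem n k.1 k.2.1 * gen n .z ^ (k.2.2 : ℕ)) with hS
  have hm : ∀ (r s : Fin n) (e : Fin 2), wtIdem n r s * gen n .z ^ (e : ℕ) ∈ S :=
    fun r s e => Submodule.subset_span ⟨(r, s, e), rfl⟩
  have key : ∀ g, ∀ b ∈ S, gen n g • b ∈ S := by
    intro g b hb
    rw [smul_eq_mul]
    induction hb using Submodule.span_induction with
    | mem b hb =>
      obtain ⟨⟨r, s, e⟩, rfl⟩ := hb
      rw [← mul_assoc]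
      cases g with
      | x => rw [x_mul_wtIdem, smul_mul_assoc]; exact S.smul_mem _ (hm r s e)
      | y => rw [y_mul_wtIdem, smul_mul_assoc]; exact S.smul_mem _ (hm r s e)
      | z =>
        rw [z_mul_wtIdem, mul_assoc]
        fin_cases e
        · simpa using hm s r 1
        · change wtIdem n s r * (gen n .z * gen n .z ^ 1) ∈ S
          -- Two passages of z past the idempotent restore its indices, so z² commutes with it and
          -- acts there by a scalar. The powers z⁰ and z¹ therefore suffice.
          have e1 : wtIdem n s r * (gen n .z * gen n .z ^ 1) =
              qRoot n ^ (s * r : ℕ) • wtIdem n s r := by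
            rw [pow_one, ← z_sq_mul_wtIdem, mul_assoc (gen n .z), z_mul_wtIdem,
              ← mul_assoc (gen n .z), z_mul_wtIdem, mul_assoc]
          rw [e1]
          exact S.smul_mem _ (by simpa using hm s r 0)
    | zero => simp
    | add a b _ _ ha hb => rw [mul_add]; exact S.add_mem ha hb
    | smul t a _ ha => rw [mul_smul_comm]; exact S.smul_mem _ ha
  intro h _
  have h1 : (1 : Pansera n) ∈ S := by
    rw [← sum_wtIdem n]
    refine Submodule.sum_mem _ fun r hr => Submodule.sum_mem _ fun s hs => ?_
    simpa using hm ⟨r, Finset.mem_range.mp hr⟩ ⟨s, Finset.mem_range.mp hs⟩ 0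
  simpa using smul_mem_of_gen S key h 1 h1

theorem finiteDimensional : FiniteDimensional ℂ (Pansera n) :=
  Module.finite_def.mpr (span_wtIdem n ▸ Submodule.fg_span (Set.finite_range _))

theorem twistSum_pow_left {B : Type} [Ring B] [Algebra ℂ B] {a b : B} (hb : b ^ n = 1)
    (h : Commute a b) (k : ℕ) : twistSum n (a ^ k) b = twistSum n a b ^ k := by
  induction k with
  | zero => rw [pow_zero, pow_zero, twistSum.one_left]
  | succ k ih => rw [pow_succ, twistSum.mul_left hb ((Commute.refl a).pow_left k) h, ih, pow_succ]

/-- The twisted sum is multiplicative in its first argument, so the n-th power of z² is the twisted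
sum at (x^n, y) = (1, y), which is 1. -/
theorem z_pow : gen n .z ^ (2 * n) = 1 := by
  rw [pow_mul, sq, z_sq, ← twistSum_pow_left n (y_pow n) (xy n), x_pow, twistSum.one_left]

theorem gen_pow (g : PanseraGen) : gen n g ^ (2 * n) = 1 := by
  cases g
  · rw [mul_comm, pow_mul, x_pow, one_pow]
  · rw [mul_comm, pow_mul, y_pow, one_pow]
  · exact z_pow n

/-- The generators as units. -/
def genUnit (g : PanseraGen) : (Pansera n)ˣ :=
  Units.ofPowEqOne (gen n g) (2 * n) (gen_pow n g) (mul_ne_zero two_ne_zero (NeZero.ne n))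

@[simp] theorem val_genUnit (g : PanseraGen) : (genUnit n g : Pansera n) = gen n g := rfl

theorem isOfFinOrder_genUnit (g : PanseraGen) : IsOfFinOrder (genUnit n g) := by
  rw [isOfFinOrder_iff_pow_eq_one]
  exact ⟨2 * n, by have := NeZero.pos n; omega, Units.ext (gen_pow n g)⟩

/-- The finite group generated by `x`, `y`, `z` in the units of `H_{2n²}`. -/
def genGroup : Subgroup (Pansera n)ˣ := Subgroup.closure (Set.range (genUnit n))

open scoped Pointwise in
-- Conjugation by z swaps x and y, so every element can be written x^a y^b z^c, and the three
-- generators have finite order.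
instance finite_genGroup : Finite (genGroup n) := by
  have hxy : Commute (genUnit n .x) (genUnit n .y) := Units.ext (xy n).eq
  have hzx : SemiconjBy (genUnit n .z) (genUnit n .x) (genUnit n .y) := Units.ext (zx n)
  have hzy : SemiconjBy (genUnit n .z) (genUnit n .y) (genUnit n .x) := Units.ext (zy n)
  set X := genUnit n .x
  set Y := genUnit n .y
  set Z := genUnit n .z
  have fin : ((Subgroup.zpowers X : Set (Pansera n)ˣ) * (Subgroup.zpowers Y : Set (Pansera n)ˣ) *
      (Subgroup.zpowers Z : Set (Pansera n)ˣ)).Finite :=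
    ((isOfFinOrder_genUnit n .x).finite_zpowers.mul (isOfFinOrder_genUnit n .y).finite_zpowers).mul
      (isOfFinOrder_genUnit n .z).finite_zpowers
  refine (fin.subset ?_).to_subtype
  have hm : ∀ a b c : ℤ, X ^ a * Y ^ b * Z ^ c ∈ (Subgroup.zpowers X : Set (Pansera n)ˣ) *
      (Subgroup.zpowers Y : Set (Pansera n)ˣ) * (Subgroup.zpowers Z : Set (Pansera n)ˣ) :=
    fun a b c => Set.mul_mem_mul (Set.mul_mem_mul ⟨a, rfl⟩ ⟨b, rfl⟩) ⟨c, rfl⟩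
  have hZ : ∀ a b : ℤ, Z * (X ^ a * Y ^ b) = X ^ b * Y ^ a * Z := fun a b => by
    rw [← mul_assoc, (hzx.zpow_right a).eq, mul_assoc, (hzy.zpow_right b).eq, ← mul_assoc,
      (hxy.symm.zpow_zpow a b).eq]
  have hZ' : ∀ a b : ℤ, Z⁻¹ * (X ^ a * Y ^ b) = X ^ b * Y ^ a * Z⁻¹ := fun a b => by
    rw [inv_mul_eq_iff_eq_mul, ← mul_assoc, hZ, mul_inv_cancel_right]
  intro g hg
  induction hg using Subgroup.closure_induction_left with
  | one => simpa using hm 0 0 0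
  | mul_left g hg h _ hh =>
    obtain ⟨g, rfl⟩ := hg
    obtain ⟨_, ⟨_, ⟨a, rfl⟩, _, ⟨b, rfl⟩, rfl⟩, _, ⟨c, rfl⟩, rfl⟩ := hh
    simp only
    cases g with
    | x => simpa [zpow_add, mul_assoc] using hm (1 + a) b c
    | y =>
      have e : Y * (X ^ a * Y ^ b * Z ^ c) = X ^ a * Y ^ (1 + b) * Z ^ c := by
        rw [zpow_add, zpow_one, ← mul_assoc (X ^ a), (hxy.zpow_left a).eq]
        simp only [mul_assoc]
      exact e ▸ hm a (1 + b) c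
    | z =>
      have e : Z * (X ^ a * Y ^ b * Z ^ c) = X ^ b * Y ^ a * Z ^ (1 + c) := by
        rw [← mul_assoc, hZ, zpow_add, zpow_one, mul_assoc]
      exact e ▸ hm b a (1 + c)
  | inv_mul_cancel g hg h _ hh =>
    obtain ⟨g, rfl⟩ := hg
    obtain ⟨_, ⟨_, ⟨a, rfl⟩, _, ⟨b, rfl⟩, rfl⟩, _, ⟨c, rfl⟩, rfl⟩ := hh
    simp only
    cases g with
    | x => simpa [zpow_add, mul_assoc] using hm (-1 + a) b c
    | y =>
      have e : Y⁻¹ * (X ^ a * Y ^ b * Z ^ c) = X ^ a * Y ^ (-1 + b) * Z ^ c := by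
        rw [zpow_add, zpow_neg_one, ← mul_assoc (X ^ a), (hxy.inv_right.zpow_left a).eq]
        simp only [mul_assoc]
      exact e ▸ hm a (-1 + b) c
    | z =>
      have e : Z⁻¹ * (X ^ a * Y ^ b * Z ^ c) = X ^ b * Y ^ a * Z ^ (-1 + c) := by
        rw [← mul_assoc, hZ', zpow_add, zpow_neg_one, mul_assoc]
      exact e ▸ hm b a (-1 + c)

/-- Maschke: H is a quotient of the complex group algebra of the finite group generated by x, y, z.
-/
theorem isSemisimpleRing : IsSemisimpleRing (Pansera n) := by
  let f : MonoidAlgebra ℂ (genGroup n) →ₐ[ℂ] Pansera n :=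
    MonoidAlgebra.lift ℂ (Pansera n) (genGroup n) ((Units.coeHom _).comp (genGroup n).subtype)
  have : NeZero (Nat.card (genGroup n) : ℂ) := ⟨by exact_mod_cast Nat.card_pos.ne'⟩
  refine RingHom.isSemisimpleRing_of_surjective f.toRingHom fun h => ?_
  have hgen : ∀ g, gen n g ∈ f.range := fun g =>
    ⟨MonoidAlgebra.of ℂ _ ⟨genUnit n g, Subgroup.subset_closure ⟨g, rfl⟩⟩, by simp [f]⟩
  have : h ∈ f.range := by
    induction h using induction with
    | hC c => exact f.range.algebraMap_mem c
    | hx => exact hgen .x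
    | hy => exact hgen .y
    | hz => exact hgen .z
    | hmul a b ha hb => exact mul_mem ha hb
    | hadd a b ha hb => exact add_mem ha hb
  exact this

end algebra

end Pansera
end

/-! ### The action on monomials, and faithfulness -/

noncomputable section

namespace Aplus

open Pansera

variable (n : ℕ) (i j : ℤ) [NeZero n]

theorem x_smul_pow {a : Aplus n i j} {s : ℤ} (h : gen n .x • a = qRoot n ^ s • a) (k : ℕ) :
    gen n .x • a ^ k = qRoot n ^ (s * k) • a ^ k := by
  induction k with
  | zero => simp [x_smul_one]
  | succ k ih =>
    rw [pow_succ, x_smul_mul, ih, h, smul_mul_assoc, mul_smul_comm, smul_smul,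
      ← zpow_add₀ (twistSum.qRoot_ne_zero n)]
    push_cast
    ring_nf

theorem y_smul_pow {a : Aplus n i j} {s : ℤ} (h : gen n .y • a = qRoot n ^ s • a) (k : ℕ) :
    gen n .y • a ^ k = qRoot n ^ (s * k) • a ^ k := by
  induction k with
  | zero => simp [y_smul_one]
  | succ k ih =>
    rw [pow_succ, y_smul_mul, ih, h, smul_mul_assoc, mul_smul_comm, smul_smul,
      ← zpow_add₀ (twistSum.qRoot_ne_zero n)]
    push_cast
    ring_nf

theorem x_smul_monomial (a b : ℕ) : gen n .x • (u n i j ^ a * v n i j ^ b) =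
    qRoot n ^ (i * a + j * b) • (u n i j ^ a * v n i j ^ b) := by
  rw [x_smul_mul, x_smul_pow n i j (x_smul_u n i j), x_smul_pow n i j (x_smul_v n i j),
    smul_mul_assoc, mul_smul_comm, smul_smul, ← zpow_add₀ (twistSum.qRoot_ne_zero n)]

theorem y_smul_monomial (a b : ℕ) : gen n .y • (u n i j ^ a * v n i j ^ b) =
    qRoot n ^ (j * a + i * b) • (u n i j ^ a * v n i j ^ b) := by
  rw [y_smul_mul, y_smul_pow n i j (y_smul_u n i j), y_smul_pow n i j (y_smul_v n i j),
    smul_mul_assoc, mul_smul_comm, smul_smul, ← zpow_add₀ (twistSum.qRoot_ne_zero n)]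

/-- Appending a u to u^a contributes ij from zu = q^(ij) v and ija from the twist, since u^a has
y-weight ja and u has x-weight i. The sum is ij(1 + ... + a). For powers of v only the twist
contributes, because zv = u, so the binomial there starts one step lower. -/
theorem z_smul_u_pow (a : ℕ) :
    gen n .z • u n i j ^ a = qRoot n ^ (i * j * ((a + 1).choose 2 : ℕ)) • v n i j ^ a := by
  induction a with
  | zero => simp [z_smul_one]
  | succ a ih =>
    rw [pow_succ, z_smul_mul (y_smul_pow n i j (y_smul_u n i j) a) (x_smul_u n i j), ih,
      z_smul_u, smul_mul_assoc, mul_smul_comm, smul_smul, smul_smul,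
      ← zpow_add₀ (twistSum.qRoot_ne_zero n), ← zpow_add₀ (twistSum.qRoot_ne_zero n), pow_succ,
      Nat.choose_succ_succ' (a + 1) 1, Nat.choose_one_right]
    push_cast
    ring_nf

theorem z_smul_v_pow (b : ℕ) :
    gen n .z • v n i j ^ b = qRoot n ^ (i * j * (b.choose 2 : ℕ)) • u n i j ^ b := by
  induction b with
  | zero => simp [z_smul_one]
  | succ b ih =>
    rw [pow_succ, z_smul_mul (y_smul_pow n i j (y_smul_v n i j) b) (x_smul_v n i j), ih,
      z_smul_v, smul_mul_assoc, smul_smul, ← zpow_add₀ (twistSum.qRoot_ne_zero n), pow_succ,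
      Nat.choose_succ_succ' b 1, Nat.choose_one_right]
    push_cast
    ring_nf

theorem exists_z_smul_monomial (a b : ℕ) : ∃ t : ℂ, t ≠ 0 ∧
    gen n .z • (u n i j ^ a * v n i j ^ b) = t • (u n i j ^ b * v n i j ^ a) := by
  have hq := twistSum.qRoot_ne_zero n
  refine ⟨_, ?_, by rw [z_smul_mul (y_smul_pow n i j (y_smul_u n i j) a)
    (x_smul_pow n i j (x_smul_v n i j) b), z_smul_u_pow, z_smul_v_pow, smul_mul_assoc,
    mul_smul_comm, pow_mul_pow_of_mul_eq_smul (v_mul_u n i j), smul_smul, smul_smul, smul_smul]⟩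
  have := param_ne_zero n i j
  positivity

/-- The action of `H_{2n²}` preserves the grading. -/
theorem smul_mem_grading (m : ℕ) (h : Pansera n) (a : Aplus n i j) (ha : a ∈ grading n i j m) :
    h • a ∈ grading n i j m := by
  refine smul_mem_of_gen (grading n i j m) (fun g a ha => ?_) h a ha
  let f : Aplus n i j →ₗ[ℂ] Aplus n i j := Algebra.lsmul ℂ ℂ (Aplus n i j) (gen n g)
  suffices a ∈ (grading n i j m).comap f from this
  refine (isQuantumPlane n i j).mem_of_coeff fun k l hkl => ?_
  have hm : k + l = m := by
    by_contra hne
    exact hkl ((isQuantumPlane n i j).coeff_eq_zero_of_mem_span_pow ha k l hne)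
  have h1 : u n i j ^ k * v n i j ^ l ∈ grading n i j m :=
    hm ▸ IsQuantumPlane.monomial_mem_span_pow k l
  have h2 : u n i j ^ l * v n i j ^ k ∈ grading n i j m :=
    hm ▸ add_comm l k ▸ IsQuantumPlane.monomial_mem_span_pow l k
  change gen n g • (u n i j ^ k * v n i j ^ l) ∈ grading n i j m
  cases g with
  | x => rw [x_smul_monomial]; exact Submodule.smul_mem _ _ h1
  | y => rw [y_smul_monomial]; exact Submodule.smul_mem _ _ h1
  | z =>
    obtain ⟨t, -, ht⟩ := exists_z_smul_monomial n i j k l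
    rw [ht]
    exact Submodule.smul_mem _ _ h2

/-- The weight idempotents act on the monomials by `0` and `1`. -/
theorem wtIdem_smul_monomial {r s : ℕ} (hr : r < n) (hs : s < n) {a b r' s' : ℕ} (hr' : r' < n)
    (hs' : s' < n) (hx : qRoot n ^ (i * a + j * b) = qRoot n ^ r')
    (hy : qRoot n ^ (j * a + i * b) = qRoot n ^ s') :
    wtIdem n r s • (u n i j ^ a * v n i j ^ b) =
      if r = r' ∧ s = s' then u n i j ^ a * v n i j ^ b else 0 := by
  have hq := twistSum.qRoot_ne_zero n
  have hn : (n : ℂ) ≠ 0 := by exact_mod_cast NeZero.ne n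
  have key : ∀ (g : Pansera n) (w : Aplus n i j) (k k' : ℕ), k < n → k' < n →
      g • w = qRoot n ^ k' • w → twistSum.idem n g k • w = if k = k' then w else 0 := by
    intro g w k k' hk hk' hg
    rw [twistSum.idem, smul_assoc, Finset.sum_smul]
    simp only [smul_assoc, pow_smul_of_smul hg, smul_smul]
    rw [← Finset.sum_smul, smul_smul]
    have e : ∀ t : ℕ, (qRoot n)⁻¹ ^ (k * t) * (qRoot n ^ k') ^ t =
        ((qRoot n)⁻¹ ^ k * qRoot n ^ k') ^ t := fun t => by rw [mul_pow, pow_mul]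
    simp only [e]
    split_ifs with h
    · subst h
      rw [inv_pow, inv_mul_cancel₀ (pow_ne_zero _ hq)]
      simp [hn]
    · have hne : (qRoot n)⁻¹ ^ k * qRoot n ^ k' ≠ 1 := by
        intro h3
        rw [inv_pow, inv_mul_eq_one₀ (pow_ne_zero _ hq)] at h3
        exact h ((twistSum.isPrimitiveRoot n).pow_inj hk hk' h3)
      have hqn := (twistSum.isPrimitiveRoot n).pow_eq_one
      rw [geom_sum_eq hne, mul_pow, ← pow_mul, ← pow_mul, mul_comm k, mul_comm k', pow_mul,
        pow_mul, inv_pow, hqn]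
      simp
  rw [wtIdem, mul_smul, key _ _ s s' hs hs' (by rw [y_smul_monomial, hy])]
  by_cases h1 : s = s'
  · rw [if_pos h1, key _ _ r r' hr hr' (by rw [x_smul_monomial, hx])]
    simp [h1]
  · rw [if_neg h1, smul_zero, if_neg fun h => h1 h.2]

theorem qRoot_zpow_eq_one_iff (k : ℤ) : qRoot n ^ k = 1 ↔ (n : ℤ) ∣ k :=
  (twistSum.isPrimitiveRoot n).zpow_eq_one_iff_dvd k

theorem qRoot_zpow_eq_iff (k l : ℤ) : qRoot n ^ k = qRoot n ^ l ↔ k ≡ l [ZMOD n] := by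
  have hq := twistSum.qRoot_ne_zero n
  rw [Int.modEq_comm, Int.modEq_iff_dvd, ← qRoot_zpow_eq_one_iff, zpow_sub₀ hq,
    div_eq_one_iff_eq (zpow_ne_zero _ hq)]

variable {n i j}

/-- If `i² - j²` is prime to `n`, every pair of weights is the weight of a monomial `u ^ a v ^ b`
with `a ≠ b`. -/
theorem exists_weight (hc : Int.gcd (i ^ 2 - j ^ 2) n = 1) (r s : ℕ) : ∃ a b : ℕ, a ≠ b ∧
    qRoot n ^ (i * a + j * b) = qRoot n ^ r ∧ qRoot n ^ (j * a + i * b) = qRoot n ^ s := by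
  have hn := NeZero.pos n
  obtain ⟨d, hd⟩ : ∃ d : ℤ, (i ^ 2 - j ^ 2) * d ≡ 1 [ZMOD n] := by
    obtain ⟨x, y, hxy⟩ := Int.isCoprime_iff_gcd_eq_one.mpr hc
    exact ⟨x, Int.modEq_iff_dvd.mpr ⟨y, by linear_combination -hxy⟩⟩
  have lift : ∀ k : ℤ, ∀ N : ℕ, ∃ a : ℕ, N < a ∧ (a : ℤ) ≡ k [ZMOD n] := by
    intro k N
    refine ⟨(k % n).toNat + n * (N + 1), by nlinarith, ?_⟩
    push_cast
    rw [Int.toNat_of_nonneg (Int.emod_nonneg _ (by exact_mod_cast hn.ne'))]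
    refine (Int.ModEq.add_right _ (Int.mod_modEq k n)).trans ?_
    exact Int.modEq_iff_dvd.mpr ⟨-(N + 1), by ring⟩
  -- Cramer's rule for the weight system, with d inverse to its determinant i² - j² modulo n. The
  -- representative b is then chosen larger than a to guarantee a ≠ b.
  obtain ⟨a, -, ha⟩ := lift (d * (i * r - j * s)) 0
  obtain ⟨b, hb, hb'⟩ := lift (d * (i * s - j * r)) a
  refine ⟨a, b, hb.ne, ?_, ?_⟩
  · rw [← zpow_natCast, qRoot_zpow_eq_iff]
    calc i * a + j * b ≡ i * (d * (i * r - j * s)) + j * (d * (i * s - j * r)) [ZMOD n] :=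
          (ha.mul_left i).add (hb'.mul_left j)
      _ = (i ^ 2 - j ^ 2) * d * r := by ring
      _ ≡ 1 * r [ZMOD n] := hd.mul_right _
      _ = r := one_mul _
  · rw [← zpow_natCast, qRoot_zpow_eq_iff]
    calc j * a + i * b ≡ j * (d * (i * r - j * s)) + i * (d * (i * s - j * r)) [ZMOD n] :=
          (ha.mul_left j).add (hb'.mul_left i)
      _ = (i ^ 2 - j ^ 2) * d * s := by ring
      _ ≡ 1 * s [ZMOD n] := hd.mul_right _
      _ = s := one_mul _

/-- If `i² - j²` is prime to `n`, the action of `H_{2n²}` on `A⁺` is faithful. -/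
theorem eq_zero_of_smul_eq_zero (hc : Int.gcd (i ^ 2 - j ^ 2) n = 1) {h : Pansera n}
    (hh : ∀ a : Aplus n i j, h • a = 0) : h = 0 := by
  have h1 : h ∈ Submodule.span ℂ (Set.range fun k : Fin n × Fin n × Fin 2 =>
      wtIdem n k.1 k.2.1 * gen n .z ^ (k.2.2 : ℕ)) := by rw [span_wtIdem]; trivial
  obtain ⟨f, hf⟩ := (Submodule.mem_span_range_iff_exists_fun ℂ).mp h1
  have hqp := isQuantumPlane n i j
  have key : ∀ r s : Fin n, f (r, s, 0) = 0 ∧ f (s, r, 1) = 0 := by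
    intro r s
    -- On u^a v^b of weight (r, s), only e_{rs} and e_{sr} z act nontrivially. They produce
    -- multiples of u^a v^b and u^b v^a, which are distinct since a ≠ b, so both coefficients can be
    -- read off.
    obtain ⟨a, b, hab, hx, hy⟩ := exists_weight (n := n) hc r s
    obtain ⟨t, ht, hz⟩ := exists_z_smul_monomial n i j a b
    have hx' : qRoot n ^ (i * b + j * a) = qRoot n ^ (s : ℕ) := by rw [add_comm]; exact hy
    have hy' : qRoot n ^ (j * b + i * a) = qRoot n ^ (r : ℕ) := by rw [add_comm]; exact hx
    have e := hh (u n i j ^ a * v n i j ^ b)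
    rw [← hf, Finset.sum_smul, Fintype.sum_prod_type] at e
    simp only [Fintype.sum_prod_type, Fin.sum_univ_two, smul_assoc, mul_smul, Fin.val_zero,
      Fin.val_one, pow_zero, pow_one, one_smul, hz, smul_comm _ t,
      wtIdem_smul_monomial n i j (Fin.is_lt _) (Fin.is_lt _) r.2 s.2 hx hy,
      wtIdem_smul_monomial n i j (Fin.is_lt _) (Fin.is_lt _) s.2 r.2 hx' hy',
      Fin.val_inj, Finset.sum_add_distrib, ite_and, smul_ite, smul_zero, Finset.sum_ite_eq',
      Finset.mem_univ, if_true, Finset.sum_ite_irrel, Finset.sum_const_zero] at e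
    have c1 := congrArg (hqp.coeff (a, b)) e
    have c2 := congrArg (hqp.coeff (b, a)) e
    have m1 := hqp.coeff_monomial (a, b) (a, b)
    have m2 := hqp.coeff_monomial (a, b) (b, a)
    have m3 := hqp.coeff_monomial (b, a) (a, b)
    have m4 := hqp.coeff_monomial (b, a) (b, a)
    simp only [Prod.mk.injEq, hab, hab.symm, if_false, and_self, if_true] at m1 m2 m3 m4
    simp only [map_add, map_smul, m1, m2, m3, m4, map_zero, smul_eq_mul, mul_one, mul_zero,
      add_zero, zero_add, mul_eq_zero, ht, false_or] at c1 c2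
    exact ⟨c1, c2⟩
  rw [← hf]
  refine Finset.sum_eq_zero fun k _ => ?_
  obtain ⟨r, s, e⟩ := k
  have : f (r, s, e) = 0 := by
    fin_cases e
    · exact (key r s).1
    · exact (key s r).2
  rw [this, zero_smul]

theorem isInnerFaithful_of_gcd (hc : Int.gcd (i ^ 2 - j ^ 2) n = 1) :
    IsInnerFaithful (Pansera n) (Aplus n i j) := fun I _ _ hI => by
  rw [eq_bot_iff]
  intro h hh
  exact eq_zero_of_smul_eq_zero hc (hI h hh)

end Aplus
end

/-! ### The Hopf ideal of trivially acting grouplikes -/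

noncomputable section

namespace Aplus

open Pansera

variable (n : ℕ) (i j : ℤ) [NeZero n]

/-- The exponents `(r, s)` for which `x ^ r y ^ s` acts trivially on `A⁺`. -/
def TrivialExponents (r s : ℕ) : Prop :=
  (n : ℤ) ∣ r * i + s * j ∧ (n : ℤ) ∣ r * j + s * i

/-- The ideal generated by the `x ^ r y ^ s - 1` such that `x ^ r y ^ s` acts trivially. -/
def trivialIdeal : Ideal (Pansera n) :=
  Ideal.span {h | ∃ r s : ℕ, TrivialExponents n i j r s ∧ h = gen n .x ^ r * gen n .y ^ s - 1}

variable {n i j}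

omit [NeZero n] in
theorem TrivialExponents.symm {r s : ℕ} (h : TrivialExponents n i j r s) :
    TrivialExponents n i j s r :=
  ⟨by rw [add_comm]; exact h.2, by rw [add_comm]; exact h.1⟩

omit [NeZero n] in
theorem TrivialExponents.mul {r s : ℕ} (h : TrivialExponents n i j r s) (k : ℕ) :
    TrivialExponents n i j (k * r) (k * s) := by
  obtain ⟨⟨a, ha⟩, ⟨b, hb⟩⟩ := h
  refine ⟨⟨k * a, ?_⟩, ⟨k * b, ?_⟩⟩
  · push_cast; linear_combination k * ha
  · push_cast; linear_combination k * hb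

omit [NeZero n] in
theorem sub_one_mem_trivialIdeal {r s : ℕ} (h : TrivialExponents n i j r s) :
    gen n .x ^ r * gen n .y ^ s - 1 ∈ trivialIdeal n i j :=
  Ideal.subset_span ⟨r, s, h, rfl⟩

theorem smul_eq_zero_of_mem_trivialIdeal {h : Pansera n} (hh : h ∈ trivialIdeal n i j)
    (a : Aplus n i j) : h • a = 0 := by
  have hq := twistSum.qRoot_ne_zero n
  induction hh using Submodule.span_induction with
  | mem h hh =>
    obtain ⟨r, s, hrs, rfl⟩ := hh
    induction a using (isQuantumPlane n i j).induction with
    | hm k l =>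
      rw [sub_smul, one_smul, mul_smul, pow_smul_of_smul (y_smul_monomial n i j k l), smul_comm,
        pow_smul_of_smul (x_smul_monomial n i j k l), smul_smul, ← zpow_natCast, ← zpow_natCast,
        ← zpow_mul, ← zpow_mul, ← zpow_add₀ hq]
      have e : qRoot n ^ ((j * k + i * l) * s + (i * k + j * l) * r) = 1 := by
        rw [qRoot_zpow_eq_one_iff]
        obtain ⟨⟨x, hx⟩, ⟨y, hy⟩⟩ := hrs
        exact ⟨k * x + l * y, by linear_combination k * hx + l * hy⟩
      rw [e, one_smul, sub_self]
    | hadd a b ha hb => rw [smul_add, ha, hb, add_zero]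
    | hsmul t a ha => rw [smul_comm, ha, smul_zero]
  | zero => exact zero_smul _ _
  | add g h _ _ hg hh => rw [add_smul, hg, hh, add_zero]
  | smul g h _ hh => rw [smul_eq_mul, mul_smul, hh, smul_zero]

omit [NeZero n] in
-- The generators commute with x and y, and moving z across one of them swaps its exponents, a
-- symmetry of the triviality condition.
theorem isTwoSided_trivialIdeal : (trivialIdeal n i j).IsTwoSided := by
  have key : ∀ h : Pansera n, ∀ g ∈ trivialIdeal n i j, g * h ∈ trivialIdeal n i j := by
    have hgen : ∀ k, ∀ g ∈ trivialIdeal n i j, g * gen n k ∈ trivialIdeal n i j := by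
      intro k g hg
      induction hg using Submodule.span_induction with
      | mem g hg =>
        obtain ⟨r, s, hrs, rfl⟩ := hg
        have hxy := xy n
        cases k with
        | x =>
          have e : Commute (gen n .x ^ r * gen n .y ^ s - 1) (gen n .x) :=
            (((Commute.refl _).pow_left r).mul_left (hxy.symm.pow_left s)).sub_left
              (Commute.one_left _)
          rw [e.eq]
          exact Ideal.mul_mem_left _ _ (sub_one_mem_trivialIdeal hrs)
        | y =>
          have e : Commute (gen n .x ^ r * gen n .y ^ s - 1) (gen n .y) :=
            ((hxy.pow_left r).mul_left ((Commute.refl _).pow_left s)).sub_left (Commute.one_left _)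
          rw [e.eq]
          exact Ideal.mul_mem_left _ _ (sub_one_mem_trivialIdeal hrs)
        | z =>
          have e : gen n .z * (gen n .x ^ s * gen n .y ^ r - 1) =
              (gen n .x ^ r * gen n .y ^ s - 1) * gen n .z := by
            have e1 : SemiconjBy (gen n .z) (gen n .x) (gen n .y) := zx n
            have e2 : SemiconjBy (gen n .z) (gen n .y) (gen n .x) := zy n
            rw [mul_sub, sub_mul, ((e1.pow_right s).mul_right (e2.pow_right r)).eq,
              (hxy.pow_pow r s).eq, mul_one, one_mul]
          rw [← e]
          exact Ideal.mul_mem_left _ _ (sub_one_mem_trivialIdeal hrs.symm)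
      | zero => simp
      | add a b _ _ ha hb => rw [add_mul]; exact Ideal.add_mem _ ha hb
      | smul a b _ hb => rw [smul_eq_mul, mul_assoc]; exact Ideal.mul_mem_left _ _ hb
    intro h
    induction h using Pansera.induction with
    | hC c =>
      intro g hg
      rw [← Algebra.commutes]
      exact Ideal.mul_mem_left _ _ hg
    | hx => exact hgen .x
    | hy => exact hgen .y
    | hz => exact hgen .z
    | hmul a b ha hb => intro g hg; rw [← mul_assoc]; exact hb _ (ha _ hg)
    | hadd a b ha hb => intro g hg; rw [mul_add]; exact Ideal.add_mem _ (ha _ hg) (hb _ hg)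
  exact ⟨fun h hg => key h _ hg⟩

/-- The generators are g - 1 with g grouplike, so Δ(g - 1) = g ⊗ (g - 1) + (g - 1) ⊗ 1 and S(g - 1)
= g⁻¹ - 1, where g⁻¹ acts trivially too. -/
theorem isHopfIdeal_trivialIdeal : (trivialIdeal n i j).IsHopfIdeal ℂ where
  toIsCoideal := by
    rw [Submodule.isCoideal_iff_comul_mem]
    constructor
    · intro h hh
      rw [counit_apply]
      replace hh : h ∈ trivialIdeal n i j := hh
      induction hh using Submodule.span_induction with
      | mem h hh => obtain ⟨r, s, -, rfl⟩ := hh; simp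
      | zero => simp
      | add a b _ _ ha hb => rw [map_add, ha, hb, add_zero]
      | smul a b _ hb => rw [smul_eq_mul, map_mul, hb, mul_zero]
    · intro h hh
      rw [comul_apply]
      set J := LinearMap.range (LinearMap.lTensor (Pansera n)
          ((trivialIdeal n i j).restrictScalars ℂ).subtype) ⊔
        LinearMap.range (LinearMap.rTensor (Pansera n)
          ((trivialIdeal n i j).restrictScalars ℂ).subtype) with hJ
      -- A left factor t is carried along so that the induction absorbs the coproducts of the left
      -- coefficients.
      suffices H : ∀ t : Pansera n ⊗[ℂ] Pansera n, t * comulHom n h ∈ J by simpa using H 1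
      replace hh : h ∈ trivialIdeal n i j := hh
      induction hh using Submodule.span_induction with
      | mem h hh =>
        obtain ⟨r, s, hrs, rfl⟩ := hh
        have hI := sub_one_mem_trivialIdeal hrs
        set g := gen n .x ^ r * gen n .y ^ s
        have e : comulHom n (g - 1) = g ⊗ₜ (g - 1) + (g - 1) ⊗ₜ 1 := by
          simp [g, TensorProduct.tmul_sub, TensorProduct.sub_tmul, Algebra.TensorProduct.one_def]
        intro t
        rw [e]
        induction t with
        | zero => simp
        | tmul c d =>
          rw [mul_add, Algebra.TensorProduct.tmul_mul_tmul, Algebra.TensorProduct.tmul_mul_tmul]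
          refine Submodule.add_mem_sup ?_ ?_
          · exact ⟨(c * g) ⊗ₜ ⟨d * (g - 1), Ideal.mul_mem_left _ _ hI⟩, rfl⟩
          · exact ⟨(⟨c * (g - 1), Ideal.mul_mem_left _ _ hI⟩ :
              (trivialIdeal n i j).restrictScalars ℂ) ⊗ₜ (d * 1), rfl⟩
        | add a b ha hb => rw [add_mul]; exact Submodule.add_mem _ ha hb
      | zero => simp
      | add a b _ _ ha hb =>
        intro t
        rw [map_add, mul_add]
        exact Submodule.add_mem _ (ha t) (hb t)
      | smul a b _ hb =>
        intro t
        rw [smul_eq_mul, map_mul, ← mul_assoc]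
        exact hb _
  antipode_mem := by
    intro h hh
    rw [antipode_apply]
    have := isTwoSided_trivialIdeal (n := n) (i := i) (j := j)
    induction hh using Submodule.span_induction with
    | mem h hh =>
      obtain ⟨r, s, hrs, rfl⟩ := hh
      have h1 : antipodeMap n 1 = 1 := by simpa using antipodeMap_algebraMap n 1
      rw [map_sub, antipodeMap_mul, antipodeMap_pow n (antipodeMap_x n),
        antipodeMap_pow n (antipodeMap_y n), h1, ← pow_mul, ← pow_mul,
        ((xy n).pow_pow _ _).symm.eq]
      -- The antipode replaces x and y by their (n - 1)-st powers, so both exponents are multiplied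
      -- by n - 1.
      exact sub_one_mem_trivialIdeal (hrs.mul (n - 1))
    | zero => simp
    | add a b _ _ ha hb => rw [map_add]; exact Ideal.add_mem _ ha hb
    | smul a b _ hb => rw [smul_eq_mul, antipodeMap_mul]; exact Ideal.mul_mem_right _ _ hb

/-- In `H_{2n²}`, `x ^ r y ^ s = 1` only if `n` divides `r` and `s`. -/
theorem dvd_of_x_pow_mul_y_pow {r s : ℕ} (h : gen n .x ^ r * gen n .y ^ s = 1) :
    n ∣ r ∧ n ∣ s := by
  have hp := twistSum.isPrimitiveRoot n
  -- In π_{1,0}, x and y act by diag(q, 1) and diag(1, q), so x^r y^s acts by diag(q^r, q^s).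
  have e := congrArg (rep n 1 0) h
  have d : ∀ a b : ℂ, !![a, 0; 0, b] = Matrix.diagonal ![a, b] := fun a b => by
    ext r s; fin_cases r <;> fin_cases s <;> rfl
  rw [map_mul, map_pow, map_pow, rep, lift_x, lift_y, map_one, d, d, Matrix.diagonal_pow,
    Matrix.diagonal_pow, Matrix.diagonal_mul_diagonal] at e
  have e0 := congrFun (congrFun e 0) 0
  have e1 := congrFun (congrFun e 1) 1
  simp at e0 e1
  exact ⟨(hp.pow_eq_one_iff_dvd _).mp e0, (hp.pow_eq_one_iff_dvd _).mp e1⟩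

/-- Let g be the gcd and m = n/g. If g divides i and j, then x^m acts trivially. Otherwise take (r,
s) = m(j, -i) modulo n: then ri + sj vanishes, and rj + si = -m(i² - j²) is divisible by mg = n. If
n divided both exponents, g would divide i and j. -/
theorem exists_trivialExponents (hc : Int.gcd (i ^ 2 - j ^ 2) n ≠ 1) :
    ∃ r s : ℕ, TrivialExponents n i j r s ∧ ¬ (n ∣ r ∧ n ∣ s) := by
  have hn := NeZero.pos n
  set g := Int.gcd (i ^ 2 - j ^ 2) n with hg
  have hgn : g ∣ n := Int.natCast_dvd_natCast.mp (Int.gcd_dvd_right (i ^ 2 - j ^ 2) (n : ℤ))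
  obtain ⟨m, hm⟩ := hgn
  obtain ⟨d, hd⟩ := Int.gcd_dvd_left (i ^ 2 - j ^ 2) (n : ℤ)
  rw [← hg] at hd
  have hm0 : 0 < m := Nat.pos_of_ne_zero fun h0 => by rw [h0, mul_zero] at hm; omega
  have hg0 : 0 < g := Nat.pos_of_ne_zero fun h0 => by rw [h0, zero_mul] at hm; omega
  have hnm : (n : ℤ) = g * m := by exact_mod_cast hm
  have hndvd : ¬ n ∣ m := fun h => by
    have := Nat.le_of_dvd hm0 h
    rw [hm] at this
    have : g ≤ 1 := by
      by_contra hlt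
      nlinarith
    omega
  by_cases hij : (g : ℤ) ∣ i ∧ (g : ℤ) ∣ j
  · obtain ⟨⟨a, ha⟩, ⟨b, hb⟩⟩ := hij
    refine ⟨m, 0, ⟨⟨a, ?_⟩, ⟨b, ?_⟩⟩, fun h => hndvd h.1⟩
    · rw [hnm, ha]; push_cast; ring
    · rw [hnm, hb]; push_cast; ring
  · obtain ⟨r, hr⟩ : ∃ r : ℕ, (r : ℤ) = m * j % n :=
      ⟨_, Int.toNat_of_nonneg (Int.emod_nonneg _ (by exact_mod_cast hn.ne'))⟩
    obtain ⟨s, hs⟩ : ∃ s : ℕ, (s : ℤ) = -(m * i) % n :=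
      ⟨_, Int.toNat_of_nonneg (Int.emod_nonneg _ (by exact_mod_cast hn.ne'))⟩
    have hr' : (n : ℤ) ∣ m * j - r := hr ▸ Int.dvd_self_sub_emod
    have hs' : (n : ℤ) ∣ -(m * i) - s := hs ▸ Int.dvd_self_sub_emod
    have hmg : (m : ℤ) ≠ 0 := by exact_mod_cast hm0.ne'
    obtain ⟨a, ha⟩ := hr'
    obtain ⟨b, hb⟩ := hs'
    refine ⟨r, s, ⟨⟨-(a * i + b * j), ?_⟩, ⟨-(d + a * j + b * i), ?_⟩⟩, fun h => hij ⟨?_, ?_⟩⟩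
    · linear_combination -i * ha - j * hb
    · linear_combination -j * ha - i * hb - (m : ℤ) * hd + d * hnm
    · have h1 : (n : ℤ) ∣ m * i := by
        have : (n : ℤ) ∣ s := by exact_mod_cast h.2
        have := dvd_add (dvd_mul_right (n : ℤ) b) this
        rw [← hb, sub_add_cancel] at this
        exact (dvd_neg).mp this
      rw [hnm, mul_comm] at h1
      exact (mul_dvd_mul_iff_left hmg).mp h1
    · have h1 : (n : ℤ) ∣ m * j := by
        have : (n : ℤ) ∣ r := by exact_mod_cast h.1
        have := dvd_add (dvd_mul_right (n : ℤ) a) this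
        rwa [← ha, sub_add_cancel] at this
      rw [hnm, mul_comm] at h1
      exact (mul_dvd_mul_iff_left hmg).mp h1

variable (n i j)

theorem isInnerFaithful_iff :
    IsInnerFaithful (Pansera n) (Aplus n i j) ↔ Int.gcd (i ^ 2 - j ^ 2) n = 1 := by
  refine ⟨fun h => ?_, isInnerFaithful_of_gcd⟩
  by_contra hc
  obtain ⟨r, s, hrs, hne⟩ := exists_trivialExponents hc
  have h0 := h (trivialIdeal n i j) isTwoSided_trivialIdeal isHopfIdeal_trivialIdeal
    fun h hh a => smul_eq_zero_of_mem_trivialIdeal hh a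
  have h1 := sub_one_mem_trivialIdeal hrs
  rw [h0, Ideal.mem_bot, sub_eq_zero] at h1
  exact hne (dvd_of_x_pow_mul_y_pow h1)

end Aplus
end

/-! ### The generators of the fixed ring -/

noncomputable section

-- The predicate need not be closed under products: it is shown that right multiplication by a
-- preserves it. This suits module decompositions, where only multiplication by the generators has
-- to be checked.
@[elab_as_elim]
theorem Algebra.adjoin_induction_mul_right {A : Type} [Ring A] [Algebra ℂ A] {s : Set A}
    {P : A → Prop} (one : P 1) (add : ∀ a b, P a → P b → P (a + b))
    (smul : ∀ (t : ℂ) a, P a → P (t • a)) (mul : ∀ a, P a → ∀ g ∈ s, P (a * g)) {a : A}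
    (ha : a ∈ Algebra.adjoin ℂ s) : P a := by
  suffices ∀ b, P b → P (b * a) by simpa using this 1 one
  induction ha using Algebra.adjoin_induction with
  | mem g hg => exact fun b hb => mul b hb g hg
  | algebraMap t =>
    intro b hb
    rw [← Algebra.commutes, ← Algebra.smul_def]
    exact smul t b hb
  | add a c _ _ ha hc => exact fun b hb => by rw [mul_add]; exact add _ _ (ha b hb) (hc b hb)
  | mul a c _ _ ha hc => exact fun b hb => by rw [← mul_assoc]; exact hc _ (ha b hb)

section decomposition

variable {A : Type} [Ring A] [Algebra ℂ A] {U V a : A}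

theorem adjoin_pair_le_adjoin_add_sub :
    Algebra.adjoin ℂ {U, V} ≤ Algebra.adjoin ℂ {U + V, U - V} := by
  have hs : U + V ∈ Algebra.adjoin ℂ {U + V, U - V} := Algebra.subset_adjoin (by simp)
  have hd : U - V ∈ Algebra.adjoin ℂ {U + V, U - V} := Algebra.subset_adjoin (by simp)
  rw [Algebra.adjoin_le_iff, Set.insert_subset_iff, Set.singleton_subset_iff]
  constructor
  · have e := Subalgebra.smul_mem _ (add_mem hs hd) (2⁻¹ : ℂ)
    rwa [add_add_sub_cancel, ← two_smul ℂ U, smul_smul, inv_mul_cancel₀ two_ne_zero, one_smul] at e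
  · have e := Subalgebra.smul_mem _ (sub_mem hs hd) (2⁻¹ : ℂ)
    rwa [add_sub_sub_cancel, ← two_smul ℂ V, smul_smul, inv_mul_cancel₀ two_ne_zero, one_smul] at e

/-- For commuting `U`, `V` the algebra `ℂ[U, V]` is spanned by `1` and `U - V` over
`ℂ[U + V, UV]`. -/
theorem exists_eq_add_mul_of_commute (hUV : V * U = U * V) (ha : a ∈ Algebra.adjoin ℂ {U, V}) :
    ∃ b ∈ Algebra.adjoin ℂ {U + V, U * V}, ∃ b' ∈ Algebra.adjoin ℂ {U + V, U * V},
      a = b + b' * (U - V) := by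
  have hs : U + V ∈ Algebra.adjoin ℂ {U + V, U * V} := Algebra.subset_adjoin (by simp)
  have hp : U * V ∈ Algebra.adjoin ℂ {U + V, U * V} := Algebra.subset_adjoin (by simp)
  refine Algebra.adjoin_induction_mul_right ?_ ?_ ?_ ?_ (adjoin_pair_le_adjoin_add_sub ha)
  · exact ⟨1, one_mem _, 0, zero_mem _, by simp⟩
  · rintro _ _ ⟨b, hb, b', hb', rfl⟩ ⟨c, hc, c', hc', rfl⟩
    exact ⟨_, add_mem hb hc, _, add_mem hb' hc', by noncomm_ring⟩
  · rintro t _ ⟨b, hb, b', hb', rfl⟩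
    exact ⟨_, Subalgebra.smul_mem _ hb t, _, Subalgebra.smul_mem _ hb' t,
      by rw [smul_add, smul_mul_assoc]⟩
  · rintro _ ⟨b, hb, b', hb', rfl⟩ g (rfl | rfl)
    · refine ⟨_, mul_mem hb hs, _, mul_mem hb' hs, ?_⟩
      have e : (U - V) * (U + V) = (U + V) * (U - V) := by
        rw [sub_mul, mul_add, mul_add, add_mul, mul_sub, mul_sub, hUV]; abel
      rw [add_mul, mul_assoc, mul_assoc, e]
    · refine ⟨b' * ((U + V) * (U + V) - (4 : ℂ) • (U * V)),
        mul_mem hb' (sub_mem (mul_mem hs hs) (Subalgebra.smul_mem _ hp _)), b, hb, ?_⟩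
      have e : (U - V) * (U - V) = (U + V) * (U + V) - (4 : ℂ) • (U * V) := by
        rw [sub_mul, mul_sub, mul_sub, add_mul, mul_add, mul_add, hUV]; module
      rw [add_mul, mul_assoc, e, add_comm]

/-- For anticommuting `U`, `V` the algebra generated by `U` and `V` is spanned by `1`, `U - V` and
`UV` as a left module over the subalgebra generated by `U + V` and `UV(U - V)`. -/
theorem exists_eq_add_mul_of_anticommute (hUV : V * U = -(U * V))
    (ha : a ∈ Algebra.adjoin ℂ {U, V}) :
    ∃ b ∈ Algebra.adjoin ℂ {U + V, U * V * (U - V)},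
      ∃ b' ∈ Algebra.adjoin ℂ {U + V, U * V * (U - V)},
      ∃ b'' ∈ Algebra.adjoin ℂ {U + V, U * V * (U - V)},
      a = b + b' * (U - V) + b'' * (U * V) := by
  have hs : U + V ∈ Algebra.adjoin ℂ {U + V, U * V * (U - V)} := Algebra.subset_adjoin (by simp)
  have ht : U * V * (U - V) ∈ Algebra.adjoin ℂ {U + V, U * V * (U - V)} :=
    Algebra.subset_adjoin (by simp)
  refine Algebra.adjoin_induction_mul_right ?_ ?_ ?_ ?_ (adjoin_pair_le_adjoin_add_sub ha)
  · exact ⟨1, one_mem _, 0, zero_mem _, 0, zero_mem _, by simp⟩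
  · rintro _ _ ⟨b, hb, b', hb', b'', hb'', rfl⟩ ⟨c, hc, c', hc', c'', hc'', rfl⟩
    exact ⟨_, add_mem hb hc, _, add_mem hb' hc', _, add_mem hb'' hc'', by
      rw [add_mul, add_mul]; abel⟩
  · rintro t _ ⟨b, hb, b', hb', b'', hb'', rfl⟩
    exact ⟨_, Subalgebra.smul_mem _ hb t, _, Subalgebra.smul_mem _ hb' t,
      _, Subalgebra.smul_mem _ hb'' t,
      by rw [smul_add, smul_add, smul_mul_assoc, smul_mul_assoc]⟩
  · rintro _ ⟨b, hb, b', hb', b'', hb'', rfl⟩ g (rfl | rfl)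
    · refine ⟨_, mul_mem hb hs, _, mul_mem hb' hs, (4 : ℂ) • b' - b'' * (U + V),
        sub_mem (Subalgebra.smul_mem _ hb' _) (mul_mem hb'' hs), ?_⟩
      -- Moving U - V past U + V leaves 4UV, which is why a third module generator is needed when U
      -- and V anticommute.
      have e : (U - V) * (U + V) = (U + V) * (U - V) + (4 : ℂ) • (U * V) := by
        rw [sub_mul, mul_add, mul_add, add_mul, mul_sub, mul_sub, hUV]; module
      have e' : U * V * (U + V) = -((U + V) * (U * V)) := by
        rw [mul_add, add_mul, mul_assoc U V U, hUV, ← mul_assoc V, hUV]; noncomm_ring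
      rw [add_mul, add_mul, mul_assoc b', mul_assoc b'', e, e', sub_mul, smul_mul_assoc,
        mul_add b' _ ((4 : ℂ) • _), mul_smul_comm, mul_neg, mul_assoc b', mul_assoc b'']
      abel
    · refine ⟨b' * ((U + V) * (U + V)) + b'' * (U * V * (U - V)),
        add_mem (mul_mem hb' (mul_mem hs hs)) (mul_mem hb'' ht), b, hb, 0, zero_mem _, ?_⟩
      -- The mixed terms cancel in both squares. As UV(U - V) lies in the coefficient algebra, right
      -- multiplication by U - V preserves the decomposition.
      have e : (U - V) * (U - V) = (U + V) * (U + V) := by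
        rw [sub_mul, mul_sub, mul_sub, add_mul, mul_add, mul_add, hUV]; abel
      rw [add_mul, add_mul, mul_assoc b', mul_assoc b'', e, zero_mul]
      abel

end decomposition

namespace Aplus

open Pansera

variable (n : ℕ) (i j : ℤ)

/-- From e^(πi) = -1 and the minus sign in p; hence p^n is 1 for odd n and -1 for even n. -/
theorem pRoot_pow_self [NeZero n] : pRoot n ^ n = (-1) ^ (n + 1) := by
  have hn : (n : ℂ) ≠ 0 := by exact_mod_cast NeZero.ne n
  rw [pRoot, neg_pow, ← Complex.exp_nat_mul, mul_div_cancel₀ _ hn, Complex.exp_pi_mul_I, pow_succ]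

/-- This is the scalar in v^n u^n = c^(n²) u^n v^n, and it decides the dichotomy. For even n it is
an even power of a sign, hence 1; for odd n the power of p disappears and -1 remains. -/
theorem param_pow [NeZero n] :
    param n i j ^ (n * n) = ((-1) ^ n * ((-1) ^ (n + 1)) ^ (i ^ 2 - j ^ 2)) ^ n := by
  rw [pow_mul, param, neg_pow, ← zpow_natCast (_ ^ _) n, ← zpow_mul, mul_comm (i ^ 2 - j ^ 2),
    zpow_mul, zpow_natCast, pRoot_pow_self]

theorem v_pow_mul_u_pow_of_even [NeZero n] (h : Even n) :
    v n i j ^ n * u n i j ^ n = u n i j ^ n * v n i j ^ n := by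
  rw [pow_mul_pow_of_mul_eq_smul (v_mul_u n i j), param_pow, h.neg_one_pow,
    h.add_one.neg_one_pow, one_mul]
  rcases Int.even_or_odd (i ^ 2 - j ^ 2) with hk | hk
  · rw [hk.neg_one_zpow, one_pow, one_smul]
  · rw [hk.neg_one_zpow, h.neg_one_pow, one_smul]

theorem v_pow_mul_u_pow_of_odd [NeZero n] (h : Odd n) :
    v n i j ^ n * u n i j ^ n = -(u n i j ^ n * v n i j ^ n) := by
  rw [pow_mul_pow_of_mul_eq_smul (v_mul_u n i j), param_pow, h.add_one.neg_one_pow, one_zpow,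
    h.neg_one_pow, mul_one, h.neg_one_pow, neg_smul, one_smul]

variable {n i j}

/-- The hypothesis under which `z` interchanges `u ^ n` and `v ^ n`. -/
theorem dvd_mul_choose_two (h : Odd n ∨ Even (i * j)) : (n : ℤ) ∣ i * j * (n.choose 2 : ℕ) := by
  have h2 : 2 * ((n.choose 2 : ℕ) : ℤ) = n * ((n - 1 : ℕ) : ℤ) := by
    rw [Nat.choose_two_right]
    exact_mod_cast Nat.mul_div_cancel' (Nat.even_mul_pred_self n).two_dvd
  rcases h with h | ⟨m, hm⟩
  · refine Dvd.dvd.mul_left (IsCoprime.dvd_of_dvd_mul_left (y := 2) ?_ ⟨_, h2⟩) _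
    exact_mod_cast Nat.isCoprime_iff_coprime.mpr (Nat.coprime_two_right.mpr h)
  · refine ⟨m * ((n - 1 : ℕ) : ℤ), ?_⟩
    linear_combination ((n.choose 2 : ℕ) : ℤ) * hm + m * h2

/-- If i and j were both odd, 2 would divide both i² - j² and n. -/
theorem even_mul_of_gcd (hc : Int.gcd (i ^ 2 - j ^ 2) n = 1) (h : Even n) : Even (i * j) := by
  rw [Int.even_mul]
  by_contra! hij
  rw [Int.not_even_iff_odd, Int.not_even_iff_odd] at hij
  have h1 : (2 : ℤ) ∣ i ^ 2 - j ^ 2 := (hij.1.pow.sub_odd hij.2.pow).two_dvd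
  have h2 : (2 : ℤ) ∣ n := by exact_mod_cast h.two_dvd
  have := Int.dvd_coe_gcd h1 h2
  rw [hc] at this
  omega

variable [NeZero n]

theorem x_smul_u_pow_self : gen n .x • u n i j ^ n = u n i j ^ n := by
  rw [x_smul_pow n i j (x_smul_u n i j), (qRoot_zpow_eq_one_iff n _).mpr (dvd_mul_left _ _),
    one_smul]

theorem x_smul_v_pow_self : gen n .x • v n i j ^ n = v n i j ^ n := by
  rw [x_smul_pow n i j (x_smul_v n i j), (qRoot_zpow_eq_one_iff n _).mpr (dvd_mul_left _ _),
    one_smul]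

theorem y_smul_u_pow_self : gen n .y • u n i j ^ n = u n i j ^ n := by
  rw [y_smul_pow n i j (y_smul_u n i j), (qRoot_zpow_eq_one_iff n _).mpr (dvd_mul_left _ _),
    one_smul]

theorem y_smul_v_pow_self : gen n .y • v n i j ^ n = v n i j ^ n := by
  rw [y_smul_pow n i j (y_smul_v n i j), (qRoot_zpow_eq_one_iff n _).mpr (dvd_mul_left _ _),
    one_smul]

theorem z_smul_u_pow_self (h : Odd n ∨ Even (i * j)) : gen n .z • u n i j ^ n = v n i j ^ n := by
  rw [z_smul_u_pow, (qRoot_zpow_eq_one_iff n _).mpr, one_smul]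
  rw [Nat.choose_succ_succ' n 1, Nat.choose_one_right]
  push_cast
  rw [mul_add]
  exact dvd_add (dvd_mul_left _ _) (dvd_mul_choose_two h)

theorem z_smul_v_pow_self (h : Odd n ∨ Even (i * j)) : gen n .z • v n i j ^ n = u n i j ^ n := by
  rw [z_smul_v_pow, (qRoot_zpow_eq_one_iff n _).mpr (dvd_mul_choose_two h), one_smul]

variable (n i j) in
/-- The subalgebra of the invariants of `x` and `y`. -/
def xyFixed : Subalgebra ℂ (Aplus n i j) where
  carrier := {a | gen n .x • a = a ∧ gen n .y • a = a}
  mul_mem' := fun ha hb => ⟨by rw [x_smul_mul, ha.1, hb.1], by rw [y_smul_mul, ha.2, hb.2]⟩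
  add_mem' := fun ha hb => ⟨by rw [smul_add, ha.1, hb.1], by rw [smul_add, ha.2, hb.2]⟩
  algebraMap_mem' := fun t => ⟨by rw [Algebra.algebraMap_eq_smul_one, smul_comm, x_smul_one],
    by rw [Algebra.algebraMap_eq_smul_one, smul_comm, y_smul_one]⟩

theorem mem_xyFixed {a : Aplus n i j} :
    a ∈ xyFixed n i j ↔ gen n .x • a = a ∧ gen n .y • a = a := Iff.rfl

theorem mem_fixedRing_iff_z (a : Aplus n i j) : a ∈ fixedRing (Pansera n) (Aplus n i j) ↔
    a ∈ xyFixed n i j ∧ gen n .z • a = a := by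
  rw [mem_fixedRing_iff, mem_xyFixed, and_assoc]

/-- The action of `z` is multiplicative on the invariants of `x` and `y`. -/
theorem z_smul_mul_of_mem {a b : Aplus n i j} (ha : a ∈ xyFixed n i j) (hb : b ∈ xyFixed n i j) :
    gen n .z • (a * b) = (gen n .z • a) * (gen n .z • b) := by
  have := z_smul_mul (n := n) (a := a) (b := b) (s := 0) (t := 0) (by simpa using ha.2)
    (by simpa using hb.1)
  simpa using this

/-- The action of x and y is diagonal on monomials, so it suffices to find the invariant ones.
Eliminating between ik + jl ≡ 0 and jk + il ≡ 0 gives n | (i² - j²)k and n | (i² - j²)l, hence n | k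
and n | l. -/
theorem xyFixed_eq_adjoin (hc : Int.gcd (i ^ 2 - j ^ 2) n = 1) :
    xyFixed n i j = Algebra.adjoin ℂ {u n i j ^ n, v n i j ^ n} := by
  have hU : u n i j ^ n ∈ Algebra.adjoin ℂ {u n i j ^ n, v n i j ^ n} :=
    Algebra.subset_adjoin (by simp)
  have hV : v n i j ^ n ∈ Algebra.adjoin ℂ {u n i j ^ n, v n i j ^ n} :=
    Algebra.subset_adjoin (by simp)
  refine le_antisymm (fun a ha => ?_) ?_
  · refine (isQuantumPlane n i j).mem_of_coeff (S := (Algebra.adjoin ℂ _).toSubmodule)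
      fun k l hkl => ?_
    have key : ∀ (g : Pansera n) (w : ℕ → ℕ → ℤ), (∀ k l, g • (u n i j ^ k * v n i j ^ l) =
        qRoot n ^ w k l • (u n i j ^ k * v n i j ^ l)) → g • a = a → (n : ℤ) ∣ w k l := by
      intro g w hg hga
      have e : ∀ b : Aplus n i j, (isQuantumPlane n i j).coeff (k, l) (g • b) =
          qRoot n ^ w k l * (isQuantumPlane n i j).coeff (k, l) b := by
        intro b
        induction b using (isQuantumPlane n i j).induction with
        | hm k' l' =>
          rw [hg, map_smul, smul_eq_mul, (isQuantumPlane n i j).coeff_monomial (k, l) (k', l')]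
          split_ifs with h
          · cases h; rfl
          · simp
        | hadd b c hb hc => rw [smul_add, map_add, map_add, hb, hc, mul_add]
        | hsmul t b hb =>
          rw [smul_comm g, LinearMap.map_smul, LinearMap.map_smul, hb, smul_eq_mul, smul_eq_mul,
            mul_left_comm]
      have e := e a
      rw [hga] at e
      exact (qRoot_zpow_eq_one_iff n _).mp (mul_right_cancel₀ hkl (by rw [← e, one_mul]))
    have hx := key _ _ (x_smul_monomial n i j) ha.1
    have hy := key _ _ (y_smul_monomial n i j) ha.2
    have hcop : IsCoprime (n : ℤ) (i ^ 2 - j ^ 2) :=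
      (Int.isCoprime_iff_gcd_eq_one.mpr hc).symm
    have hk : n ∣ k := by
      have h1 : (n : ℤ) ∣ (i ^ 2 - j ^ 2) * k := by
        have := (hx.mul_left i).sub (hy.mul_left j)
        rwa [show i * (i * k + j * l) - j * (j * k + i * l) = (i ^ 2 - j ^ 2) * k by ring] at this
      exact_mod_cast hcop.dvd_of_dvd_mul_left h1
    have hl : n ∣ l := by
      have h1 : (n : ℤ) ∣ (i ^ 2 - j ^ 2) * l := by
        have := (hy.mul_left i).sub (hx.mul_left j)
        rwa [show i * (j * k + i * l) - j * (i * k + j * l) = (i ^ 2 - j ^ 2) * l by ring] at this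
      exact_mod_cast hcop.dvd_of_dvd_mul_left h1
    obtain ⟨k, rfl⟩ := hk
    obtain ⟨l, rfl⟩ := hl
    rw [pow_mul, pow_mul]
    exact Subalgebra.mul_mem _ (pow_mem hU k) (pow_mem hV l)
  · rw [Algebra.adjoin_le_iff, Set.insert_subset_iff, Set.singleton_subset_iff]
    exact ⟨⟨x_smul_u_pow_self, y_smul_u_pow_self⟩, ⟨x_smul_v_pow_self, y_smul_v_pow_self⟩⟩

theorem u_pow_mem_xyFixed : u n i j ^ n ∈ xyFixed n i j := ⟨x_smul_u_pow_self, y_smul_u_pow_self⟩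

theorem v_pow_mem_xyFixed : v n i j ^ n ∈ xyFixed n i j := ⟨x_smul_v_pow_self, y_smul_v_pow_self⟩

theorem z_smul_add (h : Odd n ∨ Even (i * j)) :
    gen n .z • (u n i j ^ n + v n i j ^ n) = u n i j ^ n + v n i j ^ n := by
  rw [smul_add, z_smul_u_pow_self h, z_smul_v_pow_self h, add_comm]

theorem z_smul_sub (h : Odd n ∨ Even (i * j)) :
    gen n .z • (u n i j ^ n - v n i j ^ n) = -(u n i j ^ n - v n i j ^ n) := by
  rw [smul_sub, z_smul_u_pow_self h, z_smul_v_pow_self h, neg_sub]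

/-- The factors come out in reversed order. Thus u^n v^n is invariant when u^n and v^n commute and
antiinvariant when they anticommute. -/
theorem z_smul_prod (h : Odd n ∨ Even (i * j)) :
    gen n .z • (u n i j ^ n * v n i j ^ n) = v n i j ^ n * u n i j ^ n := by
  rw [z_smul_mul_of_mem u_pow_mem_xyFixed v_pow_mem_xyFixed, z_smul_u_pow_self h,
    z_smul_v_pow_self h]

omit [NeZero n] in
theorem eq_zero_of_neg_eq_self {a : Aplus n i j} (h : -a = a) : a = 0 := by
  have : (2 : ℂ) • a = 0 := by rw [two_smul]; nth_rewrite 1 [← h]; exact neg_add_cancel a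
  exact (smul_eq_zero.mp this).resolve_left two_ne_zero

theorem add_mem_fixedRing (h : Odd n ∨ Even (i * j)) :
    u n i j ^ n + v n i j ^ n ∈ fixedRing (Pansera n) (Aplus n i j) :=
  (mem_fixedRing_iff_z _).mpr ⟨add_mem u_pow_mem_xyFixed v_pow_mem_xyFixed, z_smul_add h⟩

/-- An invariant of x and y is b + b'(U - V) with b, b' in the right-hand algebra, and z turns it
into b - b'(U - V). Invariance under z removes the second term. -/
theorem fixedRing_eq_adjoin_of_even (hc : Int.gcd (i ^ 2 - j ^ 2) n = 1) (hn : Even n) :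
    fixedRing (Pansera n) (Aplus n i j) =
      Algebra.adjoin ℂ {u n i j ^ n + v n i j ^ n, u n i j ^ n * v n i j ^ n} := by
  have h : Odd n ∨ Even (i * j) := Or.inr (even_mul_of_gcd hc hn)
  have hle : Algebra.adjoin ℂ {u n i j ^ n + v n i j ^ n, u n i j ^ n * v n i j ^ n} ≤
      fixedRing (Pansera n) (Aplus n i j) := by
    rw [Algebra.adjoin_le_iff, Set.insert_subset_iff, Set.singleton_subset_iff]
    refine ⟨add_mem_fixedRing h, (mem_fixedRing_iff_z _).mpr
      ⟨mul_mem u_pow_mem_xyFixed v_pow_mem_xyFixed, ?_⟩⟩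
    rw [z_smul_prod h, v_pow_mul_u_pow_of_even n i j hn]
  refine le_antisymm (fun a ha => ?_) hle
  obtain ⟨hxy, hz⟩ := (mem_fixedRing_iff_z a).mp ha
  rw [xyFixed_eq_adjoin hc] at hxy
  obtain ⟨b, hb, b', hb', rfl⟩ :=
    exists_eq_add_mul_of_commute (v_pow_mul_u_pow_of_even n i j hn) hxy
  obtain ⟨-, hbz⟩ := (mem_fixedRing_iff_z _).mp (hle hb)
  obtain ⟨hbx', hbz'⟩ := (mem_fixedRing_iff_z _).mp (hle hb')
  rw [smul_add, z_smul_mul_of_mem hbx' (sub_mem u_pow_mem_xyFixed v_pow_mem_xyFixed), hbz, hbz',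
    z_smul_sub h, mul_neg] at hz
  rwa [eq_zero_of_neg_eq_self (add_left_cancel hz), add_zero]

theorem adjoin_le_fixedRing_of_odd (hn : Odd n) :
    Algebra.adjoin ℂ {u n i j ^ n + v n i j ^ n,
      u n i j ^ n * v n i j ^ n * (u n i j ^ n - v n i j ^ n)} ≤
      fixedRing (Pansera n) (Aplus n i j) := by
  have h : Odd n ∨ Even (i * j) := Or.inl hn
  rw [Algebra.adjoin_le_iff, Set.insert_subset_iff, Set.singleton_subset_iff]
  have hw := mul_mem (u_pow_mem_xyFixed (n := n) (i := i) (j := j)) v_pow_mem_xyFixed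
  have hd := sub_mem (u_pow_mem_xyFixed (n := n) (i := i) (j := j)) v_pow_mem_xyFixed
  refine ⟨add_mem_fixedRing h, (mem_fixedRing_iff_z _).mpr ⟨mul_mem hw hd, ?_⟩⟩
  rw [z_smul_mul_of_mem hw hd, z_smul_prod h, z_smul_sub h, v_pow_mul_u_pow_of_odd n i j hn,
    neg_mul_neg]

theorem z_smul_prod_of_odd (hn : Odd n) :
    gen n .z • (u n i j ^ n * v n i j ^ n) = -(u n i j ^ n * v n i j ^ n) := by
  rw [z_smul_prod (Or.inl hn), v_pow_mul_u_pow_of_odd n i j hn]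

/-- The decomposition of the invariants of `x` and `y` for odd `n`. -/
theorem exists_of_mem_xyFixed_of_odd (hc : Int.gcd (i ^ 2 - j ^ 2) n = 1) (hn : Odd n)
    {a : Aplus n i j} (ha : a ∈ xyFixed n i j) :
    ∃ b ∈ Algebra.adjoin ℂ {u n i j ^ n + v n i j ^ n,
        u n i j ^ n * v n i j ^ n * (u n i j ^ n - v n i j ^ n)},
      ∃ b' ∈ fixedRing (Pansera n) (Aplus n i j), ∃ b'' ∈ fixedRing (Pansera n) (Aplus n i j),
      a = b + (b' * (u n i j ^ n - v n i j ^ n) + b'' * (u n i j ^ n * v n i j ^ n)) ∧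
      gen n .z • a =
        b - (b' * (u n i j ^ n - v n i j ^ n) + b'' * (u n i j ^ n * v n i j ^ n)) := by
  have h : Odd n ∨ Even (i * j) := Or.inl hn
  rw [xyFixed_eq_adjoin hc] at ha
  obtain ⟨b, hb, b', hb', b'', hb'', rfl⟩ :=
    exists_eq_add_mul_of_anticommute (v_pow_mul_u_pow_of_odd n i j hn) ha
  have hle := adjoin_le_fixedRing_of_odd (i := i) (j := j) hn
  obtain ⟨-, hbz⟩ := (mem_fixedRing_iff_z _).mp (hle hb)
  obtain ⟨hbx', hbz'⟩ := (mem_fixedRing_iff_z _).mp (hle hb')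
  obtain ⟨hbx'', hbz''⟩ := (mem_fixedRing_iff_z _).mp (hle hb'')
  refine ⟨b, hb, b', hle hb', b'', hle hb'', add_assoc _ _ _, ?_⟩
  rw [smul_add, smul_add, z_smul_mul_of_mem hbx' (sub_mem u_pow_mem_xyFixed v_pow_mem_xyFixed),
    z_smul_mul_of_mem hbx'' (mul_mem u_pow_mem_xyFixed v_pow_mem_xyFixed), hbz, hbz', hbz'',
    z_smul_sub h, z_smul_prod_of_odd hn]
  noncomm_ring

/-- The terms in U - V and UV are both negated by z, so they cancel out of an invariant and only the
part in the displayed subalgebra remains. -/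
theorem fixedRing_eq_adjoin_of_odd (hc : Int.gcd (i ^ 2 - j ^ 2) n = 1) (hn : Odd n) :
    fixedRing (Pansera n) (Aplus n i j) = Algebra.adjoin ℂ {u n i j ^ n + v n i j ^ n,
      u n i j ^ n * v n i j ^ n * (u n i j ^ n - v n i j ^ n)} := by
  refine le_antisymm (fun a ha => ?_) (adjoin_le_fixedRing_of_odd hn)
  obtain ⟨hxy, hz⟩ := (mem_fixedRing_iff_z a).mp ha
  obtain ⟨b, hb, b', -, b'', -, e, ez⟩ := exists_of_mem_xyFixed_of_odd hc hn hxy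
  rw [ez, e, sub_eq_add_neg] at hz
  rwa [e, eq_zero_of_neg_eq_self (add_left_cancel hz), add_zero]

end Aplus
end

/-! ### Even n: the fixed ring is a polynomial ring -/

noncomputable section

section

variable {A : Type} [Ring A] [Algebra ℂ A] {x y : A}

/-- The evaluation of a polynomial in two variables at two commuting elements. -/
def Commute.aeval (h : Commute x y) : MvPolynomial (Fin 2) ℂ →ₐ[ℂ] A :=
  AddMonoidAlgebra.lift ℂ A (Fin 2 →₀ ℕ)
    { toFun := fun m => x ^ m.toAdd 0 * y ^ m.toAdd 1
      map_one' := by simp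
      map_mul' := fun m m' => by
        simp only [toAdd_mul, Finsupp.add_apply, pow_add]
        rw [mul_assoc, mul_assoc, ← mul_assoc (x ^ m'.toAdd 0), (h.pow_pow _ _).eq]
        simp only [mul_assoc] }

theorem Commute.aeval_monomial (h : Commute x y) (m : Fin 2 →₀ ℕ) (t : ℂ) :
    h.aeval (MvPolynomial.monomial m t) = t • (x ^ m 0 * y ^ m 1) := by
  rw [← MvPolynomial.single_eq_monomial]
  exact AddMonoidAlgebra.lift_single _ _ _

theorem Commute.aeval_X_zero (h : Commute x y) : h.aeval (MvPolynomial.X 0) = x := by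
  rw [MvPolynomial.X, h.aeval_monomial]; simp

theorem Commute.aeval_X_one (h : Commute x y) : h.aeval (MvPolynomial.X 1) = y := by
  rw [MvPolynomial.X, h.aeval_monomial]; simp

/-- Evaluating at commuting powers of the generators of a quantum plane is injective. -/
theorem IsQuantumPlane.aeval_pow_injective {c : ℂ} (hq : IsQuantumPlane c x y) {n : ℕ} (hn : n ≠ 0)
    (h : Commute (x ^ n) (y ^ n)) : Function.Injective h.aeval := by
  rw [injective_iff_map_eq_zero]
  intro p hp
  -- Since n ≠ 0, different exponents m give different monomials, and the coefficient of p at m can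
  -- be read off at x^(n m 0) y^(n m 1).
  have key : ∀ p m, hq.coeff (n * m 0, n * m 1) (h.aeval p) = MvPolynomial.coeff m p := by
    intro p m
    induction p using MvPolynomial.induction_on' with
    | monomial m' t =>
      rw [h.aeval_monomial, map_smul, ← pow_mul, ← pow_mul, MvPolynomial.coeff_monomial]
      have e := hq.coeff_monomial (n * m 0, n * m 1) (n * m' 0, n * m' 1)
      simp only [Prod.mk.injEq, Nat.mul_right_inj hn] at e
      have e' : m' = m ↔ m' 0 = m 0 ∧ m' 1 = m 1 := by
        rw [Finsupp.ext_iff, Fin.forall_fin_two]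
      rw [e]
      simp only [e', smul_eq_mul, mul_ite, mul_one, mul_zero]
    | add p p' h1 h2 => rw [map_add, map_add, h1, h2, MvPolynomial.coeff_add]
  ext m
  rw [← key, hp, map_zero, MvPolynomial.coeff_zero]

/-- The elementary symmetric functions of two commuting powers of the generators of a quantum plane
generate a polynomial ring. -/
theorem IsQuantumPlane.exists_algEquiv_adjoin {c : ℂ} (hq : IsQuantumPlane c x y) {n : ℕ}
    (hn : n ≠ 0) (h : Commute (x ^ n) (y ^ n)) :
    ∃ e : MvPolynomial (Fin 2) ℂ ≃ₐ[ℂ] Algebra.adjoin ℂ {x ^ n + y ^ n, x ^ n * y ^ n},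
      (e (MvPolynomial.X 0) : A) = x ^ n + y ^ n ∧ (e (MvPolynomial.X 1) : A) = x ^ n * y ^ n := by
  -- The variables go to the two elementary symmetric polynomials and are then evaluated at the
  -- powers. The first map is injective by the fundamental theorem on symmetric polynomials.
  let f : MvPolynomial (Fin 2) ℂ →ₐ[ℂ] A := h.aeval.comp
    ((MvPolynomial.symmetricSubalgebra (Fin 2) ℂ).val.comp (MvPolynomial.esymmAlgHom (Fin 2) ℂ 2))
  have hf : Function.Injective f := (hq.aeval_pow_injective hn h).comp
    (Subtype.val_injective.comp (MvPolynomial.esymmAlgHom_fin_injective ℂ le_rfl))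
  have h0 : f (MvPolynomial.X 0) = x ^ n + y ^ n := by
    change h.aeval (MvPolynomial.esymmAlgHom (Fin 2) ℂ 2 (MvPolynomial.X 0) :
      MvPolynomial (Fin 2) ℂ) = _
    rw [MvPolynomial.esymmAlgHom_apply, MvPolynomial.aeval_X, Fin.val_zero, zero_add,
      MvPolynomial.esymm_one, Fin.sum_univ_two, map_add, h.aeval_X_zero, h.aeval_X_one]
  have h1 : f (MvPolynomial.X 1) = x ^ n * y ^ n := by
    change h.aeval (MvPolynomial.esymmAlgHom (Fin 2) ℂ 2 (MvPolynomial.X 1) :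
      MvPolynomial (Fin 2) ℂ) = _
    have e : MvPolynomial.esymm (Fin 2) ℂ 2 = MvPolynomial.X 0 * MvPolynomial.X 1 := by
      rw [MvPolynomial.esymm, show Finset.powersetCard 2 (Finset.univ : Finset (Fin 2)) =
        {Finset.univ} from Finset.powersetCard_self _, Finset.sum_singleton, Fin.prod_univ_two]
    rw [MvPolynomial.esymmAlgHom_apply, MvPolynomial.aeval_X, Fin.val_one, e, map_mul,
      h.aeval_X_zero, h.aeval_X_one]
  have hr : f.range = Algebra.adjoin ℂ {x ^ n + y ^ n, x ^ n * y ^ n} := by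
    rw [← Algebra.map_top, ← MvPolynomial.adjoin_range_X, AlgHom.map_adjoin, ← Set.range_comp]
    congr 1
    ext a
    simp only [Set.mem_range, Function.comp_apply, Fin.exists_fin_two, h0, h1,
      Set.mem_insert_iff, Set.mem_singleton_iff]
    tauto
  exact ⟨(AlgEquiv.ofInjective f hf).trans (Subalgebra.equivOfEq _ _ hr), h0, h1⟩

/-- A polynomial ring in two variables is a quantum plane with parameter `1`. -/
theorem isQuantumPlane_of_algEquiv (e : MvPolynomial (Fin 2) ℂ ≃ₐ[ℂ] A) :
    IsQuantumPlane 1 (e (MvPolynomial.X 0)) (e (MvPolynomial.X 1)) := by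
  have hm : ∀ m : Fin 2 →₀ ℕ, MvPolynomial.monomial m (1 : ℂ) =
      MvPolynomial.X 0 ^ m 0 * MvPolynomial.X 1 ^ m 1 := by
    intro m
    rw [MvPolynomial.monomial_eq, MvPolynomial.C_1, one_mul,
      Finsupp.prod_fintype _ _ (by simp), Fin.prod_univ_two]
  refine ⟨by rw [one_smul, ← map_mul, mul_comm, map_mul], one_ne_zero, ?_, ?_⟩
  · let g : ℕ × ℕ → (Fin 2 →₀ ℕ) := fun k => Finsupp.equivFunOnFinite.symm ![k.1, k.2]
    have hg : Function.Injective g := fun k l hkl => by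
      have h0 := DFunLike.congr_fun hkl 0
      have h1 := DFunLike.congr_fun hkl 1
      exact Prod.ext (by simpa [g] using h0) (by simpa [g] using h1)
    have := (((MvPolynomial.basisMonomials (Fin 2) ℂ).linearIndependent.comp g hg).map'
      e.toLinearMap (LinearMap.ker_eq_bot.mpr e.injective))
    have e1 : (fun k : ℕ × ℕ => e (MvPolynomial.X 0) ^ k.1 * e (MvPolynomial.X 1) ^ k.2) =
        e.toLinearMap ∘ MvPolynomial.basisMonomials (Fin 2) ℂ ∘ g := by
      funext k
      simp [g, hm]
    rw [e1]
    exact this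
  · intro a _
    obtain ⟨p, rfl⟩ := e.surjective a
    induction p using MvPolynomial.induction_on' with
    | monomial m t =>
      have e1 : MvPolynomial.monomial m t = t • MvPolynomial.monomial m (1 : ℂ) := by
        rw [MvPolynomial.smul_monomial, smul_eq_mul, mul_one]
      rw [e1, hm, map_smul, map_mul, map_pow, map_pow]
      exact Submodule.smul_mem _ _ (Submodule.subset_span ⟨(m 0, m 1), rfl⟩)
    | add p p' h1 h2 => rw [map_add]; exact Submodule.add_mem _ (h1 trivial) (h2 trivial)

end

namespace Aplus

open Pansera

variable {n : ℕ} {i j : ℤ} [NeZero n]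

theorem isReflectionHopfAlgebra {d e : ℕ} (hc : Int.gcd (i ^ 2 - j ^ 2) n = 1) (hd : 0 < d)
    (he : 0 < e) {c : ℂ} {f g : fixedRing (Pansera n) (Aplus n i j)} (h : IsQuantumPlane c f g)
    (hf : (f : Aplus n i j) ∈ grading n i j d) (hg : (g : Aplus n i j) ∈ grading n i j e) :
    IsReflectionHopfAlgebra (Pansera n) (grading n i j) where
  finiteDimensional := Pansera.finiteDimensional n
  semisimple := Pansera.isSemisimpleRing n
  regular := ⟨2, isASRegularOfDim_grading n i j⟩
  smul_mem := smul_mem_grading n i j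
  innerFaithful := isInnerFaithful_of_gcd hc
  fixed_regular := ⟨2, h.isASRegularOfDim
    ((isConnectedGraded n i j).fixedGrading (smul_mem_grading n i j)) hd he hf hg⟩

theorem exists_algEquiv_fixedRing (hc : Int.gcd (i ^ 2 - j ^ 2) n = 1) (hn : Even n) :
    ∃ e : MvPolynomial (Fin 2) ℂ ≃ₐ[ℂ] fixedRing (Pansera n) (Aplus n i j),
      (e (MvPolynomial.X 0) : Aplus n i j) = u n i j ^ n + v n i j ^ n ∧
      (e (MvPolynomial.X 1) : Aplus n i j) = u n i j ^ n * v n i j ^ n := by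
  obtain ⟨e, h0, h1⟩ := (isQuantumPlane n i j).exists_algEquiv_adjoin (NeZero.ne n)
    (v_pow_mul_u_pow_of_even n i j hn).symm
  exact ⟨e.trans (Subalgebra.equivOfEq _ _ (fixedRing_eq_adjoin_of_even hc hn).symm), h0, h1⟩

/-- A polynomial ring in two variables is the quantum plane with parameter 1, so the regularity
theorem applies again, now with generators of degrees n and 2n. -/
theorem isReflectionHopfAlgebra_of_even (hc : Int.gcd (i ^ 2 - j ^ 2) n = 1) (hn : Even n) :
    IsReflectionHopfAlgebra (Pansera n) (grading n i j) := by
  obtain ⟨e, h0, h1⟩ := exists_algEquiv_fixedRing (i := i) (j := j) hc hn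
  have hpos := NeZero.pos n
  refine isReflectionHopfAlgebra hc hpos (show 0 < n + n by omega) (isQuantumPlane_of_algEquiv e)
    ?_ ?_
  · rw [h0]
    have hu := IsQuantumPlane.monomial_mem_span_pow (u := u n i j) (v := v n i j) n 0
    have hv := IsQuantumPlane.monomial_mem_span_pow (u := u n i j) (v := v n i j) 0 n
    rw [pow_zero, mul_one] at hu
    rw [pow_zero, one_mul, zero_add] at hv
    exact Submodule.add_mem _ hu hv
  · rw [h1]
    exact IsQuantumPlane.monomial_mem_span_pow n n

end Aplus
end

/-! ### Odd n: the antiinvariants are their own syzygy -/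

noncomputable section

section

open CategoryTheory

/-- A ring with a non-projective module that is its own syzygy has infinite global dimension. -/
theorem globalDimension_ne_of_exact {F M : Type} [Ring F] [AddCommGroup M] [Module F M]
    (f : M →ₗ[F] F × F) (g : F × F →ₗ[F] M) (hf : Function.Injective f)
    (hg : Function.Surjective g) (hfg : Function.Exact f g) (hM : ¬ Module.Projective F M) (d : ℕ) :
    globalDimension F ≠ d := by
  obtain ⟨w, hw⟩ := ModuleCat.shortExact_of_linearMap f g hf hg hfg
  have hP : Projective (ModuleCat.of F (F × F)) :=
    (IsProjective.iff_projective (F × F)).mp inferInstance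
  -- Shifting along M → F² → M lowers a bound on the projective dimension of M by one for the same
  -- M, down to projectivity.
  have key : ∀ m : ℕ, ¬ HasProjectiveDimensionLT (ModuleCat.of F M) (m + 1) := by
    intro m
    induction m with
    | zero =>
      rw [zero_add, ← projective_iff_hasProjectiveDimensionLT_one]
      exact fun h => hM ((IsProjective.iff_projective M).mpr h)
    | succ m ih => exact fun h => ih ((hw.hasProjectiveDimensionLT_X₃_iff m hP).mp h)
  intro hd
  have h1 : projectiveDimension (ModuleCat.of F M) ≤ d :=
    hd ▸ le_iSup (fun M : ModuleCat.{0} F => projectiveDimension M) (ModuleCat.of F M)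
  exact key d ((projectiveDimension_le_iff _ _).mp h1)

end

namespace IsQuantumPlane

variable {A : Type} [Ring A] [Algebra ℂ A] {c : ℂ} {u v : A} (h : IsQuantumPlane c u v)
include h

theorem coeff_mul_right_pow_of_lt (n : ℕ) (a : A) (i : ℕ) {j : ℕ} (hj : j < n) :
    h.coeff (i, j) (a * v ^ n) = 0 := by
  induction n generalizing j with
  | zero => omega
  | succ n ih =>
    rw [pow_succ, ← mul_assoc]
    cases j with
    | zero => exact h.coeff_mul_right_zero _ _
    | succ j => rw [h.coeff_mul_right_succ]; exact ih (by omega)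

theorem coeff_mul_left_pow_of_lt (n : ℕ) (a : A) (j : ℕ) {i : ℕ} (hi : i < n) :
    h.coeff (i, j) (a * u ^ n) = 0 := by
  induction n generalizing i with
  | zero => omega
  | succ n ih =>
    rw [pow_succ, ← mul_assoc]
    cases i with
    | zero => exact h.coeff_mul_left_zero _ _
    | succ i => rw [h.coeff_mul_left_succ, ih (by omega), mul_zero]

theorem coeff_mul_right_pow (n : ℕ) (a : A) (i j : ℕ) :
    h.coeff (i, j + n) (a * v ^ n) = h.coeff (i, j) a := by
  induction n with
  | zero => simp
  | succ n ih => rw [pow_succ, ← mul_assoc, ← add_assoc, h.coeff_mul_right_succ, ih]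

theorem coeff_mul_left_pow (n : ℕ) (a : A) (i j : ℕ) :
    h.coeff (i + n, j) (a * u ^ n) = (c ^ j) ^ n * h.coeff (i, j) a := by
  induction n with
  | zero => simp
  | succ n ih =>
    rw [pow_succ, ← mul_assoc, ← add_assoc, h.coeff_mul_left_succ, ih, ← mul_assoc, pow_succ']

theorem eq_zero_of_mul_monomial {k l : ℕ} {a : A} (ha : a * (u ^ k * v ^ l) = 0) : a = 0 := by
  rw [← mul_assoc] at ha
  have h1 : a * u ^ k = 0 := h.ext_coeff fun i j => by
    rw [← h.coeff_mul_right_pow l, ha, map_zero, map_zero]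
  refine h.ext_coeff fun i j => ?_
  have e := h.coeff_mul_left_pow k a i j
  rw [h1, map_zero] at e
  rw [map_zero]
  exact (mul_eq_zero.mp e.symm).resolve_left (pow_ne_zero _ (pow_ne_zero _ h.ne_zero))

theorem eq_zero_of_monomial_mul {k l : ℕ} {a : A} (ha : u ^ k * v ^ l * a = 0) : a = 0 := by
  have key : ∀ b : A, (∀ a, b * a = 0 → a = 0) → ∀ m a, b ^ m * a = 0 → a = 0 := by
    intro b hb m
    induction m with
    | zero => simp
    | succ m ih => exact fun a ha => hb a (ih _ (by rwa [pow_succ, mul_assoc] at ha))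
  rw [mul_assoc] at ha
  exact key v (fun a => h.eq_zero_of_right_mul) l _
    (key u (fun a => h.eq_zero_of_left_mul) k _ ha)

theorem coeff_monomial_mul {k l : ℕ} (hk : 0 < k) (a : A) :
    h.coeff (0, 0) (u ^ k * v ^ l * a) = 0 := by
  obtain ⟨k, rfl⟩ := Nat.exists_eq_add_one.mpr hk
  rw [pow_succ', mul_assoc, mul_assoc, h.coeff_left_mul_zero]

theorem coeff_pow_mul {l : ℕ} (hl : 0 < l) (a : A) : h.coeff (0, 0) (v ^ l * a) = 0 := by
  obtain ⟨l, rfl⟩ := Nat.exists_eq_add_one.mpr hl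
  rw [pow_succ', mul_assoc, h.coeff_right_mul_zero]

omit h in
-- Rewritten as UV(U - V) + (U - V)UV = 0, this is the syzygy of (U - V, UV) whose entries are the
-- generators themselves, interchanged. It is the source of the self-syzygy.
theorem _root_.sub_mul_mul_of_anticommute {A : Type} [Ring A] {U V : A} (hUV : V * U = -(U * V)) :
    (U - V) * (U * V) = -(U * V * (U - V)) := by
  rw [sub_mul, mul_sub, ← mul_assoc V, hUV, mul_assoc U V U, hUV]
  noncomm_ring

/-- For anticommuting `U = u ^ n` and `V = v ^ n`, the syzygies of the pair `(U - V, UV)` are the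
multiples of `(UV, U - V)`. -/
theorem exists_syzygy {n : ℕ} (hn : v ^ n * u ^ n = -(u ^ n * v ^ n)) {a b : A}
    (hab : a * (u ^ n - v ^ n) + b * (u ^ n * v ^ n) = 0) :
    ∃ f, a = f * (u ^ n * v ^ n) ∧ b = f * (u ^ n - v ^ n) := by
  -- With U = u^n and V = v^n, the relation gives aU ∈ AV and, using VU = -UV, also aV ∈ AU. The aim
  -- is to divide a by V and then by U.
  have h1 : a * u ^ n = (a - b * u ^ n) * v ^ n := by
    rw [← sub_eq_zero, ← hab, sub_mul, mul_assoc b, mul_sub]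
    abel
  have h2 : a * v ^ n = (a - b * v ^ n) * u ^ n := by
    rw [← sub_eq_zero, ← neg_eq_zero, ← hab, sub_mul, mul_assoc b, hn, mul_neg, mul_sub]
    abel
  obtain ⟨e, rfl⟩ := h.exists_eq_mul_right_pow n (a := a) fun i j hj => by
    have e := h.coeff_mul_left_pow n a i j
    rw [h1, h.coeff_mul_right_pow_of_lt _ _ _ hj] at e
    exact (mul_eq_zero.mp e.symm).resolve_left (pow_ne_zero _ (pow_ne_zero _ h.ne_zero))
  -- Here a = eV, so aV = eV² lies in AU. Right multiplication by V preserves u-exponents, hence U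
  -- divides e on the right.
  obtain ⟨f, rfl⟩ := h.exists_eq_mul_left_pow n (a := e) fun j i hi => by
    rw [← h.coeff_mul_right_pow n, ← h.coeff_mul_right_pow n, h2,
      h.coeff_mul_left_pow_of_lt _ _ _ hi]
  refine ⟨f, mul_assoc _ _ _, ?_⟩
  have h3 : (b - f * (u ^ n - v ^ n)) * (u ^ n * v ^ n) = 0 := by
    rw [sub_mul, mul_assoc f, sub_mul_mul_of_anticommute hn, mul_neg, sub_neg_eq_add, add_comm,
      ← hab]
    simp only [mul_assoc]
  exact sub_eq_zero.mp (h.eq_zero_of_mul_monomial h3)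

end IsQuantumPlane

namespace Aplus

open Pansera

variable {n : ℕ} {i j : ℤ} [NeZero n]

variable (n i j) in
/-- The module of the elements fixed by `x` and `y` and negated by `z`, over the fixed ring. -/
def antiFixed : Submodule (fixedRing (Pansera n) (Aplus n i j)) (Aplus n i j) where
  carrier := {a | a ∈ xyFixed n i j ∧ gen n .z • a = -a}
  zero_mem' := ⟨zero_mem _, by simp⟩
  add_mem' := fun ha hb => ⟨add_mem ha.1 hb.1, by rw [smul_add, ha.2, hb.2, neg_add]⟩
  smul_mem' := fun f a ha => by
    obtain ⟨h1, h2⟩ := (mem_fixedRing_iff_z _).mp f.2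
    refine ⟨mul_mem h1 ha.1, ?_⟩
    rw [Subalgebra.smul_def, smul_eq_mul, z_smul_mul_of_mem h1 ha.1, h2, ha.2, mul_neg]

theorem sub_mem_antiFixed (hn : Odd n) : u n i j ^ n - v n i j ^ n ∈ antiFixed n i j :=
  ⟨sub_mem u_pow_mem_xyFixed v_pow_mem_xyFixed, z_smul_sub (Or.inl hn)⟩

theorem prod_mem_antiFixed (hn : Odd n) : u n i j ^ n * v n i j ^ n ∈ antiFixed n i j :=
  ⟨mul_mem u_pow_mem_xyFixed v_pow_mem_xyFixed, z_smul_prod_of_odd hn⟩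

theorem mul_mem_fixedRing {a b : Aplus n i j} (ha : a ∈ antiFixed n i j)
    (hb : b ∈ antiFixed n i j) : a * b ∈ fixedRing (Pansera n) (Aplus n i j) :=
  (mem_fixedRing_iff_z _).mpr ⟨mul_mem ha.1 hb.1, by
    rw [z_smul_mul_of_mem ha.1 hb.1, ha.2, hb.2, neg_mul_neg]⟩

/-- Right multiplication by `b` as a map from the antiinvariants to the invariants. -/
def antiMul {b : Aplus n i j} (hb : b ∈ antiFixed n i j) :
    antiFixed n i j →ₗ[fixedRing (Pansera n) (Aplus n i j)]
      fixedRing (Pansera n) (Aplus n i j) where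
  toFun a := ⟨a * b, mul_mem_fixedRing a.2 hb⟩
  map_add' _ _ := Subtype.ext (add_mul _ _ _)
  map_smul' _ _ := Subtype.ext (mul_assoc _ _ _)

/-- The inclusion of the syzygies of the generators `u ^ n - v ^ n`, `u ^ n v ^ n` of the
antiinvariants. -/
def syzygyMap (hn : Odd n) : antiFixed n i j →ₗ[fixedRing (Pansera n) (Aplus n i j)]
    fixedRing (Pansera n) (Aplus n i j) × fixedRing (Pansera n) (Aplus n i j) :=
  (antiMul (prod_mem_antiFixed hn)).prod (antiMul (sub_mem_antiFixed hn))

/-- The presentation of the antiinvariants by the generators `u ^ n - v ^ n`, `u ^ n v ^ n`. -/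
def presentation (hn : Odd n) :
    fixedRing (Pansera n) (Aplus n i j) × fixedRing (Pansera n) (Aplus n i j)
      →ₗ[fixedRing (Pansera n) (Aplus n i j)] antiFixed n i j :=
  (LinearMap.toSpanSingleton _ _ ⟨_, sub_mem_antiFixed hn⟩).coprod
    (LinearMap.toSpanSingleton _ _ ⟨_, prod_mem_antiFixed hn⟩)

theorem coe_presentation (hn : Odd n)
    (p : fixedRing (Pansera n) (Aplus n i j) × fixedRing (Pansera n) (Aplus n i j)) :
    (presentation hn p : Aplus n i j) =
      p.1 * (u n i j ^ n - v n i j ^ n) + p.2 * (u n i j ^ n * v n i j ^ n) := rfl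

theorem syzygyMap_injective (hn : Odd n) :
    Function.Injective (syzygyMap (n := n) (i := i) (j := j) hn) := by
  rw [injective_iff_map_eq_zero]
  intro a ha
  have h1 : (a : Aplus n i j) * (u n i j ^ n * v n i j ^ n) = 0 :=
    congrArg Subtype.val (congrArg Prod.fst ha)
  exact Subtype.ext ((isQuantumPlane n i j).eq_zero_of_mul_monomial h1)

/-- In the decomposition b + b'(U - V) + b''UV, only b is fixed by z, so it vanishes on an
antiinvariant. -/
theorem presentation_surjective (hc : Int.gcd (i ^ 2 - j ^ 2) n = 1) (hn : Odd n) :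
    Function.Surjective (presentation (n := n) (i := i) (j := j) hn) := by
  rintro ⟨a, hxy, hz⟩
  obtain ⟨b, -, b', hb', b'', hb'', e, ez⟩ := exists_of_mem_xyFixed_of_odd hc hn hxy
  refine ⟨(⟨b', hb'⟩, ⟨b'', hb''⟩), Subtype.ext ?_⟩
  rw [coe_presentation]
  have h0 : b = 0 := by
    rw [ez, e, neg_add, sub_eq_add_neg] at hz
    exact eq_zero_of_neg_eq_self (add_right_cancel hz).symm
  rw [h0, zero_add] at e
  exact e.symm

/-- A syzygy over the fixed ring is f·(UV, U - V) with f in A⁺. Since f·UV is fixed, while UV is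
antiinvariant and can be cancelled, f itself is antiinvariant: the syzygies are a copy of the
module. -/
theorem exact_syzygyMap_presentation (hn : Odd n) :
    Function.Exact (syzygyMap (n := n) (i := i) (j := j) hn) (presentation hn) := by
  have hvu := v_pow_mul_u_pow_of_odd n i j hn
  have hq := isQuantumPlane n i j
  rintro ⟨⟨a, ha⟩, ⟨b, hb⟩⟩
  constructor
  · intro hab
    obtain ⟨f, rfl, rfl⟩ := hq.exists_syzygy hvu (congrArg Subtype.val hab)
    have hx : f ∈ xyFixed n i j := by
      obtain ⟨⟨hx, hy⟩, -⟩ := (mem_fixedRing_iff_z _).mp ha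
      obtain ⟨hwx, hwy⟩ := (prod_mem_antiFixed (n := n) (i := i) (j := j) hn).1
      rw [x_smul_mul, hwx] at hx
      rw [y_smul_mul, hwy] at hy
      exact ⟨sub_eq_zero.mp (hq.eq_zero_of_mul_monomial (by rw [sub_mul, hx, sub_self])),
        sub_eq_zero.mp (hq.eq_zero_of_mul_monomial (by rw [sub_mul, hy, sub_self]))⟩
    have hz : gen n .z • f = -f := by
      obtain ⟨-, hz⟩ := (mem_fixedRing_iff_z _).mp ha
      obtain ⟨hw, hwz⟩ := prod_mem_antiFixed (n := n) (i := i) (j := j) hn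
      rw [z_smul_mul_of_mem hx hw, hwz] at hz
      refine eq_neg_of_add_eq_zero_left (hq.eq_zero_of_mul_monomial (k := n) (l := n) ?_)
      rw [add_mul, ← hz]
      noncomm_ring
    exact ⟨⟨f, hx, hz⟩, rfl⟩
  · rintro ⟨f, hf⟩
    have ea : (f : Aplus n i j) * (u n i j ^ n * v n i j ^ n) = a :=
      congrArg Subtype.val (congrArg Prod.fst hf)
    have eb : (f : Aplus n i j) * (u n i j ^ n - v n i j ^ n) = b :=
      congrArg Subtype.val (congrArg Prod.snd hf)
    refine Subtype.ext ?_
    rw [coe_presentation]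
    change a * _ + b * _ = 0
    rw [← ea, ← eb, mul_assoc (f : Aplus n i j), mul_assoc (f : Aplus n i j), sub_mul_mul_of_anticommute hvu, ← mul_add,
      add_neg_cancel, mul_zero]

/-- A section of the presentation gives a retraction onto the syzygies. Applied to the syzygy coming
from UV, and after cancelling UV, it expresses 1 as UV·r + (U - V)·r', which has no constant term.
-/
theorem not_projective_antiFixed (hc : Int.gcd (i ^ 2 - j ^ 2) n = 1) (hn : Odd n) :
    ¬ Module.Projective (fixedRing (Pansera n) (Aplus n i j)) (antiFixed n i j) := by
  intro hP
  have hq := isQuantumPlane n i j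
  obtain ⟨σ, hσ⟩ := Module.projective_lifting_property (presentation (i := i) (j := j) hn)
    LinearMap.id (presentation_surjective hc hn)
  have hσ' : ∀ a, presentation hn (σ a) = a := fun a => LinearMap.congr_fun hσ a
  set d : antiFixed n i j := ⟨_, sub_mem_antiFixed hn⟩ with hd
  set w : antiFixed n i j := ⟨_, prod_mem_antiFixed hn⟩ with hw
  have hdp : presentation hn (1, 0) = d := Subtype.ext (by rw [coe_presentation]; simp [hd])
  have hwp : presentation hn (0, 1) = w := Subtype.ext (by rw [coe_presentation]; simp [hw])
  -- The elements r and r' are the values on the two basis vectors of the retraction given by id - σ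
  -- ∘ `presentation`.
  obtain ⟨r, hr⟩ := (exact_syzygyMap_presentation hn _).mp
    (show presentation hn ((1, 0) - σ d) = 0 by rw [map_sub, hσ', hdp, sub_self])
  obtain ⟨r', hr'⟩ := (exact_syzygyMap_presentation hn _).mp
    (show presentation hn ((0, 1) - σ w) = 0 by rw [map_sub, hσ', hwp, sub_self])
  set f := syzygyMap (n := n) (i := i) (j := j) hn with hf
  have hsum : ∀ p, presentation hn p = p.1 • d + p.2 • w := fun p => rfl
  -- The retraction fixes syzygies: the section contributes nothing, because `f w` is in the kernel
  -- of the presentation.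
  have e : w = (f w).1 • r + (f w).2 • r' := by
    refine syzygyMap_injective hn ?_
    have h0 : (f w).1 • σ d + (f w).2 • σ w = 0 := by
      rw [← map_smul, ← map_smul, ← map_add, ← hsum,
        (exact_syzygyMap_presentation hn _).mpr ⟨w, rfl⟩, map_zero]
    rw [← hf, map_add, map_smul, map_smul, hr, hr', smul_sub, smul_sub, sub_add_sub_comm, h0,
      sub_zero]
    ext <;> simp
  have e1 : u n i j ^ n * v n i j ^ n * (u n i j ^ n * v n i j ^ n * r +
      (u n i j ^ n - v n i j ^ n) * r' - 1) = 0 := by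
    have e2 : u n i j ^ n * v n i j ^ n =
        u n i j ^ n * v n i j ^ n * (u n i j ^ n * v n i j ^ n) * r +
        u n i j ^ n * v n i j ^ n * (u n i j ^ n - v n i j ^ n) * r' := congrArg Subtype.val e
    rw [mul_sub, mul_one, sub_eq_zero, mul_add]
    refine Eq.trans ?_ e2.symm
    simp only [mul_assoc]
  have e3 := congrArg (hq.coeff (0, 0)) (hq.eq_zero_of_monomial_mul e1)
  have hpos := NeZero.pos n
  have hu := hq.coeff_monomial_mul (l := 0) hpos (r' : Aplus n i j)
  have hv := hq.coeff_pow_mul hpos (r' : Aplus n i j)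
  rw [pow_zero, mul_one] at hu
  rw [map_sub, map_add, hq.coeff_monomial_mul hpos, sub_mul, map_sub, hu, hv, hq.coeff_one,
    map_zero] at e3
  norm_num at e3

theorem not_isASRegular_of_odd (hc : Int.gcd (i ^ 2 - j ^ 2) n = 1) (hn : Odd n) :
    ¬ IsASRegular (fixedGrading (Pansera n) (grading n i j)) := by
  rintro ⟨d, hd⟩
  exact globalDimension_ne_of_exact (F := fixedRing (Pansera n) (Aplus n i j))
    (M := antiFixed n i j) (syzygyMap hn) (presentation hn) (syzygyMap_injective hn)
    (presentation_surjective hc hn) (exact_syzygyMap_presentation hn) (not_projective_antiFixed hc hn)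
    d hd.globalDimension_eq

end Aplus

/-! ### The theorem -/

theorem mainTheorem2 (n : ℕ) [NeZero n] (hn : 2 ≤ n) (i j : ℤ) :
    IsASRegularOfDim (Aplus.grading n i j) 2 ∧
    (IsInnerFaithful (Pansera n) (Aplus n i j) ↔ Int.gcd (i ^ 2 - j ^ 2) n = 1) ∧
    (IsInnerFaithful (Pansera n) (Aplus n i j) →
      (Even n →
        (∃ e : MvPolynomial (Fin 2) ℂ ≃ₐ[ℂ] fixedRing (Pansera n) (Aplus n i j),
          (e (MvPolynomial.X 0) : Aplus n i j) =
            Aplus.u n i j ^ n + (-1 : ℂ) ^ (i * j) • Aplus.v n i j ^ n ∧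
          (e (MvPolynomial.X 1) : Aplus n i j) = Aplus.u n i j ^ n * Aplus.v n i j ^ n) ∧
        IsReflectionHopfAlgebra (Pansera n) (Aplus.grading n i j)) ∧
      (Odd n →
        fixedRing (Pansera n) (Aplus n i j) =
          Algebra.adjoin ℂ {Aplus.u n i j ^ n + Aplus.v n i j ^ n,
            Aplus.u n i j ^ n * Aplus.v n i j ^ n * (Aplus.u n i j ^ n - Aplus.v n i j ^ n)} ∧
        IsConnectedGraded (fixedGrading (Pansera n) (Aplus.grading n i j)) ∧
        ¬ IsASRegular (fixedGrading (Pansera n) (Aplus.grading n i j)))) := by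
  refine ⟨Aplus.isASRegularOfDim_grading n i j, Aplus.isInnerFaithful_iff n i j, fun hf => ?_⟩
  have hc := (Aplus.isInnerFaithful_iff n i j).mp hf
  refine ⟨fun he => ⟨?_, Aplus.isReflectionHopfAlgebra_of_even hc he⟩, fun ho =>
    ⟨Aplus.fixedRing_eq_adjoin_of_odd hc ho, (Aplus.isConnectedGraded n i j).fixedGrading
      (Aplus.smul_mem_grading n i j), Aplus.not_isASRegular_of_odd hc ho⟩⟩
  -- For even n, coprimality makes ij even, so the sign (-1)^(ij) in the statement is 1.
  rw [(Aplus.even_mul_of_gcd hc he).neg_one_zpow, one_smul]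
  exact Aplus.exists_algEquiv_fixedRing hc he
end
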